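/- Consider a market with one seller $s$ of a single item and two buyers $b_1,b_2$, with private values $v_s,v_1,v_2\ge 0$. A deterministic direct-revelation mechanism maps each report profile in $\mathbb{R}_{\ge 0}^3$ to the agent who ends up with the item and to a payment for each agent. It is *simple* if it is dominant-strategy incentive compatible, normalized (an agent who does not trade pays $0$), strongly budget balanced (payments always sum to $0$), and ex-post individually rational. Its gains from trade on $(v_s,v_1,v_2)$ are $v_i-v_s$ if buyer $b_i$ gets the item and $0$ if the seller keeps it; $\mathrm{GFT}(M,\mathbf V)$ denotes their expectation under a prior $\mathbf V$, and $\mathrm{OPT}_{\mathrm{simple}}(\mathbf V)$ is the supremum of $\mathrm{GFT}(M,\mathbf V)$ over all simple mechanisms $M$ with Borel measurable allocation rule. A pair $f_1,f_2:\mathbb{R}_{\ge0}\to[0,\infty]$ is *compatible* if there are no $v_1,v_2$ with $v_1>f_1(v_2)$ and $v_2>f_2(v_1)$. In the mechanism $M_{f_1,f_2}$, if $v_1>f_1(v_2)\ge v_s$ then $b_1$ buys from the seller at price $f_1(v_2)$; otherwise, if $v_2>f_2(v_1)\ge v_s$, then $b_2$ buys at price $f_2(v_1)$; otherwise a buyer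 whose value equals her price buys at that price if it is at least $v_s$ (the buyer with the higher value if this applies to both, and $b_1$ if the values are equal); otherwise there is no trade. **Theorem.** There are polynomials $P,Q$ and an algorithm (a real RAM program: integer registers with addition and truncated subtraction, arrays of reals with exact arithmetic and comparisons at unit cost, and an instruction that draws a fresh independent sample from a chosen one of the three distributions) such that the following holds for all $\varepsilon,\delta>0$, with $x=\frac1\varepsilon\log\frac1{\varepsilon\delta}$. 1. On input $(\varepsilon,\delta)$ and on every sequence of samples in $[0,1]$, the algorithm halts after at most $Q(x)$ steps, having drawn at least one and at most $P(x)$ samples from each of the three distributions. It outputs tables of two step functions $f_1,f_2:\mathbb{R}_{\ge 0}\to[0,\infty]$ that form a compatible pair, and the mechanism $M_{f_1,f_2}$ is simple with Borel measurable allocation rule. This mechanism maximizes the expected gains from trade, among all simple mechanisms with Borel measurable allocation rule, for the product of the three empirical distributions of the drawn samples. 2. For all probability distributions $V_s,V_1,V_2$ on $[0,1]$, with $\mathbf V=V_s\times V_1\times V_2$, if the samples are drawn independently from $V_s,V_1,V_2$, then with probability at least $1-\delta$ the output mechanism $M$ satisfies $$\mathrm{GFT}(M,\mathbf V)\ \ge\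 \mathrm{OPT}_{\mathrm{simple}}(\mathbf V)-\varepsilon .$$ -/

import Mathlib

open MeasureTheory Set
open scoped NNReal ENNReal BigOperators

namespace GainsFromTrade

/-! ### The market: one seller, two buyers, one item -/

/-- The three agents: the seller `s` and the buyers `b₁`, `b₂`. -/
inductive Agent
  | s
  | b₁
  | b₂
  deriving DecidableEq

instance : Fintype Agent where
  elems := {Agent.s, Agent.b₁, Agent.b₂}
  complete i := by cases i <;> simp

instance : MeasurableSpace Agent := ⊤

/-- A profile of nonnegative values (or reports), one for each agent. -/
abbrev Profile := Agent → ℝ≥0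

/-- A deterministic direct-revelation mechanism: `alloc r` is the agent that ends up with the item
and `pay r i` the payment made by agent `i` (negative if the agent receives money). -/
structure Mechanism where
  alloc : Profile → Agent
  pay : Profile → Agent → ℝ

namespace Mechanism

/-- Utility of agent `i` with true value `x` when the reports are `r`. -/
noncomputable def utility (M : Mechanism) (i : Agent) (x : ℝ≥0) (r : Profile) : ℝ :=
  match i with
  | .s => -(if M.alloc r ≠ Agent.s then (x : ℝ) else 0) - M.pay r Agent.s
  | .b₁ => (if M.alloc r = Agent.b₁ then (x : ℝ) else 0) - M.pay r Agent.b₁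
  | .b₂ => (if M.alloc r = Agent.b₂ then (x : ℝ) else 0) - M.pay r Agent.b₂

/-- Dominant strategy incentive compatibility: whatever the others report, an agent with true value
`x` does at least as well by reporting `x` as by reporting any `y`. -/
def DSIC (M : Mechanism) : Prop :=
  ∀ (i : Agent) (r : Profile) (x y : ℝ≥0),
    M.utility i x (Function.update r i y) ≤ M.utility i x (Function.update r i x)

/-- Ex-post individual rationality. -/
def IndividuallyRational (M : Mechanism) : Prop :=
  ∀ (i : Agent) (r : Profile) (x : ℝ≥0), 0 ≤ M.utility i x (Function.update r i x)

/-- Strong budget balance. -/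
def StronglyBudgetBalanced (M : Mechanism) : Prop :=
  ∀ r : Profile, ∑ i, M.pay r i = 0

/-- Agent `i` takes part in a trade when the item ends up with `a`. -/
def Wins (i a : Agent) : Prop :=
  match i with
  | .s => a ≠ Agent.s
  | .b₁ => a = Agent.b₁
  | .b₂ => a = Agent.b₂

/-- Normalization: agents that do not trade pay nothing. -/
def Normalized (M : Mechanism) : Prop :=
  ∀ (i : Agent) (r : Profile), ¬ Wins i (M.alloc r) → M.pay r i = 0

/-- A simple mechanism: (deterministic,) DSIC, normalized, ex-post strongly budget balanced and
ex-post individually rational. -/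
structure IsSimple (M : Mechanism) : Prop where
  dsic : M.DSIC
  normalized : M.Normalized
  stronglyBudgetBalanced : M.StronglyBudgetBalanced
  individuallyRational : M.IndividuallyRational

/-- Gains from trade on the value profile `v`, under truthful reports. -/
noncomputable def gft (M : Mechanism) (v : Profile) : ℝ :=
  (if M.alloc v = Agent.b₁ then (v Agent.b₁ : ℝ) - v Agent.s else 0) +
    (if M.alloc v = Agent.b₂ then (v Agent.b₂ : ℝ) - v Agent.s else 0)

/-- Expected gains from trade for a prior `μ` on value profiles. -/
noncomputable def expectedGFT (M : Mechanism) (μ : Measure Profile) : ℝ :=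
  ∫ v, M.gft v ∂μ

end Mechanism

/-- The optimal expected gains from trade of a simple mechanism (with a Borel measurable allocation
rule, so that the expectation is meaningful) for the prior `μ`. -/
noncomputable def optSimple (μ : Measure Profile) : ℝ :=
  sSup {g | ∃ M : Mechanism, M.IsSimple ∧ Measurable M.alloc ∧ g = M.expectedGFT μ}

/-! ### Mechanisms given by a pair of price functions -/

/-- Compatibility of a pair of price functions, `f₁` a function of the value of buyer 2 and `f₂` a
function of the value of buyer 1. -/
def Compatible (f₁ f₂ : ℝ≥0 → ℝ≥0∞) : Prop :=
  ¬ ∃ v₁ v₂ : ℝ≥0, f₁ v₂ < v₁ ∧ f₂ v₁ < v₂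

open Classical in
/-- The owner of the item and the price, on the reports `r`, in the mechanism of the pair
`(f₁, f₂)`. A buyer above her price trades with a seller at or below it; ties are broken in favour
of trade, and then in favour of the higher value. -/
noncomputable def pairOutcome (f₁ f₂ : ℝ≥0 → ℝ≥0∞) (r : Profile) : Agent × ℝ≥0 :=
  let v₁ : ℝ≥0∞ := r Agent.b₁
  let v₂ : ℝ≥0∞ := r Agent.b₂
  let vs : ℝ≥0∞ := r Agent.s
  let p₁ := f₁ (r Agent.b₂)
  let p₂ := f₂ (r Agent.b₁)
  if p₁ < v₁ ∧ vs ≤ p₁ then (Agent.b₁, p₁.toNNReal)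
  else if p₂ < v₂ ∧ vs ≤ p₂ then (Agent.b₂, p₂.toNNReal)
  else if (v₁ = p₁ ∧ vs ≤ p₁) ∧ (v₂ = p₂ ∧ vs ≤ p₂) then
    if v₂ ≤ v₁ then (Agent.b₁, p₁.toNNReal) else (Agent.b₂, p₂.toNNReal)
  else if v₁ = p₁ ∧ vs ≤ p₁ then (Agent.b₁, p₁.toNNReal)
  else if v₂ = p₂ ∧ vs ≤ p₂ then (Agent.b₂, p₂.toNNReal)
  else (Agent.s, 0)

/-- The mechanism corresponding to the pair `(f₁, f₂)`: the buyer who gets the item pays the price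
to the seller, and nobody else pays. -/
noncomputable def pairMechanism (f₁ f₂ : ℝ≥0 → ℝ≥0∞) : Mechanism where
  alloc r := (pairOutcome f₁ f₂ r).1
  pay r i :=
    if (pairOutcome f₁ f₂ r).1 = Agent.s then 0
    else if i = Agent.s then -((pairOutcome f₁ f₂ r).2 : ℝ)
    else if i = (pairOutcome f₁ f₂ r).1 then ((pairOutcome f₁ f₂ r).2 : ℝ)
    else 0

open Classical in
/-- The step function given by a table with `n` lines: line `k` holds a breakpoint `s k` and a price
`p k`, a negative entry standing for the price `∞`. The value at `v` is the price in the last line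
whose breakpoint is at most `v`, and `∞` if there is no such line. -/
noncomputable def stepFunction (s p : ℕ → ℝ) : ℕ → ℝ≥0 → ℝ≥0∞
  | 0, _ => ⊤
  | k + 1, v =>
    if s k ≤ v then (if p k < 0 then ⊤ else ENNReal.ofReal (p k)) else stepFunction s p k v

/-! ### Sampling -/

/-- Independent streams of samples: `ω (i, n)` is the `n`-th sample from the distribution of
agent `i`. -/
abbrev SampleStream := Agent × ℕ → ℝ≥0

/-- The law of the streams: all samples are independent, those for agent `i` have law `V i`. -/
noncomputable def streamLaw (V : Agent → Measure ℝ≥0) : Measure SampleStream :=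
  Measure.infinitePi fun x : Agent × ℕ => V x.1

/-- The empirical distribution of the first `n` terms of `x`. -/
noncomputable def empirical (n : ℕ) (x : ℕ → ℝ≥0) : Measure ℝ≥0 :=
  (n : ℝ≥0∞)⁻¹ • ∑ k ∈ Finset.range n, Measure.dirac (x k)

/-! ### The machine model: a real RAM with sample access

Programs are structured programs over integer registers (addition and truncated subtraction only)
and two-dimensional arrays of reals (exact field operations and comparisons), whose cells are
addressed through integer registers. The only constants are natural numbers. There is no rounding
of reals to integers. -/

/-- Integer expressions. -/
inductive IExp
  | const (n : ℕ)
  | reg (x : ℕ)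
  | add (e f : IExp)
  | sub (e f : IExp)

/-- Real expressions; `cell a e f` is the entry in row `e`, column `f` of the array `a`. -/
inductive RExp
  | ofInt (e : IExp)
  | cell (a : ℕ) (e f : IExp)
  | add (e f : RExp)
  | sub (e f : RExp)
  | mul (e f : RExp)
  | div (e f : RExp)

/-- Tests. -/
inductive BExp
  | ile (e f : IExp)
  | rle (e f : RExp)
  | not (b : BExp)
  | and (b c : BExp)

/-- Programs. `draw i a e f` draws a fresh sample from the distribution of agent `i` and stores it
in row `e`, column `f` of the array `a`. -/
inductive Program
  | skip
  | setReg (x : ℕ) (e : IExp)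
  | setCell (a : ℕ) (e f : IExp) (v : RExp)
  | draw (i : Agent) (a : ℕ) (e f : IExp)
  | seq (c d : Program)
  | branch (b : BExp) (c d : Program)
  | loop (b : BExp) (c : Program)

/-- Machine states: registers, arrays, and the number of samples drawn so far for each agent. -/
structure State where
  reg : ℕ → ℕ
  cell : ℕ → ℕ → ℕ → ℝ
  drawn : Agent → ℕ

def IExp.eval (σ : State) : IExp → ℕ
  | const n => n
  | reg x => σ.reg x
  | add e f => e.eval σ + f.eval σ
  | sub e f => e.eval σ - f.eval σ

noncomputable def RExp.eval (σ : State) : RExp → ℝ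
  | ofInt e => (e.eval σ : ℝ)
  | cell a e f => σ.cell a (e.eval σ) (f.eval σ)
  | add e f => e.eval σ + f.eval σ
  | sub e f => e.eval σ - f.eval σ
  | mul e f => e.eval σ * f.eval σ
  | div e f => e.eval σ / f.eval σ

def BExp.Holds (σ : State) : BExp → Prop
  | ile e f => e.eval σ ≤ f.eval σ
  | rle e f => e.eval σ ≤ f.eval σ
  | not b => ¬ b.Holds σ
  | and b c => b.Holds σ ∧ c.Holds σ

def State.setReg (σ : State) (x n : ℕ) : State :=
  { σ with reg := Function.update σ.reg x n }

noncomputable def State.setCell (σ : State) (a i j : ℕ) (v : ℝ) : State :=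
  { σ with cell :=
      Function.update σ.cell a (Function.update (σ.cell a) i (Function.update (σ.cell a i) j v)) }

/-- Store the next unused sample for agent `k` in a cell. -/
noncomputable def State.draw (σ : State) (ω : SampleStream) (k : Agent) (a i j : ℕ) : State :=
  { σ.setCell a i j (ω (k, σ.drawn k)) with
    drawn := Function.update σ.drawn k (σ.drawn k + 1) }

/-- `Exec ω c σ t τ`: with sample streams `ω`, the program `c` started in the state `σ` halts after
`t` steps in the state `τ`. Every elementary command and every evaluation of a test is one step
(the expressions in a program have a fixed size). -/
inductive Exec (ω : SampleStream) : Program → State → ℕ → State → Prop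
  | skip (σ : State) : Exec ω .skip σ 1 σ
  | setReg (σ : State) (x : ℕ) (e : IExp) :
      Exec ω (.setReg x e) σ 1 (σ.setReg x (e.eval σ))
  | setCell (σ : State) (a : ℕ) (e f : IExp) (v : RExp) :
      Exec ω (.setCell a e f v) σ 1 (σ.setCell a (e.eval σ) (f.eval σ) (v.eval σ))
  | draw (σ : State) (i : Agent) (a : ℕ) (e f : IExp) :
      Exec ω (.draw i a e f) σ 1 (σ.draw ω i a (e.eval σ) (f.eval σ))
  | seq {c d : Program} {σ τ υ : State} {t u : ℕ} :
      Exec ω c σ t τ → Exec ω d τ u υ → Exec ω (.seq c d) σ (t + u) υ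
  | branchTrue {b : BExp} {c d : Program} {σ τ : State} {t : ℕ} :
      b.Holds σ → Exec ω c σ t τ → Exec ω (.branch b c d) σ (t + 1) τ
  | branchFalse {b : BExp} {c d : Program} {σ τ : State} {t : ℕ} :
      ¬ b.Holds σ → Exec ω d σ t τ → Exec ω (.branch b c d) σ (t + 1) τ
  | loopDone {b : BExp} {c : Program} {σ : State} :
      ¬ b.Holds σ → Exec ω (.loop b c) σ 1 σ
  | loopStep {b : BExp} {c : Program} {σ τ υ : State} {t u : ℕ} :
      b.Holds σ → Exec ω c σ t τ → Exec ω (.loop b c) τ u υ →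
        Exec ω (.loop b c) σ (t + u + 1) υ

/-- Programs are deterministic: running time and final state are unique. -/
theorem Exec.unique {ω : SampleStream} {c : Program} {σ τ τ' : State} {t t' : ℕ}
    (h : Exec ω c σ t τ) (h' : Exec ω c σ t' τ') : t = t' ∧ τ = τ' := by
  induction h generalizing t' τ' with
  | skip | setReg | setCell | draw => cases h'; exact ⟨rfl, rfl⟩
  | seq _ _ ih₁ ih₂ =>
    cases h' with
    | seq k₁ k₂ =>
      obtain ⟨rfl, rfl⟩ := ih₁ k₁
      obtain ⟨rfl, rfl⟩ := ih₂ k₂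
      exact ⟨rfl, rfl⟩
  | branchTrue hb _ ih =>
    cases h' with
    | branchTrue _ k => obtain ⟨rfl, rfl⟩ := ih k; exact ⟨rfl, rfl⟩
    | branchFalse hn _ => exact absurd hb hn
  | branchFalse hn _ ih =>
    cases h' with
    | branchTrue hb _ => exact absurd hb hn
    | branchFalse _ k => obtain ⟨rfl, rfl⟩ := ih k; exact ⟨rfl, rfl⟩
  | loopDone hn =>
    cases h' with
    | loopDone _ => exact ⟨rfl, rfl⟩
    | loopStep hb _ _ => exact absurd hb hn
  | loopStep hb _ _ ih₁ ih₂ =>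
    cases h' with
    | loopDone hn => exact absurd hb hn
    | loopStep _ k₁ k₂ =>
      obtain ⟨rfl, rfl⟩ := ih₁ k₁
      obtain ⟨rfl, rfl⟩ := ih₂ k₂
      exact ⟨rfl, rfl⟩

/-- The initial state on input `(ε, δ)`: row `0` of array `0` starts with `ε, δ`, everything else
is zero, and no sample has been drawn. -/
noncomputable def inputState (ε δ : ℝ) : State where
  reg _ := 0
  cell a i j :=
    if a = 0 ∧ i = 0 ∧ j = 0 then ε else if a = 0 ∧ i = 0 ∧ j = 1 then δ else 0
  drawn _ := 0

/-- The price function written as output in the state `σ`: the table of `f₁` is in array `1`, with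
its number of lines in register `1`; that of `f₂` is in array `2`, with its number of lines in
register `2`. Breakpoints are in column `0`, prices in column `1`. -/
noncomputable def State.outputFunction (σ : State) (b : ℕ) : ℝ≥0 → ℝ≥0∞ :=
  stepFunction (fun k => σ.cell b k 0) (fun k => σ.cell b k 1) (σ.reg b)

/-- The mechanism that is output in the state `σ`. -/
noncomputable def State.outputMechanism (σ : State) : Mechanism :=
  pairMechanism (σ.outputFunction 1) (σ.outputFunction 2)

/-- The product of the empirical distributions of the samples drawn up to the state `σ`. -/
noncomputable def State.empiricalProduct (σ : State) (ω : SampleStream) : Measure Profile :=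
  Measure.pi fun i => empirical (σ.drawn i) fun n => ω (i, n)

end GainsFromTrade

open GainsFromTrade

namespace GainsFromTrade

/-! ### Pairs of price functions whose closed winning regions are disjoint -/

/-! The algorithm draws equally many samples from the three distributions and maximizes exactly for
the empirical product. Two facts carry the theorem: the empirical maximum over all simple mechanisms
is attained by price functions that are monotone where finite, which a dynamic program finds, and
the gains of such pairs converge uniformly. No uniform estimate over all simple mechanisms is
needed.

Structure. In a simple mechanism the price of a buyer depends only on the value of the other buyer
(`Mechanism.IsSimple.revenue_eq₁`, `Mechanism.IsSimple.slices`), but the seller's report may still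
decide which buyer wins. `Slices.exists_plan` removes this dependence without loss on the samples.
If both buyers can win strictly above a common price `c`, then `c` is the only price in the quadrant
of values above `c`, and against each seller only one of the buyers wins there
(`Slices.StrictOverlap.quadrant`, `Slices.Quadrant.slice`). Which buyer should get the whole
quadrant does not depend on the seller, so a single assignment is at least as good. The three plans
`planA`, `planC` and `planD` carry it out and keep the winning regions upward closed at the border
of the quadrant.

Optimization. On sorted samples, the seller-independent regions are thresholds, one for each row and
each column, and the best price for given winners is bounded by a suffix maximum
(`exists_threshold`). Disjoint thresholds, monotone or not, earn at most the value of the best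
staircase path (`IsPathValue.thresholds_le`). Tracing an optimal path gives two monotone tables
whose prices no pair of reports can reach together (`Tables.goodPair`); such a pair is simple
(`ClosedDisjoint.isSimple`) and optimal on the samples (`Tables.optimal`). A small program logic
(`Runs`) shows that the machine computes these tables in polynomial time (`mainProg_output`).

Generalization. Monotone prices make the gain of each buyer quasiconcave in every coordinate. Hence
exchanging the prior for the empirical product changes the expected gain by at most a multiple of
the discrepancy on intervals (`GoodPair.abs_expectedGFT_sub_le`), and finitely many brackets control
all intervals (`abs_sub_le_of_upperSet`). The opposite comparison concerns one near-optimal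
mechanism fixed before sampling: its empirical gain is an average over the diagonals of the sample
cube, and each diagonal consists of independent profiles, so Hoeffding's inequality applies
(`streamLaw_sum_le`). Chaining the output under the prior, the output on the samples, the fixed
mechanism on the samples and the fixed mechanism under the prior gives
`streamLaw_mainProg_fails_le`. -/

/-- The profile with seller value `s` and buyer values `a`, `b`. -/
def mkProfile (s a b : ℝ≥0) : Profile
  | .s => s
  | .b₁ => a
  | .b₂ => b

@[simp] lemma mkProfile_s (s a b : ℝ≥0) : mkProfile s a b Agent.s = s := rfl
@[simp] lemma mkProfile_b₁ (s a b : ℝ≥0) : mkProfile s a b Agent.b₁ = a := rfl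
@[simp] lemma mkProfile_b₂ (s a b : ℝ≥0) : mkProfile s a b Agent.b₂ = b := rfl

lemma eq_mkProfile (r : Profile) : r = mkProfile (r .s) (r .b₁) (r .b₂) := by
  funext i; cases i <;> rfl

@[simp] lemma update_mkProfile_s (s a b x : ℝ≥0) :
    Function.update (mkProfile s a b) Agent.s x = mkProfile x a b := by
  funext i; cases i <;> simp [Function.update]

@[simp] lemma update_mkProfile_b₁ (s a b x : ℝ≥0) :
    Function.update (mkProfile s a b) Agent.b₁ x = mkProfile s x b := by
  funext i; cases i <;> simp [Function.update]

@[simp] lemma update_mkProfile_b₂ (s a b x : ℝ≥0) :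
    Function.update (mkProfile s a b) Agent.b₂ x = mkProfile s a x := by
  funext i; cases i <;> simp [Function.update]

/-- No two reports reach both prices. -/
def ClosedDisjoint (f₁ f₂ : ℝ≥0 → ℝ≥0∞) : Prop :=
  ∀ v₁ v₂ : ℝ≥0, f₁ v₂ ≤ v₁ → f₂ v₁ ≤ v₂ → False

lemma ClosedDisjoint.compatible {f₁ f₂ : ℝ≥0 → ℝ≥0∞} (h : ClosedDisjoint f₁ f₂) :
    Compatible f₁ f₂ := fun ⟨v₁, v₂, h₁, h₂⟩ => h v₁ v₂ h₁.le h₂.le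

/-- Trade of a buyer with value `v` at price `p` with a seller of value `s`. -/
def Trades (p : ℝ≥0∞) (s v : ℝ≥0) : Prop := p ≤ v ∧ s ≤ p

-- At most one buyer reaches her price, so the strict and the tie-breaking branches of the rule
-- never compete and merge into one weak test for each buyer.
open Classical in
lemma ClosedDisjoint.pairOutcome_eq {f₁ f₂ : ℝ≥0 → ℝ≥0∞} (h : ClosedDisjoint f₁ f₂)
    (s a b : ℝ≥0) :
    pairOutcome f₁ f₂ (mkProfile s a b) =
      if Trades (f₁ b) s a then (Agent.b₁, (f₁ b).toNNReal)
      else if Trades (f₂ a) s b then (Agent.b₂, (f₂ a).toNNReal) else (Agent.s, 0) := by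
  have h' := h a b
  simp only [pairOutcome, mkProfile_s, mkProfile_b₁, mkProfile_b₂, Trades]
  by_cases h1 : f₁ b ≤ a
  · have h2 : ¬ f₂ a ≤ b := h' h1
    have h3 : ¬ f₂ a < b := fun h => h2 h.le
    have h4 : ¬ (b : ℝ≥0∞) = f₂ a := fun h => h2 h.ge
    rcases h1.lt_or_eq with h5 | h5
    · have h6 : ¬ (a : ℝ≥0∞) = f₁ b := h5.ne'
      simp [h1, h2, h3, h4, h5, h6]
    · simp [h2, h3, h4, h5.symm]
  · have h3 : ¬ f₁ b < a := fun h => h1 h.le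
    have h4 : ¬ (a : ℝ≥0∞) = f₁ b := fun h => h1 h.ge
    by_cases h2 : f₂ a ≤ b
    · rcases h2.lt_or_eq with h5 | h5
      · have h6 : ¬ (b : ℝ≥0∞) = f₂ a := h5.ne'
        simp [h1, h2, h3, h4, h5, h6]
      · simp [h1, h3, h4, h5.symm]
    · have h5 : ¬ f₂ a < b := fun h => h2 h.le
      have h6 : ¬ (b : ℝ≥0∞) = f₂ a := fun h => h2 h.ge
      simp [h1, h2, h3, h4, h5, h6]

lemma Trades.toNNReal_le {p : ℝ≥0∞} {s v : ℝ≥0} (h : Trades p s v) : (p.toNNReal : ℝ) ≤ v := by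
  have := ENNReal.toNNReal_mono ENNReal.coe_ne_top h.1
  simpa using this

lemma Trades.le_toNNReal {p : ℝ≥0∞} {s v : ℝ≥0} (h : Trades p s v) : (s : ℝ) ≤ p.toNNReal := by
  have := ENNReal.toNNReal_mono (ne_top_of_le_ne_top ENNReal.coe_ne_top h.1) h.2
  simpa using this

/-- With seller and price unchanged only the buyer's inequality can fail. A buyer who obtains a
trade by misreporting therefore pays at least her value. -/
lemma Trades.lt_of_not_buyer {p : ℝ≥0∞} {s v v' : ℝ≥0} (h : Trades p s v)
    (h' : ¬ Trades p s v') : (v' : ℝ) ≤ p.toNNReal := by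
  have h1 : (v' : ℝ≥0∞) < p := not_le.1 fun h2 => h' ⟨h2, h.2⟩
  have := ENNReal.toNNReal_mono (ne_top_of_le_ne_top ENNReal.coe_ne_top h.1) h1.le
  simpa using this

lemma Trades.lt_of_not_seller {p : ℝ≥0∞} {s s' v : ℝ≥0} (h : Trades p s v)
    (h' : ¬ Trades p s' v) : (p.toNNReal : ℝ) ≤ s' := by
  have h1 : p < s' := not_le.1 fun h2 => h' ⟨h.1, h2⟩
  have := ENNReal.toNNReal_mono ENNReal.coe_ne_top h1.le
  simpa using this

namespace ClosedDisjoint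

variable {f₁ f₂ : ℝ≥0 → ℝ≥0∞}

lemma not_both (h : ClosedDisjoint f₁ f₂) {s s' a b : ℝ≥0} (h₁ : Trades (f₁ b) s a) :
    ¬ Trades (f₂ a) s' b := fun h₂ => h a b h₁.1 h₂.1

open Classical in
lemma utility_s (h : ClosedDisjoint f₁ f₂) (s a b x : ℝ≥0) :
    (pairMechanism f₁ f₂).utility .s x (mkProfile s a b) =
      if Trades (f₁ b) s a then ((f₁ b).toNNReal : ℝ) - x
      else if Trades (f₂ a) s b then ((f₂ a).toNNReal : ℝ) - x else 0 := by
  have := h.pairOutcome_eq s a b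
  simp only [Mechanism.utility, pairMechanism, this]
  by_cases h1 : Trades (f₁ b) s a <;> by_cases h2 : Trades (f₂ a) s b <;> simp [h1, h2] <;> ring

open Classical in
lemma utility_b₁ (h : ClosedDisjoint f₁ f₂) (s a b x : ℝ≥0) :
    (pairMechanism f₁ f₂).utility .b₁ x (mkProfile s a b) =
      if Trades (f₁ b) s a then (x : ℝ) - (f₁ b).toNNReal else 0 := by
  have := h.pairOutcome_eq s a b
  simp only [Mechanism.utility, pairMechanism, this]
  by_cases h1 : Trades (f₁ b) s a <;> by_cases h2 : Trades (f₂ a) s b <;> simp [h1, h2]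

open Classical in
lemma utility_b₂ (h : ClosedDisjoint f₁ f₂) (s a b x : ℝ≥0) :
    (pairMechanism f₁ f₂).utility .b₂ x (mkProfile s a b) =
      if Trades (f₂ a) s b then (x : ℝ) - (f₂ a).toNNReal else 0 := by
  have := h.pairOutcome_eq s a b
  have h3 := @not_both f₁ f₂ h s s a b
  simp only [Mechanism.utility, pairMechanism, this]
  by_cases h1 : Trades (f₁ b) s a <;> by_cases h2 : Trades (f₂ a) s b <;> simp_all

/-- The price of a buyer does not involve her own report. The seller cannot switch between the two
prices, because `not_both` excludes wins of different buyers even at different seller reports; all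
he can do is accept or refuse a single price. -/
lemma isSimple (h : ClosedDisjoint f₁ f₂) : (pairMechanism f₁ f₂).IsSimple where
  dsic := by
    classical
    intro i r x y
    rw [eq_mkProfile r]
    generalize r .s = s
    generalize r .b₁ = a
    generalize r .b₂ = b
    cases i
    · simp only [update_mkProfile_s, h.utility_s]
      by_cases h1 : Trades (f₁ b) x a
      · have h3 : ¬ Trades (f₂ a) y b := h.not_both h1
        by_cases h2 : Trades (f₁ b) y a
        · simp [h1, h2]
        · simpa [h1, h2, h3] using h1.le_toNNReal
      · by_cases h4 : Trades (f₂ a) x b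
        · have h3 : ¬ Trades (f₁ b) y a := fun h5 => h.not_both h5 h4
          by_cases h2 : Trades (f₂ a) y b
          · simp [h1, h2, h3, h4]
          · simpa [h1, h2, h3, h4] using h4.le_toNNReal
        · by_cases h2 : Trades (f₁ b) y a
          · simpa [h1, h2, h4] using h2.lt_of_not_seller h1
          · by_cases h3 : Trades (f₂ a) y b
            · simpa [h1, h2, h3, h4] using h3.lt_of_not_seller h4
            · simp [h1, h2, h3, h4]
    · simp only [update_mkProfile_b₁, h.utility_b₁]
      by_cases h1 : Trades (f₁ b) s x <;> by_cases h2 : Trades (f₁ b) s y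
      · simp [h1, h2]
      · simpa [h1, h2] using h1.toNNReal_le
      · simpa [h1, h2] using h2.lt_of_not_buyer h1
      · simp [h1, h2]
    · simp only [update_mkProfile_b₂, h.utility_b₂]
      by_cases h1 : Trades (f₂ a) s x <;> by_cases h2 : Trades (f₂ a) s y
      · simp [h1, h2]
      · simpa [h1, h2] using h1.toNNReal_le
      · simpa [h1, h2] using h2.lt_of_not_buyer h1
      · simp [h1, h2]
  normalized := by
    intro i r hw
    cases i <;> simp_all [pairMechanism, Mechanism.Wins]
    · intro h1 h2; exact absurd h2.symm hw
    · intro h1 h2; exact absurd h2.symm hw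
  stronglyBudgetBalanced := by
    intro r
    have : (Finset.univ : Finset Agent) = {Agent.s, Agent.b₁, Agent.b₂} := rfl
    rw [this]
    rcases h1 : (pairOutcome f₁ f₂ r).1 <;> simp [pairMechanism, h1]
  individuallyRational := by
    classical
    intro i r x
    rw [eq_mkProfile r]
    cases i
    · simp only [update_mkProfile_s, h.utility_s]
      split_ifs with h1 h2
      · exact sub_nonneg.2 h1.le_toNNReal
      · exact sub_nonneg.2 h2.le_toNNReal
      · exact le_rfl
    · simp only [update_mkProfile_b₁, h.utility_b₁]
      split_ifs with h1
      · exact sub_nonneg.2 h1.toNNReal_le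
      · exact le_rfl
    · simp only [update_mkProfile_b₂, h.utility_b₂]
      split_ifs with h1
      · exact sub_nonneg.2 h1.toNNReal_le
      · exact le_rfl

open Classical in
lemma gft_eq (h : ClosedDisjoint f₁ f₂) (s a b : ℝ≥0) :
    (pairMechanism f₁ f₂).gft (mkProfile s a b) =
      (if Trades (f₁ b) s a then (a : ℝ) - s else 0) +
        (if Trades (f₂ a) s b then (b : ℝ) - s else 0) := by
  have := h.pairOutcome_eq s a b
  have h3 := @not_both f₁ f₂ h s s a b
  simp only [Mechanism.gft, pairMechanism, this]
  by_cases h1 : Trades (f₁ b) s a <;> by_cases h2 : Trades (f₂ a) s b <;> simp_all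

lemma measurableSet_trades {f : ℝ≥0 → ℝ≥0∞} (hf : Measurable f) (i j : Agent) :
    MeasurableSet {r : Profile | Trades (f (r j)) (r .s) (r i)} :=
  (measurableSet_le (hf.comp (measurable_pi_apply j)) (measurable_pi_apply i).coe_nnreal_ennreal).inter
    (measurableSet_le (measurable_pi_apply Agent.s).coe_nnreal_ennreal
      (hf.comp (measurable_pi_apply j)))

lemma measurable_alloc (h : ClosedDisjoint f₁ f₂) (h₁ : Measurable f₁) (h₂ : Measurable f₂) :
    Measurable (pairMechanism f₁ f₂).alloc := by
  classical
  have h3 : (pairMechanism f₁ f₂).alloc = fun r =>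
      if Trades (f₁ (r .b₂)) (r .s) (r .b₁) then Agent.b₁
      else if Trades (f₂ (r .b₁)) (r .s) (r .b₂) then Agent.b₂ else Agent.s := by
    funext r
    have := h.pairOutcome_eq (r .s) (r .b₁) (r .b₂)
    rw [← eq_mkProfile] at this
    simp only [pairMechanism, this]
    split_ifs <;> rfl
  rw [h3]
  exact Measurable.ite (measurableSet_trades h₁ _ _) measurable_const
    (Measurable.ite (measurableSet_trades h₂ _ _) measurable_const measurable_const)

end ClosedDisjoint

end GainsFromTrade

namespace GainsFromTrade

/-! ### The structure of simple mechanisms -/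

/-- Winning regions and prices with the properties that they have in a simple mechanism: `w₁ s a b`
says that buyer 1 wins at the values `s, a, b`, and then her price is `f₁ b`. -/
structure Slices where
  w₁ : ℝ≥0 → ℝ≥0 → ℝ≥0 → Prop
  w₂ : ℝ≥0 → ℝ≥0 → ℝ≥0 → Prop
  f₁ : ℝ≥0 → ℝ≥0
  f₂ : ℝ≥0 → ℝ≥0
  le₁ : ∀ {s a b}, w₁ s a b → s ≤ f₁ b ∧ f₁ b ≤ a
  le₂ : ∀ {s a b}, w₂ s a b → s ≤ f₂ a ∧ f₂ a ≤ b
  up₁ : ∀ {s a b a'}, w₁ s a b → f₁ b < a' → w₁ s a' b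
  up₂ : ∀ {s a b b'}, w₂ s a b → f₂ a < b' → w₂ s a b'
  disj : ∀ {s a b}, w₁ s a b → ¬ w₂ s a b
  -- A seller below the price still trades, but possibly with the other buyer. This freedom is the
  -- obstacle to describing the mechanism by seller-independent regions.
  sell₁ : ∀ {s a b s'}, w₁ s a b → s' < f₁ b → w₁ s' a b ∨ w₂ s' a b
  sell₂ : ∀ {s a b s'}, w₂ s a b → s' < f₂ a → w₁ s' a b ∨ w₂ s' a b
  same : ∀ {s s' a b}, w₁ s a b → w₂ s' a b → f₁ b = f₂ a

/-- Disjoint winning regions that do not depend on the seller, together with prices. -/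
structure Plan where
  W₁ : ℝ≥0 → ℝ≥0 → Prop
  W₂ : ℝ≥0 → ℝ≥0 → Prop
  ρ₁ : ℝ≥0 → ℝ≥0
  ρ₂ : ℝ≥0 → ℝ≥0
  disj : ∀ {a b}, W₁ a b → ¬ W₂ a b
  up₁ : ∀ {a b a'}, W₁ a b → a < a' → W₁ a' b
  up₂ : ∀ {a b b'}, W₂ a b → b < b' → W₂ a b'
  -- The price need only lie below the winning values, not at their threshold, so a plan need not be
  -- a mechanism; it only has to be an upper bound for one.
  le₁ : ∀ {a b}, W₁ a b → ρ₁ b ≤ a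
  le₂ : ∀ {a b}, W₂ a b → ρ₂ a ≤ b

open Classical in
/-- Gains from trade of a system of slices. -/
noncomputable def Slices.gain (M : Slices) (s a b : ℝ≥0) : ℝ :=
  (if M.w₁ s a b then (a : ℝ) - s else 0) + (if M.w₂ s a b then (b : ℝ) - s else 0)

open Classical in
/-- Gains from trade of a plan. -/
noncomputable def Plan.gain (L : Plan) (s a b : ℝ≥0) : ℝ :=
  (if L.W₁ a b ∧ s ≤ L.ρ₁ b then (a : ℝ) - s else 0) +
    (if L.W₂ a b ∧ s ≤ L.ρ₂ a then (b : ℝ) - s else 0)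

/-- Exchange the two buyers. -/
def Slices.swap (M : Slices) : Slices where
  w₁ s a b := M.w₂ s b a
  w₂ s a b := M.w₁ s b a
  f₁ := M.f₂
  f₂ := M.f₁
  le₁ := M.le₂
  le₂ := M.le₁
  up₁ := M.up₂
  up₂ := M.up₁
  disj h h' := M.disj h' h
  sell₁ h h' := (M.sell₂ h h').symm
  sell₂ h h' := (M.sell₁ h h').symm
  same h h' := (M.same h' h).symm

/-- Exchange the two buyers. -/
def Plan.swap (L : Plan) : Plan where
  W₁ a b := L.W₂ b a
  W₂ a b := L.W₁ b a
  ρ₁ := L.ρ₂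
  ρ₂ := L.ρ₁
  disj h h' := L.disj h' h
  up₁ := L.up₂
  up₂ := L.up₁
  le₁ := L.le₂
  le₂ := L.le₁

lemma Slices.swap_gain (M : Slices) (s a b : ℝ≥0) : M.swap.gain s a b = M.gain s b a := by
  simp only [Slices.gain, Slices.swap]
  rw [add_comm]
  congr

lemma Plan.swap_gain (L : Plan) (s a b : ℝ≥0) : L.swap.gain s a b = L.gain s b a := by
  simp only [Plan.gain, Plan.swap]
  rw [add_comm]
  congr

/-! ### Strict overlaps of the two buyers and the quadrant they force -/

namespace Slices

variable (M : Slices)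

/-- Buyer 1 wins against some seller. -/
def T₁ (a b : ℝ≥0) : Prop := ∃ s, M.w₁ s a b

/-- Buyer 2 wins against some seller. -/
def T₂ (a b : ℝ≥0) : Prop := ∃ s, M.w₂ s a b

variable {M}

lemma T₁.le {a b : ℝ≥0} (h : M.T₁ a b) : M.f₁ b ≤ a := (M.le₁ h.choose_spec).2
lemma T₂.le {a b : ℝ≥0} (h : M.T₂ a b) : M.f₂ a ≤ b := (M.le₂ h.choose_spec).2

lemma T₁.of_lt {a b a' : ℝ≥0} (h : M.T₁ a b) (h' : M.f₁ b < a') : M.T₁ a' b :=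
  ⟨_, M.up₁ h.choose_spec h'⟩
lemma T₂.of_lt {a b b' : ℝ≥0} (h : M.T₂ a b) (h' : M.f₂ a < b') : M.T₂ a b' :=
  ⟨_, M.up₂ h.choose_spec h'⟩

lemma T₁.up {a b a' : ℝ≥0} (h : M.T₁ a b) (h' : a < a') : M.T₁ a' b :=
  h.of_lt (h.le.trans_lt h')
lemma T₂.up {a b b' : ℝ≥0} (h : M.T₂ a b) (h' : b < b') : M.T₂ a b' :=
  h.of_lt (h.le.trans_lt h')

lemma T₁.same {a b : ℝ≥0} (h : M.T₁ a b) (h' : M.T₂ a b) : M.f₁ b = M.f₂ a :=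
  M.same h.choose_spec h'.choose_spec

lemma gain_of_w₁ {s a b : ℝ≥0} (h : M.w₁ s a b) : M.gain s a b = a - s := by
  simp [gain, h, M.disj h]

lemma gain_of_w₂ {s a b : ℝ≥0} (h : M.w₂ s a b) : M.gain s a b = b - s := by
  have : ¬ M.w₁ s a b := fun h' => M.disj h' h
  simp [gain, h, this]

lemma gain_of_not {s a b : ℝ≥0} (h : ¬ M.w₁ s a b) (h' : ¬ M.w₂ s a b) : M.gain s a b = 0 := by
  simp [gain, h, h']

/-- Both buyers can win strictly above their common price `c` at `a`, `b`. -/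
structure StrictOverlap (M : Slices) (c a b : ℝ≥0) : Prop where
  left : M.T₁ a b
  right : M.T₂ a b
  eq₁ : M.f₁ b = c
  eq₂ : M.f₂ a = c
  lt₁ : c < a
  lt₂ : c < b

/-- At price `0` both winning sellers have value `0`, and then both buyers would win at the same
profile. -/
lemma StrictOverlap.pos {c a b : ℝ≥0} (h : M.StrictOverlap c a b) : 0 < c := by
  obtain ⟨s, hs⟩ := h.left
  obtain ⟨s', hs'⟩ := h.right
  have h1 := (M.le₁ hs).1
  have h2 := (M.le₂ hs').1
  rw [h.eq₁] at h1
  rw [h.eq₂] at h2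
  rcases eq_or_ne c 0 with h0 | h0
  · rw [h0] at h1 h2
    rw [le_antisymm h1 zero_le] at hs
    rw [le_antisymm h2 zero_le] at hs'
    exact absurd hs' (M.disj hs)
  · exact pos_iff_ne_zero.2 h0

lemma StrictOverlap.swap {c a b : ℝ≥0} (h : M.StrictOverlap c a b) : M.swap.StrictOverlap c b a :=
  ⟨h.right, h.left, h.eq₂, h.eq₁, h.lt₂, h.lt₁⟩

/-- In the quadrant above `c`, buyer 2 always wins against the seller `0`, at price `c`. -/
structure Quadrant (M : Slices) (c : ℝ≥0) : Prop where
  pos : 0 < c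
  eq₂ : ∀ a, c < a → M.f₂ a = c
  win : ∀ a b, c < a → c < b → M.w₂ 0 a b

/-- Buyer 1 wins at every `a' > c` in the row `b` against some seller. When that seller drops to `0`
there is still a trade; it cannot be with buyer 1, since she would then also win at `a` against the
seller `0`. So buyer 2 wins, at the common price `c`, and she keeps winning for every value above
`c`. -/
lemma StrictOverlap.quadrant {c a b : ℝ≥0} (h : M.StrictOverlap c a b) (h0 : M.w₂ 0 a b) :
    M.Quadrant c := by
  have key : ∀ a', c < a' → M.w₂ 0 a' b ∧ M.f₂ a' = c := by
    intro a' ha'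
    obtain ⟨s, hs⟩ := h.left
    have h1 : M.w₁ s a' b := M.up₁ hs (h.eq₁ ▸ ha')
    rcases M.sell₁ h1 (h.eq₁ ▸ h.pos) with h2 | h2
    · exact absurd h0 (M.disj (M.up₁ h2 (h.eq₁ ▸ h.lt₁)))
    · exact ⟨h2, (M.same h1 h2).symm.trans h.eq₁⟩
  exact ⟨h.pos, fun a' ha' => (key a' ha').2,
    fun a' b' ha' hb' => M.up₂ (key a' ha').1 ((key a' ha').2 ▸ hb')⟩

namespace Quadrant

variable {c : ℝ≥0} (q : M.Quadrant c)
include q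

lemma t₂ {a b : ℝ≥0} (ha : c < a) (hb : c < b) : M.T₂ a b := ⟨0, q.win a b ha hb⟩

/-- Buyer 1 also wins at some larger value above `c`, where buyer 2 wins against the seller `0` at
price `c`; the seller's revenue at fixed buyer values is unique. -/
lemma eq₁ {a b : ℝ≥0} (hb : c < b) (h : M.T₁ a b) : M.f₁ b = c := by
  have h1 : a < a + c + 1 := by rw [add_assoc]; exact lt_add_of_pos_right _ (by positivity)
  have h2 : c < a + c + 1 := lt_of_le_of_lt le_add_self (lt_add_of_pos_right _ one_pos)
  exact ((h.up h1).same (q.t₂ h2 hb)).trans (q.eq₂ _ h2)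

/-- Lowering the seller to `0` keeps the trade. If buyer 1 were still the winner, raising her value
into the quadrant would contradict the win of buyer 2 there. -/
lemma t₂_of_t₁ {a b : ℝ≥0} (hb : c < b) (h : M.T₁ a b) : M.T₂ a b := by
  have h1 : a < a + c + 1 := by rw [add_assoc]; exact lt_add_of_pos_right _ (by positivity)
  have h2 : c < a + c + 1 := lt_of_le_of_lt le_add_self (lt_add_of_pos_right _ one_pos)
  have h3 := q.eq₁ hb h
  obtain ⟨s, hs⟩ := h
  rcases M.sell₁ hs (h3 ▸ q.pos) with h4 | h4
  · exact absurd (q.win _ _ h2 hb) (M.disj (M.up₁ h4 (h3 ▸ h2)))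
  · exact ⟨0, h4⟩

/-- A strict overlap whose first value is at most `c` would have a price `c' < c` and generate a
quadrant of its own containing the present one. In the common part either both buyers win against
the seller `0` or buyer 2 has two prices. -/
lemma mem_of_strictOverlap {c' a b : ℝ≥0} (h : M.StrictOverlap c' a b) : c < a ∧ c < b := by
  by_cases ha : c < a
  · have := q.eq₂ a ha
    rw [h.eq₂] at this
    exact ⟨ha, this ▸ h.lt₂⟩
  · have hc : c' < c := h.lt₁.trans_le (not_lt.1 ha)
    have h1 : c < c + 1 := lt_add_of_pos_right _ one_pos
    obtain ⟨s, hs⟩ := h.left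
    rcases M.sell₁ hs (h.eq₁ ▸ h.pos) with h2 | h2
    · have := (h.swap.quadrant h2).win (c + 1) (c + 1) (hc.trans h1) (hc.trans h1)
      exact absurd (q.win _ _ h1 h1) (M.disj this)
    · have := (h.quadrant h2).eq₂ (c + 1) (hc.trans h1)
      rw [q.eq₂ _ h1] at this
      exact absurd this hc.ne'

/-- Against each seller, one of the buyers never wins in the quadrant. -/
lemma slice (s : ℝ≥0) : (∀ a b, c < a → c < b → ¬ M.w₁ s a b) ∨
    (∀ a b, c < a → c < b → ¬ M.w₂ s a b) := by
  by_contra! h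
  obtain ⟨⟨a, b, ha, hb, h1⟩, ⟨a', b', ha', hb', h2⟩⟩ := h
  have h3 : M.w₁ s a' b := M.up₁ h1 ((q.eq₁ hb ⟨s, h1⟩).symm ▸ ha')
  have h4 : M.w₂ s a' b := M.up₂ h2 ((q.eq₂ a' ha').symm ▸ hb)
  exact M.disj h3 h4

end Quadrant

/-- Resolve overlaps in favour of the larger value, except that buyer 2 gets a set `Q`. -/
def resolved (M : Slices) (Q : ℝ≥0 → ℝ≥0 → Prop)
    -- The two hypotheses keep the resolved regions upward closed: a buyer who raises her value must
    -- not lose a cell to the other buyer.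
    (h₁ : ∀ {a b a'}, M.T₁ a b → ¬ (M.T₂ a b ∧ (a ≤ b ∨ Q a b)) → a < a' → M.T₂ a' b →
      ¬ (a' ≤ b ∨ Q a' b))
    (h₂ : ∀ {a b b'}, M.T₂ a b → b < b' → M.T₁ a b' → b' < a → Q a b') : Plan where
  W₁ a b := M.T₁ a b ∧ ¬ (M.T₂ a b ∧ (a ≤ b ∨ Q a b))
  W₂ a b := M.T₂ a b ∧ ¬ (M.T₁ a b ∧ b < a ∧ ¬ Q a b)
  ρ₁ := M.f₁
  ρ₂ := M.f₂
  disj {a b} h h' := by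
    refine h.2 ⟨h'.1, ?_⟩
    by_contra! hn
    exact h'.2 ⟨h.1, hn⟩
  up₁ h h' := ⟨h.1.up h', fun h'' => h₁ h.1 h.2 h' h''.1 h''.2⟩
  up₂ h h' := ⟨h.1.up h', fun h'' => h''.2.2 (h₂ h.1 h' h''.1 h''.2.1)⟩
  le₁ h := h.1.le
  le₂ h := h.1.le

/-- The plan without strict overlaps. -/
def planN (M : Slices) (h : ∀ c a b, ¬ M.StrictOverlap c a b) : Plan :=
  M.resolved (fun _ _ => False)
    (fun {a b a'} h1 _ h3 h4 h5 => by
      have h5 : a' ≤ b := by simpa using h5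
      have h6 := h1.le.trans_lt h3
      have h7 := (h1.up h3).same h4
      exact h _ a' b ⟨h1.up h3, h4, rfl, h7.symm, h6, h6.trans_le h5⟩)
    (fun {a b b'} h1 h2 h3 h4 => by
      have h6 := h1.le.trans_lt h2
      have h7 := h3.same (h1.up h2)
      exact h _ a b' ⟨h3, h1.up h2, h7, rfl, h6.trans h4, h6⟩)

/-- The plan that gives the quadrant to buyer 2. -/
def planA {c : ℝ≥0} (q : M.Quadrant c) : Plan :=
  M.resolved (fun a b => c < a ∧ c < b)
    (fun {a b a'} h1 h2 h3 h4 h5 => by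
      have h6 := h1.le.trans_lt h3
      have h7 := (h1.up h3).same h4
      have h8 : c < a' ∧ c < b := by
        rcases h5 with h5 | h5
        · exact q.mem_of_strictOverlap ⟨h1.up h3, h4, rfl, h7.symm, h6, h6.trans_le h5⟩
        · exact h5
      have h9 := q.t₂_of_t₁ h8.2 h1
      refine h2 ⟨h9, ?_⟩
      have h10 := h1.le
      rw [q.eq₁ h8.2 h1] at h10
      rcases h10.eq_or_lt with h11 | h11
      · exact Or.inl (h11 ▸ h8.2.le)
      · exact Or.inr ⟨h11, h8.2⟩)
    (fun {a b b'} h1 h2 h3 h4 => by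
      have h6 := h1.le.trans_lt h2
      have h7 := h3.same (h1.up h2)
      exact q.mem_of_strictOverlap ⟨h3, h1.up h2, h7, rfl, h6.trans h4, h6⟩)

end Slices

lemma Plan.gain_of_W₁ (L : Plan) {s a b : ℝ≥0} (h : L.W₁ a b) (h' : s ≤ L.ρ₁ b) :
    L.gain s a b = a - s := by
  simp [Plan.gain, h, h', L.disj h]

lemma Plan.gain_of_W₂ (L : Plan) {s a b : ℝ≥0} (h : L.W₂ a b) (h' : s ≤ L.ρ₂ a) :
    L.gain s a b = b - s := by
  have : ¬ L.W₁ a b := fun h'' => L.disj h'' h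
  simp [Plan.gain, h, h', this]

lemma Plan.gain_nonneg (L : Plan) (s a b : ℝ≥0) : 0 ≤ L.gain s a b := by
  unfold Plan.gain
  refine add_nonneg ?_ ?_
  · split_ifs with h
    · exact sub_nonneg.2 (NNReal.coe_le_coe.2 (h.2.trans (L.le₁ h.1)))
    · exact le_rfl
  · split_ifs with h
    · exact sub_nonneg.2 (NNReal.coe_le_coe.2 (h.2.trans (L.le₂ h.1)))
    · exact le_rfl

namespace Slices

variable {M : Slices}

/-- Outside the set given to buyer 2, the resolved plan loses nothing. -/
lemma gain_le_resolved {Q : ℝ≥0 → ℝ≥0 → Prop} {h₁ h₂} {s a b : ℝ≥0} (hQ : ¬ Q a b) :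
    M.gain s a b ≤ (M.resolved Q h₁ h₂).gain s a b := by
  set L := M.resolved Q h₁ h₂ with hL
  by_cases hw₁ : M.w₁ s a b
  · rw [gain_of_w₁ hw₁]
    have ht : M.T₁ a b := ⟨s, hw₁⟩
    have hs := (M.le₁ hw₁).1
    -- Where both buyers can win, their prices agree, so the seller accepts either of them and
    -- moving the item to the larger value cannot lose.
    by_cases h : M.T₂ a b ∧ a ≤ b
    · have hW : L.W₂ a b := ⟨h.1, fun h' => h'.2.1.not_ge h.2⟩
      rw [L.gain_of_W₂ hW (show s ≤ M.f₂ a from (ht.same h.1) ▸ hs)]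
      exact sub_le_sub_right (NNReal.coe_le_coe.2 h.2) _
    · have hW : L.W₁ a b := ⟨ht, fun h' => h ⟨h'.1, h'.2.resolve_right hQ⟩⟩
      rw [L.gain_of_W₁ hW hs]
  · by_cases hw₂ : M.w₂ s a b
    · rw [gain_of_w₂ hw₂]
      have ht : M.T₂ a b := ⟨s, hw₂⟩
      have hs := (M.le₂ hw₂).1
      by_cases h : M.T₁ a b ∧ b < a
      · have hW : L.W₁ a b := ⟨h.1, fun h' => (h'.2.resolve_right hQ).not_gt h.2⟩
        rw [L.gain_of_W₁ hW (show s ≤ M.f₁ b from (h.1.same ht).symm ▸ hs)]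
        exact sub_le_sub_right (NNReal.coe_le_coe.2 h.2.le) _
      · have hW : L.W₂ a b := ⟨ht, fun h' => h ⟨h'.1, h'.2.1⟩⟩
        rw [L.gain_of_W₂ hW hs]
    · rw [gain_of_not hw₁ hw₂]
      exact L.gain_nonneg _ _ _

end Slices

end GainsFromTrade

/-! ### Sums over sample triples, and domination of slices by a plan -/

namespace GainsFromTrade

/-- Sum of `F` over all combinations of the first `n` sample values. -/
def total (n : ℕ) (s a b : ℕ → ℝ≥0) (F : ℝ≥0 → ℝ≥0 → ℝ≥0 → ℝ) : ℝ :=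
  ∑ k ∈ Finset.range n, ∑ j ∈ Finset.range n, ∑ i ∈ Finset.range n, F (s k) (a i) (b j)

lemma total_mono {n : ℕ} {s a b : ℕ → ℝ≥0} {F G : ℝ≥0 → ℝ≥0 → ℝ≥0 → ℝ}
    (h : ∀ x y z, F x y z ≤ G x y z) : total n s a b F ≤ total n s a b G :=
  Finset.sum_le_sum fun _ _ => Finset.sum_le_sum fun _ _ => Finset.sum_le_sum fun _ _ => h _ _ _

lemma total_add (n : ℕ) (s a b : ℕ → ℝ≥0) (F G : ℝ≥0 → ℝ≥0 → ℝ≥0 → ℝ) :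
    total n s a b (fun x y z => F x y z + G x y z) = total n s a b F + total n s a b G := by
  simp [total, Finset.sum_add_distrib]

lemma total_swap (n : ℕ) (s a b : ℕ → ℝ≥0) (F : ℝ≥0 → ℝ≥0 → ℝ≥0 → ℝ) :
    total n s b a (fun x y z => F x z y) = total n s a b F :=
  Finset.sum_congr rfl fun _ _ => Finset.sum_comm

lemma total_eq_rows (n : ℕ) (s a b : ℕ → ℝ≥0) (F : ℝ≥0 → ℝ≥0 → ℝ≥0 → ℝ) :
    total n s a b F = ∑ j ∈ Finset.range n,
      ∑ k ∈ Finset.range n, ∑ i ∈ Finset.range n, F (s k) (a i) (b j) :=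
  Finset.sum_comm

lemma Plan.gain_congr {L L' : Plan} {s a b : ℝ≥0} (h₁ : L.W₁ a b ↔ L'.W₁ a b)
    (h₂ : L.W₂ a b ↔ L'.W₂ a b) (h₃ : L'.W₁ a b → L.ρ₁ b = L'.ρ₁ b)
    (h₄ : L'.W₂ a b → L.ρ₂ a = L'.ρ₂ a) : L.gain s a b = L'.gain s a b := by
  unfold Plan.gain
  by_cases h : L'.W₁ a b
  · have := L'.disj h
    simp [h₁, h₂, h, this, h₃ h]
  · by_cases h' : L'.W₂ a b
    · simp [h₁, h₂, h, h', h₄ h']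
    · simp [h₁, h₂, h, h']

namespace Slices

variable {M : Slices} {c : ℝ≥0} (q : M.Quadrant c)

/-- In a row above `c` every cell that buyer 1 can win can also be won by buyer 2, and `a ≤ c < b`
resolves it in favour of buyer 2. -/
lemma planA_not_W₁ {a b : ℝ≥0} (hb : c < b) (ha : a ≤ c) : ¬ (planA q).W₁ a b := by
  intro h
  have h1 := h.1
  exact h.2 ⟨q.t₂_of_t₁ hb h1, Or.inl (ha.trans hb.le)⟩

include q in
lemma Quadrant.le_of_t₂ {a b : ℝ≥0} (ha : c < a) (h : M.T₂ a b) : c ≤ b := q.eq₂ a ha ▸ h.le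

open Classical in
/-- The plan in which the rows above `c` copy the row `c` in the quadrant. -/
noncomputable def planC : Plan where
  W₁ a b := if c < b then c < a ∧ (planA q).W₁ a c else (planA q).W₁ a b
  W₂ a b := if c < a ∧ c < b then ¬ (planA q).W₁ a c else (planA q).W₂ a b
  ρ₁ b := if c < b then M.f₁ c else M.f₁ b
  ρ₂ := M.f₂
  disj {a b} h h' := by
    by_cases hb : c < b
    · simp only [hb, if_true] at h
      simp only [hb, h.1, and_self, if_true] at h'
      exact h' h.2
    · simp only [hb, if_false] at h
      simp only [hb, and_false, if_false] at h'
      exact (planA q).disj h h'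
  up₁ {a b a'} h h' := by
    by_cases hb : c < b
    · simp only [hb, if_true] at h ⊢
      exact ⟨h.1.trans h', (planA q).up₁ h.2 h'⟩
    · simp only [hb, if_false] at h ⊢
      exact (planA q).up₁ h h'
  up₂ {a b b'} h h' := by
    by_cases ha : c < a
    · by_cases hb : c < b
      · simp only [ha, hb, hb.trans h', and_self, if_true] at h ⊢
        exact h
      · simp only [ha, hb, and_false, if_false] at h
        -- To the right of `c` buyer 2 pays `c`, so below the quadrant she can win only in the row
        -- `c`. This is the row that is copied, hence her region continues upward.
        have h1 := q.le_of_t₂ ha h.1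
        have h2 : b = c := le_antisymm (not_lt.1 hb) h1
        subst h2
        simp only [ha, h', and_self, if_true]
        exact fun h3 => (planA q).disj h3 h
    · simp only [ha, false_and, if_false] at h ⊢
      exact (planA q).up₂ h h'
  le₁ {a b} h := by
    by_cases hb : c < b
    · simp only [hb, if_true] at h ⊢
      exact (planA q).le₁ h.2
    · simp only [hb, if_false] at h ⊢
      exact (planA q).le₁ h
  le₂ {a b} h := by
    by_cases hab : c < a ∧ c < b
    · exact (q.eq₂ a hab.1).trans_le hab.2.le
    · simp only [hab, if_false] at h
      exact (planA q).le₂ h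

open Classical in
/-- The plan that gives the quadrant and its lower side to buyer 1. -/
noncomputable def planD : Plan where
  W₁ a b := (c < a ∧ c ≤ b) ∨ (planA q).W₁ a b
  W₂ a b := ¬ (c < a ∧ c ≤ b) ∧ (planA q).W₂ a b
  -- A winner at or below `c` in the row `c` already has the price `M.f₁ c`, which the price `c`
  -- might exceed, so that price is kept; otherwise the row can be sold at `c`.
  ρ₁ b := if c < b then c else if b = c ∧ ¬ ∃ a ≤ c, (planA q).W₁ a c then c else M.f₁ b
  ρ₂ := M.f₂
  disj {a b} h h' := (planA q).disj (h.resolve_left h'.1) h'.2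
  up₁ {a b a'} h h' := by
    rcases h with h | h
    · exact Or.inl ⟨h.1.trans h', h.2⟩
    · exact Or.inr ((planA q).up₁ h h')
  up₂ {a b b'} h h' := by
    refine ⟨fun h1 => ?_, (planA q).up₂ h.2 h'⟩
    exact h.1 ⟨h1.1, q.le_of_t₂ h1.1 h.2.1⟩
  le₁ {a b} h := by
    split_ifs with hb hbc
    · rcases h with h | h
      · exact h.1.le
      · by_contra! h1
        exact planA_not_W₁ q hb h1.le h
    · rcases h with h | h
      · exact h.1.le
      · by_contra! h1
        exact hbc.2 ⟨a, h1.le, hbc.1 ▸ h⟩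
    · rcases h with h | h
      · have h1 : b = c := le_antisymm (not_lt.1 hb) h.2
        subst h1
        have h2 : ∃ a ≤ b, (planA q).W₁ a b := by simpa using hbc
        obtain ⟨a', h3, h4⟩ := h2
        exact ((planA q).le₁ h4).trans (h3.trans h.1.le)
      · exact (planA q).le₁ h
  le₂ {a b} h := (planA q).le₂ h.2

lemma gain_nonneg (M : Slices) (s a b : ℝ≥0) : 0 ≤ M.gain s a b := by
  by_cases hw₁ : M.w₁ s a b
  · rw [gain_of_w₁ hw₁]
    exact sub_nonneg.2 (NNReal.coe_le_coe.2 ((M.le₁ hw₁).1.trans (M.le₁ hw₁).2))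
  · by_cases hw₂ : M.w₂ s a b
    · rw [gain_of_w₂ hw₂]
      exact sub_nonneg.2 (NNReal.coe_le_coe.2 ((M.le₂ hw₂).1.trans (M.le₂ hw₂).2))
    · rw [gain_of_not hw₁ hw₂]

include q in
open Classical in
/-- Against one seller, the gain in the quadrant is that of an assignment to one buyer. -/
lemma quadrant_slice (s : ℝ≥0) :
    (∀ a b, c < a → c < b → M.gain s a b ≤ if s ≤ c then (b : ℝ) - s else 0) ∨
    (∀ a b, c < a → c < b → M.gain s a b ≤ if s ≤ c then (a : ℝ) - s else 0) := by
  have h1 : ∀ a b, c < a → c < b → M.w₁ s a b → s ≤ c := fun a b _ hb h =>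
    (M.le₁ h).1.trans_eq (q.eq₁ hb ⟨s, h⟩)
  have h2 : ∀ a b, c < a → c < b → M.w₂ s a b → s ≤ c := fun a b ha _ h =>
    (M.le₂ h).1.trans_eq (q.eq₂ a ha)
  have h3 : ∀ x : ℝ≥0, c < x → 0 ≤ if s ≤ c then (x : ℝ) - s else 0 := by
    intro x hx
    split_ifs with h
    · exact sub_nonneg.2 (NNReal.coe_le_coe.2 (h.trans hx.le))
    · exact le_rfl
  rcases q.slice s with h | h
  · refine Or.inl fun a b ha hb => ?_
    by_cases hw : M.w₂ s a b
    · rw [gain_of_w₂ hw, if_pos (h2 a b ha hb hw)]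
    · rw [gain_of_not (h a b ha hb) hw]
      exact h3 b hb
  · refine Or.inr fun a b ha hb => ?_
    by_cases hw : M.w₁ s a b
    · rw [gain_of_w₁ hw, if_pos (h1 a b ha hb hw)]
    · rw [gain_of_not hw (h a b ha hb)]
      exact h3 a ha

open Classical in
/-- Gains of an assignment of the quadrant above `c` at price `c` to a buyer of value `x a b`. -/
noncomputable def quadrantGain (c : ℝ≥0) (x : ℝ≥0 → ℝ≥0 → ℝ≥0) (s a b : ℝ≥0) : ℝ :=
  if c < a ∧ c < b then if s ≤ c then (x a b : ℝ) - s else 0 else 0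

open Classical in
/-- Sum of the values `x a b` over the samples in the quadrant. -/
noncomputable def quadrantSum (n : ℕ) (a b : ℕ → ℝ≥0) (c : ℝ≥0) (x : ℝ≥0 → ℝ≥0 → ℝ≥0) : ℝ :=
  ∑ j ∈ Finset.range n, ∑ i ∈ Finset.range n,
    if c < a i ∧ c < b j then (x (a i) (b j) : ℝ) else 0

/-- The seller's value enters only through the number of sample pairs in the quadrant, which is the
same for both assignments. The better buyer is therefore the same for all sellers. -/
lemma quadrantGain_slice_mono {n : ℕ} {a b : ℕ → ℝ≥0} {x y : ℝ≥0 → ℝ≥0 → ℝ≥0}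
    (h : quadrantSum n a b c x ≤ quadrantSum n a b c y) (s : ℝ≥0) :
    ∑ j ∈ Finset.range n, ∑ i ∈ Finset.range n, quadrantGain c x s (a i) (b j) ≤
      ∑ j ∈ Finset.range n, ∑ i ∈ Finset.range n, quadrantGain c y s (a i) (b j) := by
  classical
  by_cases hs : s ≤ c
  · have key : ∀ x : ℝ≥0 → ℝ≥0 → ℝ≥0,
        ∑ j ∈ Finset.range n, ∑ i ∈ Finset.range n, quadrantGain c x s (a i) (b j) =
        quadrantSum n a b c x - ∑ j ∈ Finset.range n, ∑ i ∈ Finset.range n,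
          if c < a i ∧ c < b j then (s : ℝ) else 0 := by
      intro x
      simp only [quadrantSum, ← Finset.sum_sub_distrib]
      refine Finset.sum_congr rfl fun j _ => Finset.sum_congr rfl fun i _ => ?_
      by_cases hq : c < a i ∧ c < b j <;> simp [quadrantGain, hq, hs]
    rw [key, key]
    linarith
  · simp [quadrantGain, hs]

open Classical in
include q in
/-- The gain in the quadrant is at most that of assigning it to the better buyer. -/
lemma total_quadrant_le {n : ℕ} {s a b : ℕ → ℝ≥0} {y : ℝ≥0 → ℝ≥0 → ℝ≥0}
    (ha : quadrantSum n a b c (fun a _ => a) ≤ quadrantSum n a b c y)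
    (hb : quadrantSum n a b c (fun _ b => b) ≤ quadrantSum n a b c y) :
    total n s a b (fun s a b => if c < a ∧ c < b then M.gain s a b else 0) ≤
      total n s a b (quadrantGain c y) := by
  refine Finset.sum_le_sum fun k _ => ?_
  rcases quadrant_slice q (s k) with h | h
  · refine le_trans ?_ (quadrantGain_slice_mono hb (s k))
    refine Finset.sum_le_sum fun j _ => Finset.sum_le_sum fun i _ => ?_
    by_cases h1 : c < a i ∧ c < b j
    · simpa only [quadrantGain, h1, and_self, if_true] using h _ _ h1.1 h1.2
    · simp only [quadrantGain, h1, if_false, le_refl]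
  · refine le_trans ?_ (quadrantGain_slice_mono ha (s k))
    refine Finset.sum_le_sum fun j _ => Finset.sum_le_sum fun i _ => ?_
    by_cases h1 : c < a i ∧ c < b j
    · simpa only [quadrantGain, h1, and_self, if_true] using h _ _ h1.1 h1.2
    · simp only [quadrantGain, h1, if_false, le_refl]

lemma gain_le_planA {s a b : ℝ≥0} (h : ¬ (c < a ∧ c < b)) :
    M.gain s a b ≤ (planA q).gain s a b :=
  gain_le_resolved (Q := fun a b => c < a ∧ c < b) h

/-- If buyer 2 is the better owner of the quadrant there is no conflict at its border, since buyer 2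
already wins everywhere in it. -/
lemma total_le_planA {n : ℕ} {s a b : ℕ → ℝ≥0}
    (h : quadrantSum n a b c (fun a _ => a) ≤ quadrantSum n a b c (fun _ b => b)) :
    total n s a b M.gain ≤ total n s a b (planA q).gain := by
  classical
  calc total n s a b M.gain
      = total n s a b (fun s a b => (if c < a ∧ c < b then 0 else M.gain s a b) +
          (if c < a ∧ c < b then M.gain s a b else 0)) := by
        congr 1; funext s a b; split_ifs <;> simp
    _ ≤ total n s a b (fun s a b => (if c < a ∧ c < b then 0 else M.gain s a b) +
          quadrantGain c (fun _ b => b) s a b) := by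
        rw [total_add, total_add]
        exact add_le_add le_rfl (total_quadrant_le q h le_rfl)
    _ ≤ _ := by
        refine total_mono fun s a b => ?_
        by_cases hq : c < a ∧ c < b
        · have hW : (planA q).W₂ a b := ⟨q.t₂ hq.1 hq.2, fun h' => h'.2.2 hq⟩
          by_cases hs : s ≤ c
          · have hs' : s ≤ M.f₂ a := (q.eq₂ a hq.1).symm ▸ hs
            rw [(planA q).gain_of_W₂ hW hs']
            simp [quadrantGain, hq, hs]
          · simpa [quadrantGain, hq, hs] using (planA q).gain_nonneg s a b
        · simpa [quadrantGain, hq] using gain_le_planA q hq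

lemma total_rows (n : ℕ) (s a b : ℕ → ℝ≥0) (p : ℝ≥0 → Prop) [DecidablePred p] (F : ℝ≥0 → ℝ≥0 → ℝ) :
    total n s a b (fun s a b => if p b then F s a else 0) =
      (∑ j ∈ Finset.range n, if p (b j) then (1 : ℝ) else 0) *
        ∑ k ∈ Finset.range n, ∑ i ∈ Finset.range n, F (s k) (a i) := by
  rw [total_eq_rows, Finset.sum_mul]
  refine Finset.sum_congr rfl fun j _ => ?_
  by_cases h : p (b j) <;> simp [h]

open Classical in
/-- Gain of buyer 1 from values above `c`, at price `c`. -/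
noncomputable def rowAt (c s a : ℝ≥0) : ℝ := if c < a then if s ≤ c then (a : ℝ) - s else 0 else 0

open Classical in
/-- Gain in the row `c` from values of buyer 1 above `c`. -/
noncomputable def rowGain (M : Slices) (c s a : ℝ≥0) : ℝ := if c < a then M.gain s a c else 0

open Classical in
lemma quadrantGain_fst (c : ℝ≥0) :
    quadrantGain c (fun a _ => a) = fun s a b => if c < b then rowAt c s a else 0 := by
  funext s a b
  by_cases h1 : c < a <;> by_cases h2 : c < b <;> simp [quadrantGain, rowAt, h1, h2]

lemma gain_le_planC {s a b : ℝ≥0} (h : ¬ (c < a ∧ c < b)) :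
    M.gain s a b ≤ (planC q).gain s a b := by
  refine (gain_le_planA q h).trans_eq (Plan.gain_congr ?_ ?_ ?_ fun _ => rfl)
  · by_cases hb : c < b
    · have ha : ¬ c < a := fun ha => h ⟨ha, hb⟩
      simp [planC, hb, ha, planA_not_W₁ q hb (not_lt.1 ha)]
    · simp [planC, hb]
  · simp [planC, h]
  · intro hW
    by_cases hb : c < b
    · simp only [planC, hb, if_true] at hW
      exact absurd ⟨hW.1, hb⟩ h
    · simp only [planC, hb, if_false]
      rfl

/-- If buyer 1 owns the cell in the row `c`, the copy has the same price, and her value exceeds `c`,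
so she replaces a winning buyer 2 without loss. Otherwise buyer 1 did not win there, and a winning
buyer 2 now has value `b > c`. -/
lemma rowGain_le_planC {s a b : ℝ≥0} (ha : c < a) (hb : c < b) :
    M.gain s a c ≤ (planC q).gain s a b := by
  by_cases hW : (planA q).W₁ a c
  · have hW' : (planC q).W₁ a b := by simp [planC, ha, hb, hW]
    have hρ : (planC q).ρ₁ b = M.f₁ c := by simp [planC, hb]
    by_cases hw₁ : M.w₁ s a c
    · rw [gain_of_w₁ hw₁, (planC q).gain_of_W₁ hW' (hρ ▸ (M.le₁ hw₁).1)]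
    · by_cases hw₂ : M.w₂ s a c
      · have h1 : s ≤ M.f₁ c := (hW.1.same ⟨s, hw₂⟩) ▸ (M.le₂ hw₂).1
        rw [gain_of_w₂ hw₂, (planC q).gain_of_W₁ hW' (hρ ▸ h1)]
        exact sub_le_sub_right (NNReal.coe_le_coe.2 ha.le) _
      · rw [gain_of_not hw₁ hw₂]
        exact (planC q).gain_nonneg _ _ _
  · have hW' : (planC q).W₂ a b := by simp [planC, ha, hb, hW]
    have hw₁ : ¬ M.w₁ s a c := by
      intro hw₁
      refine hW ⟨⟨s, hw₁⟩, fun h => ?_⟩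
      rcases h.2 with h | h
      · exact h.not_gt ha
      · exact h.2.false
    by_cases hw₂ : M.w₂ s a c
    · rw [gain_of_w₂ hw₂, (planC q).gain_of_W₂ hW' (M.le₂ hw₂).1]
      exact sub_le_sub_right (NNReal.coe_le_coe.2 hb.le) _
    · rw [gain_of_not hw₁ hw₂]
      exact (planC q).gain_nonneg _ _ _

open Classical in
lemma gain_decomp (M : Slices) (c : ℝ≥0) (n : ℕ) (s a b : ℕ → ℝ≥0) :
    total n s a b M.gain =
      total n s a b (fun s a b => if c < a ∧ c < b then 0 else M.gain s a b) +
        total n s a b (fun s a b => if c < a ∧ c < b then M.gain s a b else 0) := by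
  rw [← total_add]
  congr 1; funext s a b; split_ifs <;> simp

/-- When the quadrant should go to buyer 1, each of its rows earns on average at most `rowAt`. If
the existing row `c` is at least as good, copying it into all higher rows is an improvement that
needs no change in the row `c` itself. -/
lemma total_le_planC {n : ℕ} {s a b : ℕ → ℝ≥0}
    (h : quadrantSum n a b c (fun _ b => b) ≤ quadrantSum n a b c (fun a _ => a))
    (hXY : ∑ k ∈ Finset.range n, ∑ i ∈ Finset.range n, rowAt c (s k) (a i) ≤
      ∑ k ∈ Finset.range n, ∑ i ∈ Finset.range n, M.rowGain c (s k) (a i)) :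
    total n s a b M.gain ≤ total n s a b (planC q).gain := by
  classical
  have h1 := total_quadrant_le q (s := s) le_rfl h
  rw [quadrantGain_fst, total_rows n s a b (fun b => c < b)] at h1
  have h2 : (0 : ℝ) ≤ ∑ j ∈ Finset.range n, if c < b j then (1 : ℝ) else 0 :=
    Finset.sum_nonneg fun _ _ => by split_ifs <;> norm_num
  have h3 := h1.trans (mul_le_mul_of_nonneg_left hXY h2)
  rw [← total_rows n s a b (fun b => c < b)] at h3
  rw [gain_decomp M c]
  refine (add_le_add le_rfl h3).trans ?_
  rw [← total_add]
  refine total_mono fun s a b => ?_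
  by_cases ha : c < a <;> by_cases hb : c < b
  · simpa [rowGain, ha, hb] using rowGain_le_planC q ha hb
  · simpa [ha, hb] using gain_le_planC q (s := s) (a := a) (b := b) (by simp [hb])
  · simpa [rowGain, ha, hb] using gain_le_planC q (s := s) (a := a) (b := b) (by simp [ha])
  · simpa [rowGain, ha, hb] using gain_le_planC q (s := s) (a := a) (b := b) (by simp [ha])

lemma rowAt_le_planD {s a b : ℝ≥0} (ha : c < a) (hb : c ≤ b)
    (h : c < b ∨ ¬ ∃ a ≤ c, (planA q).W₁ a c) : rowAt c s a ≤ (planD q).gain s a b := by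
  by_cases hs : s ≤ c
  · have hW : (planD q).W₁ a b := Or.inl ⟨ha, hb⟩
    have hρ : (planD q).ρ₁ b = c := by
      by_cases hb' : c < b
      · simp [planD, hb']
      · have h1 : b = c := le_antisymm (not_lt.1 hb') hb
        subst h1
        have h2 := h.resolve_left hb'
        exact (if_neg hb').trans (if_pos ⟨rfl, h2⟩)
    rw [(planD q).gain_of_W₁ hW (hρ.symm ▸ hs)]
    simp [rowAt, ha, hs]
  · simpa [rowAt, ha, hs] using (planD q).gain_nonneg s a b

/-- Away from the lower side of the quadrant nothing changes. On that side, a winner at or below `c`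
shows that buyer 1 can win at every `a > c` too, at the retained price, and there her value exceeds
that of buyer 2. -/
lemma gain_le_planD {s a b : ℝ≥0} (h : ¬ (c < a ∧ c < b))
    (h' : ¬ (c < a ∧ b = c) ∨ ∃ a ≤ c, (planA q).W₁ a c) :
    M.gain s a b ≤ (planD q).gain s a b := by
  by_cases he : c < a ∧ b = c
  · obtain ⟨ha, rfl⟩ := he
    obtain ⟨a', h1, h2⟩ := h'.resolve_left (by simp [ha])
    have hW : (planD q).W₁ a b := Or.inl ⟨ha, le_rfl⟩
    have hρ : (planD q).ρ₁ b = M.f₁ b := by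
      have : ∃ a ≤ b, (planA q).W₁ a b := ⟨a', h1, h2⟩
      simp [planD, this]
    have hT : M.T₁ a b := h2.1.up (h1.trans_lt ha)
    by_cases hw₁ : M.w₁ s a b
    · rw [gain_of_w₁ hw₁, (planD q).gain_of_W₁ hW (hρ ▸ (M.le₁ hw₁).1)]
    · by_cases hw₂ : M.w₂ s a b
      · have h1 : s ≤ M.f₁ b := (hT.same ⟨s, hw₂⟩) ▸ (M.le₂ hw₂).1
        rw [gain_of_w₂ hw₂, (planD q).gain_of_W₁ hW (hρ ▸ h1)]
        exact sub_le_sub_right (NNReal.coe_le_coe.2 ha.le) _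
      · rw [gain_of_not hw₁ hw₂]
        exact (planD q).gain_nonneg _ _ _
  · refine (gain_le_planA q h).trans_eq ?_
    have h1 : ¬ (c < a ∧ c ≤ b) := fun h1 => by
      rcases h1.2.eq_or_lt with h2 | h2
      · exact he ⟨h1.1, h2.symm⟩
      · exact h ⟨h1.1, h2⟩
    have h2 : (planD q).W₁ a b ↔ (planA q).W₁ a b := by simp [planD, h1]
    have h3 : (planD q).W₂ a b ↔ (planA q).W₂ a b := by
      simp only [planD, h1, not_false_eq_true, true_and]
    have h4 : (planA q).W₁ a b → (planD q).ρ₁ b = (planA q).ρ₁ b := by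
      intro h4
      have h5 : ¬ c < b := by
        intro hb
        exact planA_not_W₁ q hb (not_lt.1 fun ha => h ⟨ha, hb⟩) h4
      have h6 : ¬ (b = c ∧ ¬ ∃ a ≤ c, (planA q).W₁ a c) := by
        rintro ⟨rfl, h6⟩
        exact h6 ⟨a, not_lt.1 fun ha => he ⟨ha, rfl⟩, h4⟩
      simp only [planD, h5, h6, if_false]
      rfl
    have h5 : (planD q).ρ₂ a = (planA q).ρ₂ a := rfl
    exact Plan.gain_congr h2.symm h3.symm (fun h6 => (h4 (h2.1 h6)).symm) fun _ => h5

/-- Giving the quadrant to buyer 1 conflicts with wins of buyer 2 on its lower side, which extend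
upward. If selling the row `c` to buyer 1 at price `c` earns no less than the present row, that side
can be reassigned as well. -/
lemma total_le_planD {n : ℕ} {s a b : ℕ → ℝ≥0}
    (h : quadrantSum n a b c (fun _ b => b) ≤ quadrantSum n a b c (fun a _ => a))
    (hXY : ∑ k ∈ Finset.range n, ∑ i ∈ Finset.range n, M.rowGain c (s k) (a i) ≤
      ∑ k ∈ Finset.range n, ∑ i ∈ Finset.range n, rowAt c (s k) (a i)) :
    total n s a b M.gain ≤ total n s a b (planD q).gain := by
  classical
  have h1 := total_quadrant_le q (s := s) le_rfl h
  rw [quadrantGain_fst] at h1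
  -- With a winner at or below `c`, the lower side is improved cell by cell; without one, only its
  -- sum is compared, through `hXY`.
  by_cases hlow : ∃ a ≤ c, (planA q).W₁ a c
  · rw [gain_decomp M c]
    refine (add_le_add le_rfl h1).trans ?_
    rw [← total_add]
    refine total_mono fun s a b => ?_
    by_cases ha : c < a <;> by_cases hb : c < b
    · simpa [ha, hb] using rowAt_le_planD q ha hb.le (Or.inl hb)
    · simpa [ha, hb] using gain_le_planD q (s := s) (a := a) (b := b) (by simp [hb]) (Or.inr hlow)
    · simpa [rowAt, ha, hb] using
        gain_le_planD q (s := s) (a := a) (b := b) (by simp [ha]) (Or.inr hlow)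
    · simpa [rowAt, ha, hb] using
        gain_le_planD q (s := s) (a := a) (b := b) (by simp [ha]) (Or.inr hlow)
  · have h2 : (0 : ℝ) ≤ ∑ j ∈ Finset.range n, if b j = c then (1 : ℝ) else 0 :=
      Finset.sum_nonneg fun _ _ => by split_ifs <;> norm_num
    have h3 := mul_le_mul_of_nonneg_left hXY h2
    rw [← total_rows n s a b (fun b => b = c), ← total_rows n s a b (fun b => b = c)] at h3
    rw [gain_decomp M c]
    have h4 : total n s a b (fun s a b => if c < a ∧ c < b then 0 else M.gain s a b) =
        total n s a b (fun s a b => if c < a ∧ c ≤ b then 0 else M.gain s a b) +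
          total n s a b (fun s a b => if b = c then M.rowGain c s a else 0) := by
      rw [← total_add]
      congr 1; funext s a b
      by_cases ha : c < a <;> rcases lt_trichotomy c b with hb | hb | hb
      · simp [ha, hb, hb.le, hb.ne']
      · subst hb; simp [ha, rowGain]
      · simp [ha, hb.not_gt, hb.not_ge, hb.ne]
      · simp [ha, hb.ne']
      · subst hb; simp [ha, rowGain]
      · simp [ha, hb.ne]
    rw [h4]
    refine (add_le_add (add_le_add le_rfl h3) h1).trans ?_
    rw [← total_add, ← total_add]
    refine total_mono fun s a b => ?_
    by_cases ha : c < a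
    · rcases lt_trichotomy c b with hb | hb | hb
      · simpa [ha, hb, hb.le, hb.ne'] using rowAt_le_planD q ha hb.le (Or.inl hb)
      · subst hb
        simpa [ha] using rowAt_le_planD q ha le_rfl (Or.inr hlow)
      · simpa [ha, hb.not_gt, hb.not_ge, hb.ne] using
          gain_le_planD q (s := s) (a := a) (b := b) (by simp [hb.le]) (Or.inl (by simp [hb.ne]))
    · simpa [rowAt, ha] using
        gain_le_planD q (s := s) (a := a) (b := b) (by simp [ha]) (Or.inl (by simp [ha]))

lemma exists_plan_of_quadrant (q : M.Quadrant c) (n : ℕ) (s a b : ℕ → ℝ≥0) :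
    ∃ L : Plan, total n s a b M.gain ≤ total n s a b L.gain := by
  rcases le_total (quadrantSum n a b c (fun a _ => a)) (quadrantSum n a b c (fun _ b => b))
    with h | h
  · exact ⟨_, total_le_planA q h⟩
  · rcases le_total (∑ k ∈ Finset.range n, ∑ i ∈ Finset.range n, M.rowGain c (s k) (a i))
      (∑ k ∈ Finset.range n, ∑ i ∈ Finset.range n, rowAt c (s k) (a i)) with h' | h'
    · exact ⟨_, total_le_planD q h h'⟩
    · exact ⟨_, total_le_planC q h h'⟩

/-- On finitely many samples, the gains from trade are at most those of a plan. -/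
theorem exists_plan (M : Slices) (n : ℕ) (s a b : ℕ → ℝ≥0) :
    ∃ L : Plan, total n s a b M.gain ≤ total n s a b L.gain := by
  by_cases h : ∃ c a b, M.StrictOverlap c a b
  · obtain ⟨c, a₀, b₀, h⟩ := h
    obtain ⟨t, ht⟩ := h.left
    -- The constructions assume that buyer 2 is the one who wins the overlap against the seller `0`;
    -- otherwise the buyers are exchanged.
    rcases M.sell₁ ht (h.eq₁ ▸ h.pos) with h0 | h0
    · obtain ⟨L, hL⟩ := exists_plan_of_quadrant (h.swap.quadrant h0) n s b a
      refine ⟨L.swap, ?_⟩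
      have h1 : M.swap.gain = fun x y z => M.gain x z y := by
        funext x y z; exact M.swap_gain x y z
      have h2 : L.swap.gain = fun x y z => L.gain x z y := by
        funext x y z; exact L.swap_gain x y z
      rw [h1, total_swap] at hL
      rw [h2]
      exact hL.trans_eq (total_swap n s b a L.gain).symm
    · exact exists_plan_of_quadrant (h.quadrant h0) n s a b
  · push Not at h
    exact ⟨M.planN h, total_mono fun s a b => gain_le_resolved (Q := fun _ _ => False) id⟩

end Slices

end GainsFromTrade

/-! ### Prices and slices of a simple mechanism -/

namespace GainsFromTrade

namespace Mechanism

variable {M : Mechanism} (hM : M.IsSimple) {s s' a a' b b' : ℝ≥0}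

/-- Buyer 1 wins at the values `s, a, b`. -/
def Wins₁ (M : Mechanism) (s a b : ℝ≥0) : Prop := M.alloc (mkProfile s a b) = Agent.b₁

/-- Buyer 2 wins at the values `s, a, b`. -/
def Wins₂ (M : Mechanism) (s a b : ℝ≥0) : Prop := M.alloc (mkProfile s a b) = Agent.b₂

/-- The amount paid to the seller. -/
def revenue (M : Mechanism) (s a b : ℝ≥0) : ℝ := -M.pay (mkProfile s a b) .s

include hM

lemma IsSimple.pay_sum (s a b : ℝ≥0) : M.revenue s a b =
    M.pay (mkProfile s a b) .b₁ + M.pay (mkProfile s a b) .b₂ := by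
  have := hM.stronglyBudgetBalanced (mkProfile s a b)
  have h : (Finset.univ : Finset Agent) = {Agent.s, Agent.b₁, Agent.b₂} := rfl
  rw [h] at this
  simp at this
  unfold revenue
  linarith

lemma IsSimple.pay_b₁ (h : M.Wins₁ s a b) : M.pay (mkProfile s a b) .b₁ = M.revenue s a b := by
  have h2 := hM.normalized .b₂ (mkProfile s a b) (by simp [Wins, show M.alloc _ = _ from h])
  rw [hM.pay_sum, h2, add_zero]

lemma IsSimple.pay_b₂ (h : M.Wins₂ s a b) : M.pay (mkProfile s a b) .b₂ = M.revenue s a b := by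
  have h2 := hM.normalized .b₁ (mkProfile s a b) (by simp [Wins, show M.alloc _ = _ from h])
  rw [hM.pay_sum, h2, zero_add]

lemma IsSimple.revenue_nonneg_of_trade (h : M.alloc (mkProfile s a b) ≠ .s) :
    (s : ℝ) ≤ M.revenue s a b := by
  have := hM.individuallyRational .s (mkProfile s a b) s
  rw [update_mkProfile_s] at this
  simp only [utility, h, ne_eq, not_false_eq_true, if_true] at this
  unfold revenue
  linarith

/-- Without trade a seller of value `s'` has utility `0`, and reporting `s` would earn him
`M.revenue s a b - s' > 0`. -/
lemma IsSimple.trade_of_lt (h : M.alloc (mkProfile s a b) ≠ .s) (h' : s' < M.revenue s a b) :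
    M.alloc (mkProfile s' a b) ≠ .s := by
  intro h0
  have h1 := hM.dsic .s (mkProfile s a b) s' s
  have h2 := hM.normalized .s (mkProfile s' a b) (by simp [Wins, h0])
  simp only [update_mkProfile_s, utility, h, h0, ne_eq, not_false_eq_true, if_true,
    not_true_eq_false, if_false, h2] at h1
  unfold revenue at h'
  linarith

lemma IsSimple.revenue_eq_of_trade (h : M.alloc (mkProfile s a b) ≠ .s)
    (h' : M.alloc (mkProfile s' a b) ≠ .s) : M.revenue s a b = M.revenue s' a b := by
  have h1 := hM.dsic .s (mkProfile s a b) s s'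
  have h2 := hM.dsic .s (mkProfile s a b) s' s
  simp only [update_mkProfile_s, utility, h, h', ne_eq, not_false_eq_true, if_true] at h1 h2
  unfold revenue
  linarith

lemma IsSimple.revenue_le₁ (h : M.Wins₁ s a b) : M.revenue s a b ≤ a := by
  have := hM.individuallyRational .b₁ (mkProfile s a b) a
  rw [update_mkProfile_b₁] at this
  simp only [utility, show M.alloc (mkProfile s a b) = _ from h, if_true, hM.pay_b₁ h] at this
  linarith

lemma IsSimple.revenue_le₂ (h : M.Wins₂ s a b) : M.revenue s a b ≤ b := by
  have := hM.individuallyRational .b₂ (mkProfile s a b) b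
  rw [update_mkProfile_b₂] at this
  simp only [utility, show M.alloc (mkProfile s a b) = _ from h, if_true, hM.pay_b₂ h] at this
  linarith

lemma IsSimple.wins₁_of_lt (h : M.Wins₁ s a b) (h' : M.revenue s a b < a') : M.Wins₁ s a' b := by
  by_contra h0
  have h1 := hM.dsic .b₁ (mkProfile s a b) a' a
  have h2 := hM.normalized .b₁ (mkProfile s a' b) h0
  simp only [update_mkProfile_b₁, utility, show M.alloc (mkProfile s a b) = _ from h,
    show ¬ M.alloc (mkProfile s a' b) = _ from h0, if_true, if_false, h2, hM.pay_b₁ h] at h1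
  linarith

lemma IsSimple.wins₂_of_lt (h : M.Wins₂ s a b) (h' : M.revenue s a b < b') : M.Wins₂ s a b' := by
  by_contra h0
  have h1 := hM.dsic .b₂ (mkProfile s a b) b' b
  have h2 := hM.normalized .b₂ (mkProfile s a b') h0
  simp only [update_mkProfile_b₂, utility, show M.alloc (mkProfile s a b) = _ from h,
    show ¬ M.alloc (mkProfile s a b') = _ from h0, if_true, if_false, h2, hM.pay_b₂ h] at h1
  linarith

lemma IsSimple.revenue_eq₁_same (h : M.Wins₁ s a b) (h' : M.Wins₁ s a' b) :
    M.revenue s a b = M.revenue s a' b := by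
  have h1 := hM.dsic .b₁ (mkProfile s a b) a a'
  have h2 := hM.dsic .b₁ (mkProfile s a b) a' a
  simp only [update_mkProfile_b₁, utility, show M.alloc (mkProfile s a b) = _ from h,
    show M.alloc (mkProfile s a' b) = _ from h', if_true, hM.pay_b₁ h, hM.pay_b₁ h'] at h1 h2
  linarith

lemma IsSimple.revenue_eq₂_same (h : M.Wins₂ s a b) (h' : M.Wins₂ s a b') :
    M.revenue s a b = M.revenue s a b' := by
  have h1 := hM.dsic .b₂ (mkProfile s a b) b b'
  have h2 := hM.dsic .b₂ (mkProfile s a b) b' b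
  simp only [update_mkProfile_b₂, utility, show M.alloc (mkProfile s a b) = _ from h,
    show M.alloc (mkProfile s a b') = _ from h', if_true, hM.pay_b₂ h, hM.pay_b₂ h'] at h1 h2
  linarith

omit hM in
lemma Wins₁.trade (h : M.Wins₁ s a b) : M.alloc (mkProfile s a b) ≠ .s := by
  rw [show M.alloc (mkProfile s a b) = _ from h]; simp

omit hM in
lemma Wins₂.trade (h : M.Wins₂ s a b) : M.alloc (mkProfile s a b) ≠ .s := by
  rw [show M.alloc (mkProfile s a b) = _ from h]; simp

/-- Buyer 1 wins in both situations at a common large value without changing her payment. At that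
profile only the seller's report differs, and his incentives make the revenue constant. -/
lemma IsSimple.revenue_eq₁ (h : M.Wins₁ s a b) (h' : M.Wins₁ s' a' b) :
    M.revenue s a b = M.revenue s' a' b := by
  have h1 := hM.wins₁_of_lt (a' := a + a' + 1) h
    ((hM.revenue_le₁ h).trans_lt (by push_cast; linarith [a'.coe_nonneg]))
  have h2 := hM.wins₁_of_lt (a' := a + a' + 1) h'
    ((hM.revenue_le₁ h').trans_lt (by push_cast; linarith [a.coe_nonneg]))
  rw [hM.revenue_eq₁_same h h1, hM.revenue_eq₁_same h' h2]
  exact hM.revenue_eq_of_trade h1.trade h2.trade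

lemma IsSimple.revenue_eq₂ (h : M.Wins₂ s a b) (h' : M.Wins₂ s' a b') :
    M.revenue s a b = M.revenue s' a b' := by
  have h1 := hM.wins₂_of_lt (b' := b + b' + 1) h
    ((hM.revenue_le₂ h).trans_lt (by push_cast; linarith [b'.coe_nonneg]))
  have h2 := hM.wins₂_of_lt (b' := b + b' + 1) h'
    ((hM.revenue_le₂ h').trans_lt (by push_cast; linarith [b.coe_nonneg]))
  rw [hM.revenue_eq₂_same h h1, hM.revenue_eq₂_same h' h2]
  exact hM.revenue_eq_of_trade h1.trade h2.trade

omit hM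

open Classical in
/-- The price at which buyer 1 trades when buyer 2 has value `b`. -/
noncomputable def price₁ (M : Mechanism) (b : ℝ≥0) : ℝ≥0 :=
  -- The default `0` is harmless: every field of `Slices` mentions this price only where buyer 1
  -- wins.
  if h : ∃ p : ℝ≥0 × ℝ≥0, M.Wins₁ p.1 p.2 b then (M.revenue h.choose.1 h.choose.2 b).toNNReal else 0

open Classical in
/-- The price at which buyer 2 trades when buyer 1 has value `a`. -/
noncomputable def price₂ (M : Mechanism) (a : ℝ≥0) : ℝ≥0 :=
  if h : ∃ p : ℝ≥0 × ℝ≥0, M.Wins₂ p.1 a p.2 then (M.revenue h.choose.1 a h.choose.2).toNNReal else 0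

include hM

lemma IsSimple.revenue_eq_price₁ (h : M.Wins₁ s a b) : M.revenue s a b = M.price₁ b := by
  have h' : ∃ p : ℝ≥0 × ℝ≥0, M.Wins₁ p.1 p.2 b := ⟨(s, a), h⟩
  have h0 := (NNReal.coe_nonneg s).trans (hM.revenue_nonneg_of_trade h.trade)
  rw [price₁, dif_pos h', hM.revenue_eq₁ h'.choose_spec h, Real.coe_toNNReal _ h0]

lemma IsSimple.revenue_eq_price₂ (h : M.Wins₂ s a b) : M.revenue s a b = M.price₂ a := by
  have h' : ∃ p : ℝ≥0 × ℝ≥0, M.Wins₂ p.1 a p.2 := ⟨(s, b), h⟩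
  have h0 := (NNReal.coe_nonneg s).trans (hM.revenue_nonneg_of_trade h.trade)
  rw [price₂, dif_pos h', hM.revenue_eq₂ h'.choose_spec h, Real.coe_toNNReal _ h0]

omit hM in
lemma wins_of_trade (h : M.alloc (mkProfile s a b) ≠ .s) : M.Wins₁ s a b ∨ M.Wins₂ s a b := by
  unfold Wins₁ Wins₂
  generalize M.alloc (mkProfile s a b) = x at h ⊢
  cases x <;> simp at h ⊢

omit hM in
/-- The system of slices of a simple mechanism. -/
noncomputable def IsSimple.slices (hM : M.IsSimple) : Slices where
  w₁ := M.Wins₁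
  w₂ := M.Wins₂
  f₁ := M.price₁
  f₂ := M.price₂
  le₁ h := by
    rw [← NNReal.coe_le_coe, ← NNReal.coe_le_coe, ← hM.revenue_eq_price₁ h]
    exact ⟨hM.revenue_nonneg_of_trade h.trade, hM.revenue_le₁ h⟩
  le₂ h := by
    rw [← NNReal.coe_le_coe, ← NNReal.coe_le_coe, ← hM.revenue_eq_price₂ h]
    exact ⟨hM.revenue_nonneg_of_trade h.trade, hM.revenue_le₂ h⟩
  up₁ h h' := hM.wins₁_of_lt h (by rwa [hM.revenue_eq_price₁ h, NNReal.coe_lt_coe])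
  up₂ h h' := hM.wins₂_of_lt h (by rwa [hM.revenue_eq_price₂ h, NNReal.coe_lt_coe])
  disj h h' := by
    rw [Wins₁] at h
    rw [Wins₂, h] at h'
    simp at h'
  sell₁ h h' := wins_of_trade
    (hM.trade_of_lt h.trade (by rwa [hM.revenue_eq_price₁ h, NNReal.coe_lt_coe]))
  sell₂ h h' := wins_of_trade
    (hM.trade_of_lt h.trade (by rwa [hM.revenue_eq_price₂ h, NNReal.coe_lt_coe]))
  same h h' := by
    rw [← NNReal.coe_inj, ← hM.revenue_eq_price₁ h, ← hM.revenue_eq_price₂ h']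
    exact hM.revenue_eq_of_trade h.trade h'.trade

lemma IsSimple.slices_gain (s a b : ℝ≥0) :
    hM.slices.gain s a b = M.gft (mkProfile s a b) := by
  classical
  unfold Slices.gain gft
  congr

lemma IsSimple.gft_nonneg (v : Profile) : 0 ≤ M.gft v := by
  rw [eq_mkProfile v, ← hM.slices_gain]
  exact Slices.gain_nonneg _ _ _ _

omit hM in
lemma gft_le_one (M : Mechanism) {v : Profile} (hv : ∀ i, v i ≤ 1) : M.gft v ≤ 1 := by
  have h1 : (v .b₁ : ℝ) ≤ 1 := mod_cast hv .b₁
  have h2 : (v .b₂ : ℝ) ≤ 1 := mod_cast hv .b₂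
  have h3 := (v .s).coe_nonneg
  unfold gft
  rcases M.alloc v <;> simp <;> linarith

end Mechanism

end GainsFromTrade

namespace GainsFromTrade

/-! ### Sorted samples -/

/-- Number of samples below `t`. -/
noncomputable def numLt (n : ℕ) (x : ℕ → ℝ≥0) (t : ℝ≥0) : ℕ := {i ∈ Finset.range n | x i < t}.card

/-- Number of samples that are at most `t`. -/
noncomputable def numLe (n : ℕ) (x : ℕ → ℝ≥0) (t : ℝ≥0) : ℕ := {i ∈ Finset.range n | x i ≤ t}.card

/-- The sorted sequence of the first `n` terms of `x`. -/
noncomputable def sorted (n : ℕ) (x : ℕ → ℝ≥0) (r : ℕ) : ℝ≥0 :=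
  {i ∈ Finset.range n | numLt n x (x i) ≤ r}.sup x

/-- The multiplicity of a value, at the last place where it occurs in the sorted sequence. -/
noncomputable def weight (n : ℕ) (x : ℕ → ℝ≥0) (r : ℕ) : ℕ :=
  {i ∈ Finset.range n | numLe n x (x i) = r + 1}.card

/-- The last place of the sample `x i` in the sorted sequence. -/
noncomputable def lastRank (n : ℕ) (x : ℕ → ℝ≥0) (i : ℕ) : ℕ := numLe n x (x i) - 1

section Sorted

variable {n : ℕ} {x : ℕ → ℝ≥0}

lemma sorted_mono : Monotone (sorted n x) := fun _ _ h =>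
  Finset.sup_mono fun _ hi => by
    simp only [Finset.mem_filter] at hi ⊢
    exact ⟨hi.1, hi.2.trans h⟩

lemma numLt_lt_numLe {i : ℕ} (hi : i < n) : numLt n x (x i) < numLe n x (x i) := by
  refine Finset.card_lt_card ⟨fun k hk => ?_, fun h => ?_⟩
  · simp only [Finset.mem_filter] at hk ⊢
    exact ⟨hk.1, hk.2.le⟩
  · have : i ∈ {k ∈ Finset.range n | x k ≤ x i} := by simp [hi]
    simpa using h this

lemma numLe_le_numLt {t u : ℝ≥0} (h : t < u) : numLe n x t ≤ numLt n x u := by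
  refine Finset.card_le_card fun k hk => ?_
  simp only [Finset.mem_filter] at hk ⊢
  exact ⟨hk.1, hk.2.trans_lt h⟩

lemma numLe_le : ∀ t, numLe n x t ≤ n := fun t =>
  (Finset.card_filter_le (Finset.range n) (fun i => x i ≤ t)).trans_eq (Finset.card_range n)

lemma lastRank_add_one {i : ℕ} (hi : i < n) : lastRank n x i + 1 = numLe n x (x i) :=
  Nat.sub_add_cancel (Nat.one_le_of_lt (numLt_lt_numLe hi))

lemma lastRank_lt {i : ℕ} (hi : i < n) : lastRank n x i < n := by
  have := lastRank_add_one (x := x) hi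
  have := numLe_le (n := n) (x := x) (x i)
  omega

lemma sorted_lastRank {i : ℕ} (hi : i < n) : sorted n x (lastRank n x i) = x i := by
  have h1 := lastRank_add_one (x := x) hi
  refine le_antisymm (Finset.sup_le fun k hk => ?_) (Finset.le_sup ?_)
  · by_contra! h
    have h2 := numLe_le_numLt (n := n) (x := x) h
    have h3 := (Finset.mem_filter.1 hk).2
    omega
  · have := numLt_lt_numLe (x := x) hi
    simp only [Finset.mem_filter, Finset.mem_range]
    omega

/-- The smallest sample above `x i` has no samples below it except those that are at most `x i`, so
its strict rank is at most `lastRank n x i + 1 ≤ r`. -/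
lemma lt_sorted {i r : ℕ} (hi : i < n) (h : lastRank n x i < r) (hr : r < n) :
    x i < sorted n x r := by
  have h1 := lastRank_add_one (x := x) hi
  have h2 : {k ∈ Finset.range n | x i < x k}.Nonempty := by
    by_contra! h3
    have h4 : numLe n x (x i) = n := by
      unfold numLe
      rw [Finset.filter_true_of_mem, Finset.card_range]
      intro k hk
      by_contra! h5
      have : k ∈ {k ∈ Finset.range n | x i < x k} := by simpa using ⟨Finset.mem_range.1 hk, h5⟩
      rw [h3] at this
      simp at this
    omega
  obtain ⟨k, hk, hmin⟩ := Finset.exists_min_image _ x h2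
  rw [Finset.mem_filter] at hk
  refine hk.2.trans_le (Finset.le_sup (f := x) ?_)
  rw [Finset.mem_filter]
  refine ⟨hk.1, ?_⟩
  have h5 : numLt n x (x k) ≤ numLe n x (x i) := by
    refine Finset.card_le_card fun l hl => ?_
    rw [Finset.mem_filter] at hl ⊢
    refine ⟨hl.1, ?_⟩
    by_contra! h6
    exact (hmin l (by rw [Finset.mem_filter]; exact ⟨hl.1, h6⟩)).not_gt hl.2
  omega

lemma sum_lastRank (φ : ℕ → ℝ) :
    ∑ i ∈ Finset.range n, φ (lastRank n x i) = ∑ r ∈ Finset.range n, weight n x r * φ r := by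
  rw [← Finset.sum_fiberwise_of_maps_to (g := lastRank n x) (t := Finset.range n)
    (fun i hi => Finset.mem_range.2 (lastRank_lt (Finset.mem_range.1 hi)))]
  refine Finset.sum_congr rfl fun r _ => ?_
  have h1 : weight n x r = {i ∈ Finset.range n | lastRank n x i = r}.card := by
    unfold weight
    congr 1
    refine Finset.filter_congr fun i hi => ?_
    rw [← lastRank_add_one (Finset.mem_range.1 hi)]
    omega
  rw [h1, ← nsmul_eq_mul]
  exact Finset.sum_eq_card_nsmul fun i hi => by rw [(Finset.mem_filter.1 hi).2]

/-- Each distinct value is counted once, with its multiplicity, at its last place. With tied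
breakpoints this is the line that `stepFunction` reads. -/
lemma sum_sorted (φ : ℝ≥0 → ℝ) :
    ∑ i ∈ Finset.range n, φ (x i) = ∑ r ∈ Finset.range n, weight n x r * φ (sorted n x r) := by
  rw [← sum_lastRank]
  exact Finset.sum_congr rfl fun i hi => by rw [sorted_lastRank (Finset.mem_range.1 hi)]

end Sorted

/-! ### Optimal prices -/

/-- Total gain of a buyer with samples `x` at the price `p`. -/
noncomputable def priceGain (n : ℕ) (s x : ℕ → ℝ≥0) (p : ℝ) : ℝ :=
  ∑ k ∈ Finset.range n, ∑ i ∈ Finset.range n,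
    if p ≤ x i ∧ (s k : ℝ) ≤ p then (x i : ℝ) - s k else 0

lemma priceGain_nonneg (n : ℕ) (s x : ℕ → ℝ≥0) (p : ℝ) : 0 ≤ priceGain n s x p :=
  Finset.sum_nonneg fun _ _ => Finset.sum_nonneg fun _ _ => by
    split_ifs with h
    · linarith
    · exact le_rfl

/-- `G i` is the best gain at a price in the list `S i, …, S (n - 1)`, and `P i` the price. -/
structure IsSuffixMax (n : ℕ) (g : ℝ → ℝ) (S G P : ℕ → ℝ) : Prop where
  -- Row `n` stands for no sale: gain `0`, and the entry `-1` that the tables read as the price `∞`.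
  last : G n = 0
  price_last : P n = -1
  of_le : ∀ i < n, G (i + 1) ≤ g (S i) → G i = g (S i) ∧ P i = S i
  of_gt : ∀ i < n, g (S i) < G (i + 1) → G i = G (i + 1) ∧ P i = P (i + 1)

namespace IsSuffixMax

variable {n : ℕ} {g : ℝ → ℝ} {S G P : ℕ → ℝ} (h : IsSuffixMax n g S G P)
include h

lemma le_of_lt {i : ℕ} (hi : i < n) : G (i + 1) ≤ G i ∧ g (S i) ≤ G i := by
  rcases le_or_gt (G (i + 1)) (g (S i)) with h1 | h1
  · have := h.of_le i hi h1
    exact ⟨this.1 ▸ h1, this.1.ge⟩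
  · have := h.of_gt i hi h1
    exact ⟨this.1.ge, this.1 ▸ h1.le⟩

lemma anti {i j : ℕ} (hij : i ≤ j) (hj : j ≤ n) : G j ≤ G i := by
  induction j, hij using Nat.le_induction with
  | base => exact le_rfl
  | succ j hij ih => exact (h.le_of_lt hj).1.trans (ih (by omega))

/-- Gains are nonnegative, so the sentinel gain `0` never strictly beats a real price and `-1` is
not propagated to rows below `n`. -/
lemma spec (hg : ∀ p, 0 ≤ g p) {i : ℕ} (hi : i < n) :
    g (P i) = G i ∧ ∃ k, i ≤ k ∧ k < n ∧ P i = S k := by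
  induction hm : n - i generalizing i with
  | zero => omega
  | succ m ih =>
    rcases le_or_gt (G (i + 1)) (g (S i)) with h1 | h1
    · have h2 := h.of_le i hi h1
      exact ⟨by rw [h2.1, h2.2], i, le_rfl, hi, h2.2⟩
    · have h2 := h.of_gt i hi h1
      have h3 : i + 1 < n := by
        rcases Nat.lt_or_ge (i + 1) n with h4 | h4
        · exact h4
        · have h5 : i + 1 = n := by omega
          rw [h5, h.last] at h1
          exact absurd h1 (hg _).not_gt
      obtain ⟨h4, k, h5, h6, h7⟩ := ih h3 (by omega)
      exact ⟨by rw [h2.1, h2.2, h4], k, by omega, h6, by rw [h2.2, h7]⟩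

/-- Going down one row either keeps the price or replaces it by the current entry, while the old
price is a later entry of an increasing list. This is the source of the monotonicity of the output.
-/
lemma price_mono (hg : ∀ p, 0 ≤ g p) (hS : Monotone S) {i j : ℕ} (hij : i ≤ j) (hj : j < n) :
    P i ≤ P j := by
  induction j, hij using Nat.le_induction with
  | base => exact le_rfl
  | succ j hij ih =>
    refine (ih (by omega)).trans ?_
    have hj' : j < n := by omega
    rcases le_or_gt (G (j + 1)) (g (S j)) with h1 | h1
    · obtain ⟨_, k, h5, _, h7⟩ := h.spec hg hj
      rw [(h.of_le j hj' h1).2, h7]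
      exact hS (by omega)
    · exact (h.of_gt j hj' h1).2.le

end IsSuffixMax

/-- Gain of a buyer with samples `x` whose winning values are those in `W`, at a price `ρ`. -/
lemma exists_threshold {n : ℕ} {s x : ℕ → ℝ≥0} {G P : ℕ → ℝ}
    (h : IsSuffixMax n (priceGain n s x) (fun r => sorted n x r) G P) (W : ℝ≥0 → Prop)
    [DecidablePred W] (hW : ∀ {v v'}, W v → v < v' → W v') (ρ : ℝ≥0) (hρ : ∀ {v}, W v → ρ ≤ v) :
    ∃ α ≤ n, (∀ i < n, α ≤ i ↔ W (sorted n x i)) ∧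
      ∑ k ∈ Finset.range n, ∑ i ∈ Finset.range n,
        (if W (x i) ∧ s k ≤ ρ then (x i : ℝ) - s k else 0) ≤ G α := by
  -- The first alternative makes the threshold equal to `n` when no sample wins.
  have hex : ∃ i, n ≤ i ∨ W (sorted n x i) := ⟨n, Or.inl le_rfl⟩
  have hle : Nat.find hex ≤ n := Nat.find_min' hex (Or.inl le_rfl)
  have hiff : ∀ i < n, Nat.find hex ≤ i ↔ W (sorted n x i) := by
    refine fun i hi => ⟨fun h1 => ?_, fun h1 => Nat.find_min' hex (Or.inr h1)⟩
    have h2 := (Nat.find_spec hex).resolve_left (by omega)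
    rcases (sorted_mono (n := n) (x := x) h1).eq_or_lt with h3 | h3
    · exact h3 ▸ h2
    · exact hW h2 h3
  refine ⟨_, hle, hiff, ?_⟩
  generalize Nat.find hex = α at hle hiff
  have hx : ∀ i < n, W (x i) → α ≤ lastRank n x i := fun i hi hw => by
    rw [hiff _ (lastRank_lt hi), sorted_lastRank hi]
    exact hw
  rcases hle.eq_or_lt with h1 | h1
  · rw [h1, h.last]
    refine (Finset.sum_eq_zero fun k _ => Finset.sum_eq_zero fun i hi => if_neg fun h2 => ?_).le
    have := hx i (Finset.mem_range.1 hi) h2.1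
    have := lastRank_lt (x := x) (Finset.mem_range.1 hi)
    omega
  · refine le_trans ?_ (h.le_of_lt h1).2
    -- Raising the price from `ρ` to the smallest winning sample keeps all winners and can only
    -- attract more sellers.
    have hp : ρ ≤ sorted n x α := hρ ((hiff α h1).1 le_rfl)
    refine Finset.sum_le_sum fun k _ => Finset.sum_le_sum fun i hi => ?_
    split_ifs with h2 h3 h3
    · exact le_rfl
    · refine absurd ⟨?_, ?_⟩ h3
      · have h4 := sorted_mono (n := n) (x := x) (hx i (Finset.mem_range.1 hi) h2.1)
        rw [sorted_lastRank (Finset.mem_range.1 hi)] at h4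
        exact_mod_cast h4
      · exact_mod_cast h2.2.trans hp
    · linarith
    · exact le_rfl

/-! ### Dynamic programming over staircase paths -/

/-- `D i j` is the best gain from the columns `i, …, n - 1` and the rows `j, …, n - 1`: a column
passed at height `j` earns `G₂ j` and a row passed at position `i` earns `G₁ i`. -/
structure IsPathValue (n : ℕ) (w₁ w₂ G₁ G₂ : ℕ → ℝ) (D : ℕ → ℕ → ℝ) : Prop where
  right : ∀ j ≤ n, D n j = 0
  top : ∀ i ≤ n, D i n = 0
  step : ∀ i < n, ∀ j < n, D i j = max (w₁ i * G₂ j + D (i + 1) j) (w₂ j * G₁ i + D i (j + 1))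

/-- Thresholds are clamped to the rectangle beyond `(i, j)`. Advancing in one direction changes no
clamped threshold of the other buyer, provided the direction is chosen by the case distinction
below. The given thresholds need not be monotone. -/
lemma IsPathValue.thresholds_le {n : ℕ} {w₁ w₂ G₁ G₂ : ℕ → ℝ} {D : ℕ → ℕ → ℝ}
    (h : IsPathValue n w₁ w₂ G₁ G₂ D) (hw₁ : ∀ i, 0 ≤ w₁ i) (hw₂ : ∀ j, 0 ≤ w₂ j)
    (hG₁ : ∀ i j, i ≤ j → j ≤ n → G₁ j ≤ G₁ i) (hG₂ : ∀ i j, i ≤ j → j ≤ n → G₂ j ≤ G₂ i)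
    (h₁ : G₁ n = 0) (h₂ : G₂ n = 0) {α β : ℕ → ℕ} (hα : ∀ j, α j ≤ n) (hβ : ∀ i, β i ≤ n)
    (hαβ : ∀ i < n, ∀ j < n, α j ≤ i → ¬ β i ≤ j) {i j : ℕ} (hi : i ≤ n) (hj : j ≤ n) :
    ∑ i' ∈ Finset.Ico i n, w₁ i' * G₂ (max (β i') j) +
      ∑ j' ∈ Finset.Ico j n, w₂ j' * G₁ (max (α j') i) ≤ D i j := by
  induction hm : (n - i) + (n - j) using Nat.strong_induction_on generalizing i j with
  | _ m ih =>
    rcases hi.eq_or_lt with rfl | hi'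
    · rw [h.right j hj]
      simp [hα, h₁]
    rcases hj.eq_or_lt with rfl | hj'
    · rw [h.top i hi]
      simp [hβ, h₂]
    rw [h.step i hi' j hj']
    -- If buyer 2 wins in the row `j` at some remaining column `i'`, disjointness puts the
    -- thresholds of all remaining rows beyond `i' ≥ i`, so column `i` can be passed. Otherwise the
    -- thresholds of all remaining columns exceed `j`, and row `j` can be passed.
    by_cases hc : ∃ i', i ≤ i' ∧ i' < n ∧ β i' ≤ j
    · obtain ⟨i', hi1, hi2, hi3⟩ := hc
      refine le_trans ?_ (le_max_left _ _)
      have h3 := ih _ (by omega) (i := i + 1) (j := j) (by omega) hj rfl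
      refine le_trans ?_ (add_le_add le_rfl h3)
      rw [← add_assoc, Finset.sum_eq_sum_Ico_succ_bot hi']
      refine add_le_add (add_le_add ?_ le_rfl) (Finset.sum_le_sum fun j' hj'' => ?_)
      · exact mul_le_mul_of_nonneg_left (hG₂ _ _ (le_max_right _ _) (max_le (hβ _) hj)) (hw₁ _)
      · rw [Finset.mem_Ico] at hj''
        have h4 : i + 1 ≤ α j' := by
          by_contra! h5
          exact hαβ i' hi2 j' hj''.2 (by omega) (by omega)
        rw [max_eq_left h4, max_eq_left (by omega)]
    · push Not at hc
      refine le_trans ?_ (le_max_right _ _)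
      have h3 := ih _ (by omega) (i := i) (j := j + 1) hi (by omega) rfl
      refine le_trans ?_ (add_le_add le_rfl h3)
      rw [← add_assoc, add_comm (w₂ j * G₁ i), add_assoc, Finset.sum_eq_sum_Ico_succ_bot hj']
      refine add_le_add (Finset.sum_le_sum fun i' hi'' => ?_) (add_le_add ?_ le_rfl)
      · rw [Finset.mem_Ico] at hi''
        have h4 := hc i' hi''.1 hi''.2
        rw [max_eq_left h4.le, max_eq_left (by omega)]
      · exact mul_le_mul_of_nonneg_left (hG₁ _ _ (le_max_right _ _) (max_le (hα _) hi)) (hw₂ _)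

lemma total_eq_buyers (n : ℕ) (s a b : ℕ → ℝ≥0) (F₁ F₂ : ℝ≥0 → ℝ≥0 → ℝ≥0 → ℝ) :
    total n s a b (fun s a b => F₁ s a b + F₂ s b a) =
      ∑ j ∈ Finset.range n, ∑ k ∈ Finset.range n, ∑ i ∈ Finset.range n, F₁ (s k) (a i) (b j) +
      ∑ i ∈ Finset.range n, ∑ k ∈ Finset.range n, ∑ j ∈ Finset.range n, F₂ (s k) (b j) (a i) := by
  rw [total_add, total_eq_rows, ← total_swap, total_eq_rows]

/-- The data of an optimal pair of price functions for samples `s, a, b`. -/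
structure Tables (n : ℕ) (s a b : ℕ → ℝ≥0) (G₁ P₁ G₂ P₂ : ℕ → ℝ) (D : ℕ → ℕ → ℝ) : Prop where
  max₁ : IsSuffixMax n (priceGain n s a) (fun r => sorted n a r) G₁ P₁
  max₂ : IsSuffixMax n (priceGain n s b) (fun r => sorted n b r) G₂ P₂
  value : IsPathValue n (fun r => weight n a r) (fun r => weight n b r) G₁ G₂ D

/-- No plan has larger gains than the value of the dynamic program. -/
lemma Tables.plan_le {n : ℕ} {s a b : ℕ → ℝ≥0} {G₁ P₁ G₂ P₂ : ℕ → ℝ} {D : ℕ → ℕ → ℝ}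
    (h : Tables n s a b G₁ P₁ G₂ P₂ D) (L : Plan) : total n s a b L.gain ≤ D 0 0 := by
  classical
  have h1 : ∀ j, ∃ α ≤ n, _ := fun j => exists_threshold h.max₁ (fun v => L.W₁ v (sorted n b j))
    L.up₁ (L.ρ₁ (sorted n b j)) L.le₁
  have h2 : ∀ i, ∃ β ≤ n, _ := fun i => exists_threshold h.max₂ (fun v => L.W₂ (sorted n a i) v)
    L.up₂ (L.ρ₂ (sorted n a i)) L.le₂
  choose α hα hα1 hα2 using h1
  choose β hβ hβ1 hβ2 using h2
  have h3 := h.value.thresholds_le (fun _ => Nat.cast_nonneg _) (fun _ => Nat.cast_nonneg _)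
    (fun _ _ => h.max₁.anti) (fun _ _ => h.max₂.anti) h.max₁.last h.max₂.last hα hβ
    (fun i hi j hj h4 h5 => L.disj ((hα1 j i hi).1 h4) ((hβ1 i j hj).1 h5))
    (Nat.zero_le n) (Nat.zero_le n)
  refine le_trans ?_ h3
  have h4 : total n s a b L.gain = total n s a b (fun s a b =>
      (if L.W₁ a b ∧ s ≤ L.ρ₁ b then (a : ℝ) - s else 0) +
        (if L.W₂ a b ∧ s ≤ L.ρ₂ a then (b : ℝ) - s else 0)) := rfl
  rw [h4, total_eq_buyers n s a b
    (fun s a b => if L.W₁ a b ∧ s ≤ L.ρ₁ b then (a : ℝ) - s else 0)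
    (fun s b a => if L.W₂ a b ∧ s ≤ L.ρ₂ a then (b : ℝ) - s else 0), add_comm]
  rw [sum_sorted (x := b) (fun v => ∑ k ∈ Finset.range n, ∑ i ∈ Finset.range n,
      (if L.W₁ (a i) v ∧ s k ≤ L.ρ₁ v then (a i : ℝ) - s k else 0)),
    sum_sorted (x := a) (fun v => ∑ k ∈ Finset.range n, ∑ j ∈ Finset.range n,
      (if L.W₂ v (b j) ∧ s k ≤ L.ρ₂ v then (b j : ℝ) - s k else 0))]
  simp only [Nat.zero_le, sup_of_le_left, ← Finset.range_eq_Ico]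
  exact add_le_add
    (Finset.sum_le_sum fun i _ => mul_le_mul_of_nonneg_left (hβ2 i) (Nat.cast_nonneg _))
    (Finset.sum_le_sum fun j _ => mul_le_mul_of_nonneg_left (hα2 j) (Nat.cast_nonneg _))

/-- A staircase path: row `j` is passed at position `x j`, column `i` at height `y i`. -/
structure IsPath (n : ℕ) (w₁ w₂ G₁ G₂ : ℕ → ℝ) (v : ℝ) (x y : ℕ → ℕ) : Prop where
  le₁ : ∀ j < n, x j ≤ n
  le₂ : ∀ i < n, y i ≤ n
  mono₁ : ∀ j j', j ≤ j' → j' < n → x j ≤ x j'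
  mono₂ : ∀ i i', i ≤ i' → i' < n → y i ≤ y i'
  disj : ∀ i < n, ∀ j < n, x j ≤ i → ¬ y i ≤ j
  value : v ≤ ∑ j ∈ Finset.range n, w₂ j * G₁ (x j) + ∑ i ∈ Finset.range n, w₁ i * G₂ (y i)

end GainsFromTrade

namespace GainsFromTrade

/-! ### Step functions given by tables -/

/-- The price written as `p` in a table. -/
noncomputable def tablePrice (p : ℝ) : ℝ≥0∞ := if p < 0 then ⊤ else ENNReal.ofReal p

lemma stepFunction_eq_of_last {s p : ℕ → ℝ} {n k : ℕ} {v : ℝ≥0} (hk : k < n) (h : s k ≤ v)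
    (h' : ∀ l, k < l → l < n → (v : ℝ) < s l) : stepFunction s p n v = tablePrice (p k) := by
  induction n with
  | zero => omega
  | succ n ih =>
    rw [stepFunction]
    rcases Nat.lt_succ_iff_lt_or_eq.1 hk with hk' | rfl
    · rw [if_neg (h' n hk' (by omega)).not_ge]
      exact ih hk' fun l h1 h2 => h' l h1 (by omega)
    · rw [if_pos h]
      rfl

lemma stepFunction_cases (s p : ℕ → ℝ) (n : ℕ) (v : ℝ≥0) :
    ((∀ l < n, (v : ℝ) < s l) ∧ stepFunction s p n v = ⊤) ∨
      ∃ k < n, s k ≤ v ∧ (∀ l, k < l → l < n → (v : ℝ) < s l) ∧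
        stepFunction s p n v = tablePrice (p k) := by
  by_cases h : ∃ k < n, s k ≤ v
  · right
    obtain ⟨k₀, h1, h2⟩ := h
    obtain ⟨k, hk, hmax⟩ := Finset.exists_max_image {k ∈ Finset.range n | s k ≤ v} id
      ⟨k₀, by simp [h1, h2]⟩
    simp only [Finset.mem_filter, Finset.mem_range, id] at hk hmax
    have h3 : ∀ l, k < l → l < n → (v : ℝ) < s l := fun l h3 h4 => by
      by_contra! h5
      have := hmax l ⟨h4, h5⟩
      omega
    exact ⟨k, hk.1, hk.2, h3, stepFunction_eq_of_last hk.1 hk.2 h3⟩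
  · left
    push Not at h
    refine ⟨h, ?_⟩
    induction n with
    | zero => rfl
    | succ n ih =>
      rw [stepFunction, if_neg (h n (by omega)).not_ge]
      exact ih fun k hk => h k (by omega)

lemma measurable_stepFunction (s p : ℕ → ℝ) (n : ℕ) : Measurable (stepFunction s p n) := by
  induction n with
  | zero => exact measurable_const
  | succ n ih =>
    exact Measurable.ite (measurableSet_le measurable_const measurable_subtype_coe)
      measurable_const ih

/-- The function is monotone where it is finite, and the set where it is finite is an interval. -/
def IntervalMonotone (f : ℝ≥0 → ℝ≥0∞) : Prop :=
  ∀ v v' v'' : ℝ≥0, v ≤ v' → v' ≤ v'' → f v ≠ ⊤ → f v'' ≠ ⊤ → f v ≤ f v' ∧ f v' ≤ f v''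

/-- Sample-based price functions for which uniform convergence holds. -/
structure GoodPair (f₁ f₂ : ℝ≥0 → ℝ≥0∞) : Prop where
  disj : ClosedDisjoint f₁ f₂
  meas₁ : Measurable f₁
  meas₂ : Measurable f₂
  mono₁ : IntervalMonotone f₁
  mono₂ : IntervalMonotone f₂

/-! ### Price tables built from suffix maxima and monotone indices -/

section

variable {n : ℕ} {g : ℝ → ℝ} {x : ℕ → ℝ≥0} {G P : ℕ → ℝ}
    (h : IsSuffixMax n g (fun r => sorted n x r) G P) (hg : ∀ p, 0 ≤ g p)
include h hg

lemma IsSuffixMax.price_nonneg {i : ℕ} (hi : i < n) : 0 ≤ P i := by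
  obtain ⟨_, k, _, _, h3⟩ := h.spec hg hi
  rw [h3]
  exact NNReal.coe_nonneg _

lemma IsSuffixMax.tablePrice_eq {i : ℕ} (hi : i < n) :
    tablePrice (P i) = ENNReal.ofReal (P i) := if_neg (h.price_nonneg hg hi).not_gt

omit hg in
lemma IsSuffixMax.tablePrice_last : tablePrice (P n) = ⊤ := by
  rw [h.price_last]
  exact if_pos (by norm_num)

/-- The table with prices `P (z k)` for a monotone `z`. -/
lemma IsSuffixMax.intervalMonotone {z : ℕ → ℕ} (s : ℕ → ℝ) (hz : ∀ j < n, z j ≤ n)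
    (hz' : ∀ j j', j ≤ j' → j' < n → z j ≤ z j') :
    IntervalMonotone (stepFunction s (fun k => P (z k)) n) := by
  intro v v' v'' h1 h2 h3 h4
  rcases stepFunction_cases s (fun k => P (z k)) n v with h5 | ⟨k, hk, hk1, -, hk2⟩
  · exact absurd h5.2 h3
  rcases stepFunction_cases s (fun k => P (z k)) n v' with h5 | ⟨k', hk', hk1', hk3', hk2'⟩
  · exact absurd (hk1.trans (NNReal.coe_le_coe.2 h1)) (h5.1 k hk).not_ge
  rcases stepFunction_cases s (fun k => P (z k)) n v'' with h5 | ⟨k'', hk'', -, hk3'', hk2''⟩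
  · exact absurd h5.2 h4
  have hkk' : k ≤ k' := by
    by_contra! h6
    exact (hk3' k h6 hk).not_ge (hk1.trans (NNReal.coe_le_coe.2 h1))
  have hkk'' : k' ≤ k'' := by
    by_contra! h6
    exact (hk3'' k' h6 hk').not_ge (hk1'.trans (NNReal.coe_le_coe.2 h2))
  rw [hk2, hk2', hk2'']
  rw [hk2''] at h4
  have h6 : z k'' < n := lt_of_le_of_ne (hz _ hk'') fun h7 => h4 (by rw [h7, h.tablePrice_last])
  have h7 := hz' _ _ hkk'' hk''
  have h8 := hz' _ _ hkk' hk'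
  have hS : Monotone fun r => (sorted n x r : ℝ) := fun _ _ h => NNReal.coe_le_coe.2 (sorted_mono h)
  rw [h.tablePrice_eq hg h6, h.tablePrice_eq hg (h7.trans_lt h6),
    h.tablePrice_eq hg (h8.trans_lt (h7.trans_lt h6))]
  exact ⟨ENNReal.ofReal_le_ofReal (h.price_mono hg hS h8 (h7.trans_lt h6)),
    ENNReal.ofReal_le_ofReal (h.price_mono hg hS h7 h6)⟩

/-- A price at most `v` in the table comes from a line that is in the range of `v`. -/
lemma IsSuffixMax.of_stepFunction_le {z : ℕ → ℕ} {s : ℕ → ℝ} {u v : ℝ≥0} (hz : ∀ j < n, z j ≤ n)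
    (hv : stepFunction s (fun k => P (z k)) n u ≤ v) :
    ∃ k < n, (∀ l, k < l → l < n → (u : ℝ) < s l) ∧ z k < n ∧ (sorted n x (z k) : ℝ) ≤ v := by
  rcases stepFunction_cases s (fun k => P (z k)) n u with h5 | ⟨k, hk, -, hk1, hk2⟩
  · rw [h5.2] at hv
    simp at hv
  rw [hk2] at hv
  have h6 : z k < n := lt_of_le_of_ne (hz _ hk) fun h7 => by
    rw [h7, h.tablePrice_last] at hv
    simp at hv
  refine ⟨k, hk, hk1, h6, ?_⟩
  rw [h.tablePrice_eq hg h6] at hv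
  have h7 : P (z k) ≤ v := by
    have := ENNReal.toReal_mono ENNReal.coe_ne_top hv
    rwa [ENNReal.toReal_ofReal (h.price_nonneg hg h6), ENNReal.coe_toReal] at this
  obtain ⟨_, l, h8, _, h9⟩ := h.spec hg h6
  exact (NNReal.coe_le_coe.2 (sorted_mono h8)).trans (h9.symm.trans_le h7)

end

variable {n : ℕ} {s a b : ℕ → ℝ≥0} {G₁ P₁ G₂ P₂ : ℕ → ℝ} {D : ℕ → ℕ → ℝ}
  (h : Tables n s a b G₁ P₁ G₂ P₂ D) {x y : ℕ → ℕ}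
  (hp : IsPath n (fun r => weight n a r) (fun r => weight n b r) G₁ G₂ (D 0 0) x y)
include h hp

/-- Reports that reach both prices lie in lines `j` and `i` of the tables. Prices come from samples
at or after the path positions, so the reports satisfy `x j ≤ i` and `y i ≤ j`, which the path
excludes. -/
lemma Tables.goodPair : GoodPair (stepFunction (fun r => sorted n b r) (fun j => P₁ (x j)) n)
    (stepFunction (fun r => sorted n a r) (fun i => P₂ (y i)) n) where
  disj := by
    intro v₁ v₂ h1 h2
    obtain ⟨j, hj, hj1, hj2, hj3⟩ := h.max₁.of_stepFunction_le (priceGain_nonneg _ _ _) hp.le₁ h1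
    obtain ⟨i, hi, hi1, hi2, hi3⟩ := h.max₂.of_stepFunction_le (priceGain_nonneg _ _ _) hp.le₂ h2
    refine hp.disj i hi j hj ?_ ?_
    · by_contra! h3
      exact (hi1 _ h3 hj2).not_ge hj3
    · by_contra! h3
      exact (hj1 _ h3 hi2).not_ge hi3
  meas₁ := measurable_stepFunction _ _ _
  meas₂ := measurable_stepFunction _ _ _
  mono₁ := h.max₁.intervalMonotone (priceGain_nonneg _ _ _) _ hp.le₁ hp.mono₁
  mono₂ := h.max₂.intervalMonotone (priceGain_nonneg _ _ _) _ hp.le₂ hp.mono₂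

-- A sample of the other buyer reads the table line of its last place. The price there realizes the
-- suffix maximum, and ties are collected by `weight`.
omit h hp in
open Classical in
lemma IsSuffixMax.sum_trades {s x u : ℕ → ℝ≥0} {G P : ℕ → ℝ}
    (h : IsSuffixMax n (priceGain n s x) (fun r => sorted n x r) G P) {z : ℕ → ℕ}
    (hz : ∀ j < n, z j ≤ n) :
    ∑ j ∈ Finset.range n, ∑ k ∈ Finset.range n, ∑ i ∈ Finset.range n,
      (if Trades (stepFunction (fun r => sorted n u r) (fun k => P (z k)) n (u j)) (s k) (x i)
        then (x i : ℝ) - s k else 0) =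
    ∑ j ∈ Finset.range n, weight n u j * G (z j) := by
  rw [← sum_lastRank]
  refine Finset.sum_congr rfl fun j hj => ?_
  have hj := Finset.mem_range.1 hj
  have h1 := lastRank_lt (x := u) hj
  rw [stepFunction_eq_of_last h1 (by rw [sorted_lastRank hj]) fun l h2 h3 =>
    NNReal.coe_lt_coe.2 (lt_sorted hj h2 h3)]
  generalize lastRank n u j = r at h1
  rcases (hz r h1).eq_or_lt with h2 | h2
  · rw [h2, h.tablePrice_last, h.last]
    refine Finset.sum_eq_zero fun k _ => Finset.sum_eq_zero fun i _ => if_neg fun h3 => ?_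
    exact absurd h3.1 (by simp)
  · rw [h.tablePrice_eq (priceGain_nonneg _ _ _) h2, ← (h.spec (priceGain_nonneg _ _ _) h2).1,
      priceGain]
    refine Finset.sum_congr rfl fun k _ => Finset.sum_congr rfl fun i _ => ?_
    have h3 := h.price_nonneg (priceGain_nonneg _ _ _) h2
    have h4 : Trades (ENNReal.ofReal (P (z r))) (s k) (x i) ↔
        P (z r) ≤ x i ∧ (s k : ℝ) ≤ P (z r) := by
      unfold Trades
      rw [← ENNReal.ofReal_coe_nnreal, ← ENNReal.ofReal_coe_nnreal,
        ENNReal.ofReal_le_ofReal_iff (NNReal.coe_nonneg _), ENNReal.ofReal_le_ofReal_iff h3]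
    simp only [h4]

/-- The output is at least as good on the samples as any simple mechanism. -/
lemma Tables.optimal {M : Mechanism} (hM : M.IsSimple) :
    total n s a b (fun s a b => M.gft (mkProfile s a b)) ≤
      total n s a b (fun t u v => (pairMechanism
        (stepFunction (fun r => sorted n b r) (fun j => P₁ (x j)) n)
        (stepFunction (fun r => sorted n a r) (fun i => P₂ (y i)) n)).gft (mkProfile t u v)) := by
  classical
  obtain ⟨L, hL⟩ := hM.slices.exists_plan n s a b
  simp only [← hM.slices_gain]
  -- The chain is: mechanism, plan, value of the dynamic program, gain along the traced path; the
  -- last is what the output earns.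
  refine (hL.trans (h.plan_le L)).trans (hp.value.trans_eq ?_)
  simp only [(h.goodPair hp).disj.gft_eq]
  rw [total_eq_buyers n s a b (fun t u v => if Trades (stepFunction _ _ n v) t u
      then (u : ℝ) - t else 0) (fun t v u => if Trades (stepFunction _ _ n u) t v
      then (v : ℝ) - t else 0), h.max₁.sum_trades hp.le₁, h.max₂.sum_trades hp.le₂]

end GainsFromTrade

namespace GainsFromTrade

/-! ### Reasoning about programs -/

/-- The registers that a program may change. -/
def Program.regs : Program → List ℕ
  | skip => []
  | setReg x _ => [x]
  | setCell _ _ _ _ => []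
  | draw _ _ _ _ => []
  | seq c d => c.regs ++ d.regs
  | branch _ c d => c.regs ++ d.regs
  | loop _ c => c.regs

/-- The arrays that a program may change. -/
def Program.arrays : Program → List ℕ
  | skip => []
  | setReg _ _ => []
  | setCell a _ _ _ => [a]
  | draw _ a _ _ => [a]
  | seq c d => c.arrays ++ d.arrays
  | branch _ c d => c.arrays ++ d.arrays
  | loop _ c => c.arrays

/-- The program draws no samples. -/
def Program.NoDraw : Program → Prop
  | skip => True
  | setReg _ _ => True
  | setCell _ _ _ _ => True
  | draw _ _ _ _ => False
  | seq c d => c.NoDraw ∧ d.NoDraw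
  | branch _ c d => c.NoDraw ∧ d.NoDraw
  | loop _ c => c.NoDraw

/-- The two states agree except for what `c` may change. -/
structure Keeps (c : Program) (σ τ : State) : Prop where
  reg : ∀ x ∉ c.regs, τ.reg x = σ.reg x
  cell : ∀ a ∉ c.arrays, τ.cell a = σ.cell a
  drawn : c.NoDraw → τ.drawn = σ.drawn

lemma Keeps.refl (c : Program) (σ : State) : Keeps c σ σ := ⟨fun _ _ => rfl, fun _ _ => rfl, fun _ => rfl⟩

lemma Keeps.trans {c : Program} {σ τ υ : State} (h : Keeps c σ τ) (h' : Keeps c τ υ) :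
    Keeps c σ υ :=
  ⟨fun x hx => (h'.reg x hx).trans (h.reg x hx), fun a ha => (h'.cell a ha).trans (h.cell a ha),
    fun hc => (h'.drawn hc).trans (h.drawn hc)⟩

lemma Keeps.seq_left {c d : Program} {σ τ : State} (h : Keeps c σ τ) : Keeps (.seq c d) σ τ :=
  ⟨fun x hx => h.reg x fun h' => hx (List.mem_append_left _ h'),
    fun a ha => h.cell a fun h' => ha (List.mem_append_left _ h'), fun hc => h.drawn hc.1⟩

lemma Keeps.seq_right {c d : Program} {σ τ : State} (h : Keeps d σ τ) : Keeps (.seq c d) σ τ :=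
  ⟨fun x hx => h.reg x fun h' => hx (List.mem_append_right _ h'),
    fun a ha => h.cell a fun h' => ha (List.mem_append_right _ h'), fun hc => h.drawn hc.2⟩

lemma Keeps.of_loop_body {b : BExp} {c : Program} {σ τ : State} (h : Keeps c σ τ) :
    Keeps (.loop b c) σ τ := ⟨h.reg, h.cell, h.drawn⟩

lemma Exec.keeps {ω : SampleStream} {c : Program} {σ τ : State} {t : ℕ} (h : Exec ω c σ t τ) :
    Keeps c σ τ := by
  induction h with
  | skip => exact Keeps.refl _ _
  | setReg σ x e =>
    exact ⟨fun y hy => Function.update_of_ne (by simpa [Program.regs] using hy) _ _,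
      fun _ _ => rfl, fun _ => rfl⟩
  | setCell σ a e f v =>
    exact ⟨fun _ _ => rfl,
      fun y hy => Function.update_of_ne (by simpa [Program.arrays] using hy) _ _, fun _ => rfl⟩
  | draw σ i a e f =>
    exact ⟨fun _ _ => rfl,
      fun y hy => Function.update_of_ne (by simpa [Program.arrays] using hy) _ _, fun h => h.elim⟩
  | seq _ _ ih₁ ih₂ => exact ih₁.seq_left.trans ih₂.seq_right
  | branchTrue _ _ ih =>
    exact ⟨fun x hx => ih.reg x fun h' => hx (List.mem_append_left _ h'),
      fun a ha => ih.cell a fun h' => ha (List.mem_append_left _ h'), fun hc => ih.drawn hc.1⟩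
  | branchFalse _ _ ih =>
    exact ⟨fun x hx => ih.reg x fun h' => hx (List.mem_append_right _ h'),
      fun a ha => ih.cell a fun h' => ha (List.mem_append_right _ h'), fun hc => ih.drawn hc.2⟩
  | loopDone => exact Keeps.refl _ _
  | loopStep _ _ _ ih₁ ih₂ => exact ih₁.of_loop_body.trans ih₂

/-- The program halts after at most `T` steps in a state that satisfies `Q`. -/
def Runs (ω : SampleStream) (c : Program) (σ : State) (T : ℕ) (Q : State → Prop) : Prop :=
  ∃ t τ, Exec ω c σ t τ ∧ t ≤ T ∧ Q τ

section Rules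

variable {ω : SampleStream} {σ : State} {T U : ℕ} {Q R : State → Prop}

@[simp] lemma setCell_cell (σ : State) (a i j : ℕ) (v : ℝ) (a' i' j' : ℕ) :
    (σ.setCell a i j v).cell a' i' j' =
      if a' = a ∧ i' = i ∧ j' = j then v else σ.cell a' i' j' := by
  unfold State.setCell
  by_cases h1 : a' = a
  · subst h1
    by_cases h2 : i' = i
    · subst h2
      by_cases h3 : j' = j <;> simp [h3]
    · simp [h2]
  · simp [h1]

@[simp] lemma setCell_reg (σ : State) (a i j : ℕ) (v : ℝ) : (σ.setCell a i j v).reg = σ.reg := rfl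
@[simp] lemma setCell_drawn (σ : State) (a i j : ℕ) (v : ℝ) :
    (σ.setCell a i j v).drawn = σ.drawn := rfl

@[simp] lemma setReg_reg (σ : State) (x n y : ℕ) :
    (σ.setReg x n).reg y = if y = x then n else σ.reg y := by
  simp [State.setReg, Function.update_apply]
@[simp] lemma setReg_cell (σ : State) (x n : ℕ) : (σ.setReg x n).cell = σ.cell := rfl
@[simp] lemma setReg_drawn (σ : State) (x n : ℕ) : (σ.setReg x n).drawn = σ.drawn := rfl

@[simp] lemma draw_cell (σ : State) (ω : SampleStream) (k : Agent) (a i j a' i' j' : ℕ) :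
    (σ.draw ω k a i j).cell a' i' j' =
      if a' = a ∧ i' = i ∧ j' = j then (ω (k, σ.drawn k) : ℝ) else σ.cell a' i' j' :=
  setCell_cell _ _ _ _ _ _ _ _
@[simp] lemma draw_reg (σ : State) (ω : SampleStream) (k : Agent) (a i j : ℕ) :
    (σ.draw ω k a i j).reg = σ.reg := rfl
@[simp] lemma draw_drawn (σ : State) (ω : SampleStream) (k : Agent) (a i j : ℕ) (l : Agent) :
    (σ.draw ω k a i j).drawn l = if l = k then σ.drawn k + 1 else σ.drawn l := by
  simp [State.draw, Function.update_apply]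

lemma Runs.mono {c : Program} (h : Runs ω c σ T Q) (hT : T ≤ U) (hQ : ∀ τ, Q τ → R τ) :
    Runs ω c σ U R := by
  obtain ⟨t, τ, h1, h2, h3⟩ := h
  exact ⟨t, τ, h1, h2.trans hT, hQ τ h3⟩

lemma Runs.keeps {c : Program} (h : Runs ω c σ T Q) :
    Runs ω c σ T (fun τ => Keeps c σ τ ∧ Q τ) := by
  obtain ⟨t, τ, h1, h2, h3⟩ := h
  exact ⟨t, τ, h1, h2, h1.keeps, h3⟩

lemma Runs.skip (h : Q σ) : Runs ω .skip σ 1 Q := ⟨1, _, .skip _, le_rfl, h⟩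

lemma Runs.setReg {x : ℕ} {e : IExp} (h : Q (σ.setReg x (e.eval σ))) :
    Runs ω (.setReg x e) σ 1 Q := ⟨1, _, .setReg _ _ _, le_rfl, h⟩

lemma Runs.setCell {a : ℕ} {e f : IExp} {v : RExp}
    (h : Q (σ.setCell a (e.eval σ) (f.eval σ) (v.eval σ))) :
    Runs ω (.setCell a e f v) σ 1 Q := ⟨1, _, .setCell _ _ _ _ _, le_rfl, h⟩

lemma Runs.draw {i : Agent} {a : ℕ} {e f : IExp} (h : Q (σ.draw ω i a (e.eval σ) (f.eval σ))) :
    Runs ω (.draw i a e f) σ 1 Q := ⟨1, _, .draw _ _ _ _ _, le_rfl, h⟩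

lemma Runs.seq {c d : Program} (h : Runs ω c σ T Q)
    (h' : ∀ τ, Keeps c σ τ → Q τ → Runs ω d τ U R) : Runs ω (.seq c d) σ (T + U) R := by
  obtain ⟨t, τ, h1, h2, h3⟩ := h
  obtain ⟨u, υ, h4, h5, h6⟩ := h' τ h1.keeps h3
  exact ⟨t + u, υ, .seq h1 h4, add_le_add h2 h5, h6⟩

lemma Runs.branch {b : BExp} {c d : Program} (h : b.Holds σ → Runs ω c σ T Q)
    (h' : ¬ b.Holds σ → Runs ω d σ T Q) : Runs ω (.branch b c d) σ (T + 1) Q := by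
  by_cases hb : b.Holds σ
  · obtain ⟨t, τ, h1, h2, h3⟩ := h hb
    exact ⟨t + 1, τ, .branchTrue hb h1, by omega, h3⟩
  · obtain ⟨t, τ, h1, h2, h3⟩ := h' hb
    exact ⟨t + 1, τ, .branchFalse hb h1, by omega, h3⟩

/-- While loops: `I` is an invariant and `μ` a variant. -/
lemma Runs.loop {b : BExp} {c : Program} (I : State → Prop) (μ : State → ℕ)
    (h : ∀ τ, Keeps c σ τ → I τ → b.Holds τ → Runs ω c τ T (fun υ => I υ ∧ μ υ < μ τ))
    (h0 : I σ) :
    Runs ω (.loop b c) σ (μ σ * (T + 1) + 1) (fun τ => I τ ∧ ¬ b.Holds τ) := by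
  have key : ∀ m τ, Keeps c σ τ → I τ → μ τ ≤ m →
      Runs ω (.loop b c) τ (m * (T + 1) + 1) (fun τ => I τ ∧ ¬ b.Holds τ) := by
    intro m
    induction m with
    | zero =>
      intro τ hk hI hm
      have hb : ¬ b.Holds τ := fun hb => by
        obtain ⟨_, _, _, _, _, h4⟩ := h τ hk hI hb
        omega
      exact ⟨1, τ, .loopDone hb, by omega, hI, hb⟩
    | succ m ih =>
      intro τ hk hI hm
      by_cases hb : b.Holds τ
      · obtain ⟨t, υ, h1, h2, h3, h4⟩ := h τ hk hI hb
        obtain ⟨u, υ', h5, h6, h7⟩ := ih υ (hk.trans h1.keeps) h3 (by omega)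
        refine ⟨t + u + 1, υ', .loopStep hb h1 h5, ?_, h7⟩
        rw [Nat.succ_mul]
        omega
      · exact ⟨1, τ, .loopDone hb, by omega, hI, hb⟩
  exact key _ σ (Keeps.refl _ _) h0 le_rfl

/-- Counting loops: the register `x` runs from `0` to the value of the register `N`. -/
def Program.forLoop (x N : ℕ) (c : Program) : Program :=
  .seq (.setReg x (.const 0))
    (.loop (.not (.ile (.reg N) (.reg x))) (.seq c (.setReg x (.add (.reg x) (.const 1)))))

/-- Counting loops with an invariant on the arrays and the numbers of samples. -/
lemma Runs.forLoop {x N n : ℕ} {c : Program} (I : ℕ → (ℕ → ℕ → ℕ → ℝ) → (Agent → ℕ) → Prop)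
    (hx : x ∉ c.regs) (hN : N ∉ c.regs) (hxN : N ≠ x) (hn : σ.reg N = n)
    (h : ∀ k < n, ∀ τ, Keeps (.forLoop x N c) σ τ → τ.reg x = k → I k τ.cell τ.drawn →
      Runs ω c τ T (fun υ => I (k + 1) υ.cell υ.drawn))
    (h0 : I 0 σ.cell σ.drawn) :
    Runs ω (.forLoop x N c) σ (n * (T + 2) + 2) (fun τ => I n τ.cell τ.drawn) := by
  have h1 : Runs ω (.loop (.not (.ile (.reg N) (.reg x)))
      (.seq c (.setReg x (.add (.reg x) (.const 1))))) (σ.setReg x 0) (n * (T + 1 + 1) + 1)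
      (fun τ => (τ.reg x ≤ n ∧ I (τ.reg x) τ.cell τ.drawn) ∧
        ¬ (BExp.not (.ile (.reg N) (.reg x))).Holds τ) := by
    have h2 := Runs.loop (ω := ω) (σ := σ.setReg x 0) (b := .not (.ile (.reg N) (.reg x)))
      (c := .seq c (.setReg x (.add (.reg x) (.const 1)))) (T := T + 1)
      (fun τ => τ.reg x ≤ n ∧ I (τ.reg x) τ.cell τ.drawn) (fun τ => n - τ.reg x) ?_ ?_
    · simpa using h2
    · intro τ hk hI hb
      have hNτ : τ.reg N = n := by
        rw [hk.reg N (by simp [Program.regs, hN, hxN])]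
        simp [hxN, hn]
      have hlt : τ.reg x < n := by simpa [BExp.Holds, IExp.eval, hNτ] using hb
      have hkeep : Keeps (.forLoop x N c) σ τ := by
        refine ⟨fun y hy => ?_, fun a ha => ?_, fun hd => ?_⟩
        · have hy' : y ≠ x ∧ y ∉ c.regs := by
            simp only [Program.forLoop, Program.regs, List.mem_append, List.mem_singleton] at hy
            tauto
          rw [hk.reg y (by simp [Program.regs, hy'])]
          simp [hy']
        · rw [hk.cell a (by simpa [Program.forLoop, Program.arrays] using ha)]
          rfl
        · rw [hk.drawn (by simpa [Program.forLoop, Program.NoDraw] using hd)]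
          rfl
      refine (h _ hlt τ hkeep rfl hI.2).seq fun υ hυ hI' => Runs.setReg ?_
      have h3 : υ.reg x = τ.reg x := hυ.reg x hx
      simp only [IExp.eval, setReg_reg, if_true, setReg_cell, setReg_drawn, h3]
      exact ⟨⟨hlt, hI'⟩, by omega⟩
    · simpa using h0
  have h3 : Runs ω (.forLoop x N c) σ (1 + (n * (T + 1 + 1) + 1))
      (fun τ => (τ.reg x ≤ n ∧ I (τ.reg x) τ.cell τ.drawn) ∧
        ¬ (BExp.not (.ile (.reg N) (.reg x))).Holds τ) := by
    refine Runs.seq (Q := fun τ => τ = σ.setReg x 0) (Runs.setReg rfl) fun τ _ hτ => hτ ▸ h1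
  refine h3.keeps.mono (by ring_nf; omega) fun τ hτ => ?_
  obtain ⟨hk, ⟨h4, h5⟩, h6⟩ := hτ
  have hNτ : τ.reg N = n := by
    rw [hk.reg N (by simp [Program.forLoop, Program.regs, hN, hxN]), hn]
  have h7 : n ≤ τ.reg x := by simpa [BExp.Holds, IExp.eval, hNτ] using h6
  rwa [le_antisymm h4 h7] at h5

end Rules

end GainsFromTrade

namespace GainsFromTrade

open Program

/-! ### Sorting -/

/-- Count the samples in row `q` of array `3` below, and up to, the one in column `reg 5`. -/
def countBody (q : ℕ) : Program :=
  .seq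
    (.branch (.rle (.cell 3 (.const q) (.reg 5)) (.cell 3 (.const q) (.reg 6))) .skip
      (.setCell 7 (.const 0) (.const 0)
        (.add (.cell 7 (.const 0) (.const 0)) (.ofInt (.const 1)))))
    (.branch (.rle (.cell 3 (.const q) (.reg 6)) (.cell 3 (.const q) (.reg 5)))
      (.setCell 7 (.const 0) (.const 1)
        (.add (.cell 7 (.const 0) (.const 1)) (.ofInt (.const 1)))) .skip)

/-- Count the samples in row `q` of array `3` below, and up to, the one in column `reg 5`. -/
def countProg (q : ℕ) : Program :=
  .seq (.setCell 7 (.const 0) (.const 0) (.ofInt (.const 0)))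
    (.seq (.setCell 7 (.const 0) (.const 1) (.ofInt (.const 0))) (forLoop 6 1 (countBody q)))

lemma numLt_succ (n : ℕ) (x : ℕ → ℝ≥0) (t : ℝ≥0) :
    numLt (n + 1) x t = numLt n x t + if x n < t then 1 else 0 := by
  unfold numLt
  rw [Finset.range_add_one, Finset.filter_insert]
  split_ifs <;> simp

lemma numLe_succ (n : ℕ) (x : ℕ → ℝ≥0) (t : ℝ≥0) :
    numLe (n + 1) x t = numLe n x t + if x n ≤ t then 1 else 0 := by
  unfold numLe
  rw [Finset.range_add_one, Finset.filter_insert]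
  split_ifs <;> simp

section

variable {ω : SampleStream} {σ : State} {n q : ℕ} {x : ℕ → ℝ≥0}

/-- Ranks are recounted for every sample and kept as reals, because no instruction moves a real into
a register. The resulting cubic cost of sorting is harmless. -/
lemma countProg_spec (hn : σ.reg 1 = n) (hx : ∀ k < n, σ.cell 3 q k = x k) {i : ℕ}
    (hi : σ.reg 5 = i) (hin : i < n) :
    Runs ω (countProg q) σ (6 * n + 4) (fun τ => τ.cell 7 0 0 = numLt n x (x i) ∧
      τ.cell 7 0 1 = numLe n x (x i)) := by
  refine Runs.mono (T := 1 + (1 + (n * (4 + 2) + 2))) ?_ (by omega) (fun _ h => h)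
  refine Runs.seq (Q := fun τ => τ.cell 7 0 0 = 0) (Runs.setCell (by simp [RExp.eval, IExp.eval]))
    fun σ₁ hk₁ h₁ => ?_
  refine Runs.seq (Q := fun τ => τ.cell 7 0 0 = 0 ∧ τ.cell 7 0 1 = 0)
    (Runs.setCell (by simp [RExp.eval, IExp.eval, h₁])) fun σ₂ hk₂ h₂ => ?_
  have r1 : σ₂.reg 1 = n := by rw [hk₂.reg 1 (by simp [regs]), hk₁.reg 1 (by simp [regs]), hn]
  have r5 : σ₂.reg 5 = i := by rw [hk₂.reg 5 (by simp [regs]), hk₁.reg 5 (by simp [regs]), hi]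
  have c3 : σ₂.cell 3 = σ.cell 3 := by
    rw [hk₂.cell 3 (by simp [arrays]), hk₁.cell 3 (by simp [arrays])]
  refine Runs.forLoop (fun k m _ => m 7 0 0 = numLt k x (x i) ∧ m 7 0 1 = numLe k x (x i))
    (by simp [countBody, regs]) (by simp [countBody, regs]) (by norm_num) r1 ?_
    (by simpa [numLt, numLe] using h₂)
  intro k hk τ hkτ h6 hI
  have t5 : τ.reg 5 = i := by rw [hkτ.reg 5 (by simp [countBody, forLoop, regs]), r5]
  have t3 : τ.cell 3 = σ.cell 3 := by rw [hkτ.cell 3 (by simp [countBody, forLoop, arrays]), c3]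
  refine Runs.seq (Q := fun υ => υ.cell 7 0 0 = numLt (k + 1) x (x i) ∧
    υ.cell 7 0 1 = numLe k x (x i)) (T := 2) (U := 2) ?_ ?_
  · refine Runs.branch (fun hb => Runs.skip ?_) (fun hb => Runs.setCell ?_)
    · simp only [BExp.Holds, RExp.eval, IExp.eval, t5, t3, h6, hx i hin, hx k hk,
        NNReal.coe_le_coe] at hb
      simpa [numLt_succ, hb.not_gt] using hI
    · simp only [BExp.Holds, RExp.eval, IExp.eval, t5, t3, h6, hx i hin, hx k hk,
        NNReal.coe_le_coe, not_le] at hb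
      simp [numLt_succ, hb, hI, RExp.eval, IExp.eval]
  · intro υ hkυ hI
    have u5 : υ.reg 5 = i := by rw [hkυ.reg 5 (by simp [regs]), t5]
    have u6 : υ.reg 6 = k := by rw [hkυ.reg 6 (by simp [regs]), h6]
    have u3 : υ.cell 3 = σ.cell 3 := by rw [hkυ.cell 3 (by simp [arrays]), t3]
    refine Runs.branch (fun hb => Runs.setCell ?_) (fun hb => Runs.skip ?_)
    · simp only [BExp.Holds, RExp.eval, IExp.eval, u5, u3, u6, hx i hin, hx k hk,
        NNReal.coe_le_coe] at hb
      simp [numLe_succ, hb, hI, RExp.eval, IExp.eval]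
    · simp only [BExp.Holds, RExp.eval, IExp.eval, u5, u3, u6, hx i hin, hx k hk,
        NNReal.coe_le_coe] at hb
      simpa [numLe_succ, hb] using hI

end

/-- Update the entry of rank `reg 4` with the sample in column `reg 5`. -/
def sortBody (q d : ℕ) : Program :=
  .seq (countProg q)
    (.seq
      (.branch (.and (.rle (.cell 7 (.const 0) (.const 0)) (.ofInt (.reg 4)))
          (.rle (.cell d (.reg 4) (.const 0)) (.cell 3 (.const q) (.reg 5))))
        (.setCell d (.reg 4) (.const 0) (.cell 3 (.const q) (.reg 5))) .skip)
      (.branch (.and (.rle (.cell 7 (.const 0) (.const 1)) (.ofInt (.add (.reg 4) (.const 1))))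
          (.rle (.ofInt (.add (.reg 4) (.const 1))) (.cell 7 (.const 0) (.const 1))))
        (.setCell d (.reg 4) (.const 2)
          (.add (.cell d (.reg 4) (.const 2)) (.ofInt (.const 1)))) .skip))

/-- Compute row `reg 4` of the table of sorted samples. -/
def sortRow (q d : ℕ) : Program :=
  .seq (.setCell d (.reg 4) (.const 0) (.ofInt (.const 0)))
    (.seq (.setCell d (.reg 4) (.const 2) (.ofInt (.const 0))) (forLoop 5 1 (sortBody q d)))

/-- Write the sorted sequence of the samples in row `q` of array `3` into column `0` of array `d`,
and the weights into column `2`. -/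
def sortProg (q d : ℕ) : Program := forLoop 4 1 (sortRow q d)

section

variable {ω : SampleStream} {σ : State} {n q d : ℕ} {x : ℕ → ℝ≥0}

/-- The first `k` samples have been taken into account for the entry of rank `r`. -/
def SortedUpTo (n : ℕ) (x : ℕ → ℝ≥0) (r k : ℕ) (m : ℕ → ℕ → ℝ) : Prop :=
  m r 0 = (({i ∈ Finset.range k | numLt n x (x i) ≤ r}.sup x : ℝ≥0) : ℝ) ∧
    m r 2 = ({i ∈ Finset.range k | numLe n x (x i) = r + 1}.card : ℝ)

/-- Sorting by selection: the entry of rank `r` is the maximum of the samples with at most `r`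
samples strictly below. Starting the maximum at `0` is correct because samples are nonnegative. -/
lemma sortRow_spec (hd3 : d ≠ 3) (hd7 : d ≠ 7) (hn : σ.reg 1 = n)
    (hx : ∀ k < n, σ.cell 3 q k = x k) {r : ℕ} (hr : σ.reg 4 = r)
    (h : ∀ r' < r, SortedUpTo n x r' n (σ.cell d)) :
    Runs ω (sortRow q d) σ (6 * n * n + 10 * n + 4)
      (fun τ => ∀ r' < r + 1, SortedUpTo n x r' n (τ.cell d)) := by
  refine Runs.mono (T := 1 + (1 + (n * ((6 * n + 4 + (2 + 2)) + 2) + 2))) ?_ (by ring_nf; omega)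
    (fun _ h => h)
  refine Runs.seq (Q := fun τ => τ.cell d r 0 = 0 ∧ ∀ r' < r, SortedUpTo n x r' n (τ.cell d))
    (Runs.setCell ?_) fun σ₁ hk₁ h₁ => ?_
  · refine ⟨by simp [RExp.eval, IExp.eval, hr], fun r' hr' => ?_⟩
    simpa [SortedUpTo, RExp.eval, IExp.eval, hr, hr'.ne] using h r' hr'
  have q4 : σ₁.reg 4 = r := by rw [hk₁.reg 4 (by simp [regs]), hr]
  refine Runs.seq (Q := fun τ => (τ.cell d r 0 = 0 ∧ τ.cell d r 2 = 0) ∧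
    ∀ r' < r, SortedUpTo n x r' n (τ.cell d)) (Runs.setCell ?_) fun σ₂ hk₂ h₂ => ?_
  · refine ⟨by simp [RExp.eval, IExp.eval, q4, h₁], fun r' hr' => ?_⟩
    simpa [SortedUpTo, RExp.eval, IExp.eval, q4, hr'.ne] using h₁.2 r' hr'
  have r1 : σ₂.reg 1 = n := by rw [hk₂.reg 1 (by simp [regs]), hk₁.reg 1 (by simp [regs]), hn]
  have r4 : σ₂.reg 4 = r := by rw [hk₂.reg 4 (by simp [regs]), q4]
  have c3 : σ₂.cell 3 = σ.cell 3 := by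
    rw [hk₂.cell 3 (by simp [arrays, hd3.symm]), hk₁.cell 3 (by simp [arrays, hd3.symm])]
  refine Runs.mono (T := n * ((6 * n + 4 + (2 + 2)) + 2) + 2) (Q := fun τ =>
    SortedUpTo n x r n (τ.cell d) ∧ ∀ r' < r, SortedUpTo n x r' n (τ.cell d)) ?_ le_rfl ?_
  swap
  · rintro τ ⟨h3, h4⟩ r' hr'
    rcases Nat.lt_succ_iff_lt_or_eq.1 hr' with h5 | h5
    · exact h4 r' h5
    · exact h5 ▸ h3
  refine Runs.forLoop (fun k m _ => SortedUpTo n x r k (m d) ∧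
    ∀ r' < r, SortedUpTo n x r' n (m d)) (by simp [sortBody, countProg, countBody, forLoop, regs])
    (by simp [sortBody, countProg, countBody, forLoop, regs]) (by norm_num) r1 ?_
    (by simpa [SortedUpTo] using h₂)
  intro k hk τ hkτ h5 hI
  have t1 : τ.reg 1 = n := by
    rw [hkτ.reg 1 (by simp [sortBody, countProg, countBody, forLoop, regs]), r1]
  have t4 : τ.reg 4 = r := by
    rw [hkτ.reg 4 (by simp [sortBody, countProg, countBody, forLoop, regs]), r4]
  have t3 : τ.cell 3 = σ.cell 3 := by
    rw [hkτ.cell 3 (by simp [sortBody, countProg, countBody, forLoop, arrays, hd3.symm]), c3]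
  refine Runs.seq (T := 6 * n + 4) (U := 2 + 2)
    (countProg_spec t1 (fun k hk => by rw [t3]; exact hx k hk) h5 hk) fun υ hkυ hυ => ?_
  have u4 : υ.reg 4 = r := by
    rw [hkυ.reg 4 (by simp [countProg, countBody, forLoop, regs]), t4]
  have u5 : υ.reg 5 = k := by
    rw [hkυ.reg 5 (by simp [countProg, countBody, forLoop, regs]), h5]
  have u3 : υ.cell 3 = σ.cell 3 := by
    rw [hkυ.cell 3 (by simp [countProg, countBody, forLoop, arrays]), t3]
  have ud : υ.cell d = τ.cell d :=
    hkυ.cell d (by simp [countProg, countBody, forLoop, arrays, hd7])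
  rw [← ud] at hI
  refine Runs.seq (T := 2) (U := 2) (Q := fun υ =>
    (υ.cell d r 0 = (({i ∈ Finset.range (k + 1) | numLt n x (x i) ≤ r}.sup x : ℝ≥0) : ℝ) ∧
      υ.cell d r 2 = ({i ∈ Finset.range k | numLe n x (x i) = r + 1}.card : ℝ)) ∧
    ∀ r' < r, SortedUpTo n x r' n (υ.cell d)) ?_ ?_
  · refine Runs.branch (fun hb => Runs.setCell ?_) (fun hb => Runs.skip ?_)
    · simp only [BExp.Holds, RExp.eval, IExp.eval, u4, u5, u3, hυ.1, hx k hk, hI.1.1,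
        NNReal.coe_le_coe, Nat.cast_le] at hb
      refine ⟨⟨?_, ?_⟩, fun r' hr' => ?_⟩
      · simp only [RExp.eval, IExp.eval, u4, u5, u3, setCell_cell, and_self, if_true, hx k hk,
          Finset.range_add_one, Finset.filter_insert, hb.1, Finset.sup_insert]
        rw [sup_eq_left.2 hb.2]
      · simpa [RExp.eval, IExp.eval] using hI.1.2
      · simpa [SortedUpTo, RExp.eval, IExp.eval, u4, hr'.ne] using hI.2 r' hr'
    · simp only [BExp.Holds, RExp.eval, IExp.eval, u4, u5, u3, hυ.1, hx k hk, hI.1.1,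
        NNReal.coe_le_coe, Nat.cast_le, not_and, not_le] at hb
      refine ⟨⟨?_, hI.1.2⟩, hI.2⟩
      rw [hI.1.1, Finset.range_add_one, Finset.filter_insert]
      split_ifs with h7
      · rw [Finset.sup_insert, sup_eq_right.2 (hb h7).le]
      · rfl
  · intro ξ hkξ hξ
    have v4 : ξ.reg 4 = r := by rw [hkξ.reg 4 (by simp [regs]), u4]
    have v7 : ξ.cell 7 = υ.cell 7 := hkξ.cell 7 (by simp [arrays, hd7.symm])
    refine Runs.branch (fun hb => Runs.setCell ?_) (fun hb => Runs.skip ?_)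
    · simp only [BExp.Holds, RExp.eval, IExp.eval, v4, v7, hυ.2, Nat.cast_le] at hb
      refine ⟨⟨?_, ?_⟩, fun r' hr' => ?_⟩
      · simpa [RExp.eval, IExp.eval] using hξ.1.1
      · simp only [RExp.eval, IExp.eval, v4, setCell_cell, and_self, if_true, hξ.1.2,
          Finset.range_add_one, Finset.filter_insert, le_antisymm hb.1 hb.2]
        simp
      · simpa [SortedUpTo, RExp.eval, IExp.eval, v4, hr'.ne] using hξ.2 r' hr'
    · simp only [BExp.Holds, RExp.eval, IExp.eval, v4, v7, hυ.2, Nat.cast_le] at hb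
      have h8 : ¬ numLe n x (x k) = r + 1 := fun h8 => hb ⟨h8.le, h8.ge⟩
      refine ⟨⟨hξ.1.1, ?_⟩, hξ.2⟩
      rw [hξ.1.2, Finset.range_add_one, Finset.filter_insert, if_neg h8]

lemma sortProg_spec (hd3 : d ≠ 3) (hd7 : d ≠ 7) (hn : σ.reg 1 = n)
    (hx : ∀ k < n, σ.cell 3 q k = x k) :
    Runs ω (sortProg q d) σ (n * (6 * n * n + 10 * n + 4 + 2) + 2)
      (fun τ => ∀ r < n, τ.cell d r 0 = sorted n x r ∧ τ.cell d r 2 = weight n x r) := by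
  refine Runs.forLoop (fun k m _ => ∀ r < k, SortedUpTo n x r n (m d))
    (by simp [sortRow, sortBody, countProg, countBody, forLoop, regs])
    (by simp [sortRow, sortBody, countProg, countBody, forLoop, regs]) (by norm_num) hn ?_ (by simp)
  intro k hk τ hkτ h4 hI
  have t1 : τ.reg 1 = n := by
    rw [hkτ.reg 1 (by simp [sortRow, sortBody, countProg, countBody, forLoop, regs]), hn]
  have t3 : τ.cell 3 = σ.cell 3 := by
    rw [hkτ.cell 3
      (by simp [sortRow, sortBody, countProg, countBody, forLoop, arrays, hd3.symm])]
  exact sortRow_spec hd3 hd7 t1 (fun k hk => by rw [t3]; exact hx k hk) h4 hI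

end

end GainsFromTrade

namespace GainsFromTrade

open Program

/-! ### Suffix maxima -/

/-- The row treated by a backward loop over `reg 4`. -/
def backRow : IExp := .sub (.sub (.reg 1) (.const 1)) (.reg 4)

/-- The row after the one treated by a backward loop over `reg 4`. -/
def backRowSucc : IExp := .add backRow (.const 1)

/-- Add the gain of one pair of a seller and a buyer to the gain of the price in row `backRow`. -/
def gainCell (q d : ℕ) : Program :=
  .branch (.and (.rle (.cell d backRow (.const 0)) (.cell 3 (.const q) (.reg 6)))
      (.rle (.cell 3 (.const 0) (.reg 5)) (.cell d backRow (.const 0))))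
    (.setCell 7 (.const 0) (.const 0) (.add (.cell 7 (.const 0) (.const 0))
      (.sub (.cell 3 (.const q) (.reg 6)) (.cell 3 (.const 0) (.reg 5))))) .skip

/-- Compute the gain of the price in row `backRow`. -/
def gainSum (q d : ℕ) : Program :=
  .seq (.setCell 7 (.const 0) (.const 0) (.ofInt (.const 0)))
    (forLoop 5 1 (forLoop 6 1 (gainCell q d)))

/-- Write row `backRow` of the table of suffix maxima. -/
def gainRow (q d e : ℕ) : Program :=
  .seq (gainSum q d)
    (.branch (.rle (.cell e backRowSucc (.const 0)) (.cell 7 (.const 0) (.const 0)))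
      (.seq (.setCell e backRow (.const 0) (.cell 7 (.const 0) (.const 0)))
        (.setCell e backRow (.const 1) (.cell d backRow (.const 0))))
      (.seq (.setCell e backRow (.const 0) (.cell e backRowSucc (.const 0)))
        (.setCell e backRow (.const 1) (.cell e backRowSucc (.const 1)))))

/-- Write the suffix maxima of the gains of the prices in column `0` of array `d` into column `0`
of array `e`, and the maximizing prices into column `1`. -/
def gainProg (q d e : ℕ) : Program :=
  .seq (.setCell e (.reg 1) (.const 0) (.ofInt (.const 0)))
    (.seq (.setCell e (.reg 1) (.const 1) (.sub (.ofInt (.const 0)) (.ofInt (.const 1))))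
      (forLoop 4 1 (gainRow q d e)))

section

variable {ω : SampleStream} {σ : State} {n q d e : ℕ} {s x : ℕ → ℝ≥0} {S : ℕ → ℝ}

/-- Counting loops only go up, so truncated subtraction reverses them; for `t < n` the row is a
genuine index. -/
lemma backRow_eval {t : ℕ} (hn : σ.reg 1 = n) (ht : σ.reg 4 = t) :
    backRow.eval σ = n - 1 - t := by simp [backRow, IExp.eval, hn, ht]

lemma backRowSucc_eval {t : ℕ} (hn : σ.reg 1 = n) (ht : σ.reg 4 = t) :
    backRowSucc.eval σ = n - 1 - t + 1 := by simp [backRowSucc, backRow, IExp.eval, hn, ht]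

lemma gainSum_spec (hd7 : d ≠ 7) (hn : σ.reg 1 = n)
    (hs : ∀ k < n, σ.cell 3 0 k = s k) (hx : ∀ k < n, σ.cell 3 q k = x k)
    (hS : ∀ r < n, σ.cell d r 0 = S r) {t : ℕ} (ht : σ.reg 4 = t) (htn : t < n) :
    Runs ω (gainSum q d) σ (1 + (n * (n * (2 + 2) + 2 + 2) + 2))
      (fun τ => τ.cell 7 0 0 = priceGain n s x (S (n - 1 - t))) := by
  refine Runs.seq (Q := fun τ => τ.cell 7 0 0 = 0) (Runs.setCell (by simp [RExp.eval, IExp.eval]))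
    fun σ₁ hk₁ h₁ => ?_
  have r1 : σ₁.reg 1 = n := by rw [hk₁.reg 1 (by simp [regs]), hn]
  have r4 : σ₁.reg 4 = t := by rw [hk₁.reg 4 (by simp [regs]), ht]
  have c3 : σ₁.cell 3 = σ.cell 3 := hk₁.cell 3 (by simp [arrays])
  have cd : σ₁.cell d = σ.cell d := hk₁.cell d (by simp [arrays, hd7])
  set g : ℕ → ℕ → ℝ := fun k i =>
    if S (n - 1 - t) ≤ x i ∧ (s k : ℝ) ≤ S (n - 1 - t) then (x i : ℝ) - s k else 0 with hg
  have h2 : priceGain n s x (S (n - 1 - t)) =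
      ∑ k ∈ Finset.range n, ∑ i ∈ Finset.range n, g k i := rfl
  rw [h2]
  refine Runs.forLoop (fun k m _ => m 7 0 0 = ∑ k ∈ Finset.range k, ∑ i ∈ Finset.range n, g k i)
    (by simp [gainCell, forLoop, regs]) (by simp [gainCell, forLoop, regs]) (by norm_num) r1 ?_
    (by simpa using h₁)
  intro k hk τ hkτ h5 hI
  have t1 : τ.reg 1 = n := by rw [hkτ.reg 1 (by simp [gainCell, forLoop, regs]), r1]
  have t4 : τ.reg 4 = t := by rw [hkτ.reg 4 (by simp [gainCell, forLoop, regs]), r4]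
  have t3 : τ.cell 3 = σ.cell 3 := by
    rw [hkτ.cell 3 (by simp [gainCell, forLoop, arrays]), c3]
  have td : τ.cell d = σ.cell d := by
    rw [hkτ.cell d (by simp [gainCell, forLoop, arrays, hd7]), cd]
  simp only [Finset.sum_range_succ _ k]
  refine Runs.forLoop (fun i m _ => m 7 0 0 =
    ∑ k ∈ Finset.range k, ∑ i ∈ Finset.range n, g k i + ∑ i ∈ Finset.range i, g k i)
    (by simp [gainCell, regs]) (by simp [gainCell, regs]) (by norm_num) t1 ?_
    (by simpa using hI)
  intro i hi υ hkυ h6 hI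
  have u1 : υ.reg 1 = n := by rw [hkυ.reg 1 (by simp [gainCell, forLoop, regs]), t1]
  have u4 : υ.reg 4 = t := by rw [hkυ.reg 4 (by simp [gainCell, forLoop, regs]), t4]
  have u5 : υ.reg 5 = k := by rw [hkυ.reg 5 (by simp [gainCell, forLoop, regs]), h5]
  have u3 : υ.cell 3 = σ.cell 3 := by rw [hkυ.cell 3 (by simp [gainCell, forLoop, arrays]), t3]
  have ud : υ.cell d = σ.cell d := by
    rw [hkυ.cell d (by simp [gainCell, forLoop, arrays, hd7]), td]
  have eb := backRow_eval u1 u4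
  have hlt : n - 1 - t < n := by omega
  refine Runs.branch (fun hb => Runs.setCell ?_) (fun hb => Runs.skip ?_)
  · simp only [BExp.Holds, RExp.eval, eb, IExp.eval, u3, ud, u5, h6, hx i hi, hs k hk,
      hS _ hlt] at hb
    simp only [RExp.eval, IExp.eval, setCell_cell, and_self, if_true, hI, u3, u5, h6, hx i hi,
      hs k hk, Finset.sum_range_succ, add_assoc]
    rw [hg]
    simp only [if_pos hb]
  · simp only [BExp.Holds, RExp.eval, eb, IExp.eval, u3, ud, u5, h6, hx i hi, hs k hk,
      hS _ hlt] at hb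
    rw [hI, Finset.sum_range_succ]
    simp only [hg, if_neg hb, add_zero]

/-- The recurrence of suffix maxima holds in the last `t` rows. -/
def SuffixMaxFrom (n : ℕ) (g : ℝ → ℝ) (S : ℕ → ℝ) (t : ℕ) (m : ℕ → ℕ → ℝ) : Prop :=
  (m n 0 = 0 ∧ m n 1 = -1) ∧ ∀ i < n, n - t ≤ i →
    (m (i + 1) 0 ≤ g (S i) → m i 0 = g (S i) ∧ m i 1 = S i) ∧
    (g (S i) < m (i + 1) 0 → m i 0 = m (i + 1) 0 ∧ m i 1 = m (i + 1) 1)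

/-- Only the row `n - 1 - t` is written, and its recurrence refers to the next row, which is already
final. -/
lemma SuffixMaxFrom.succ {g : ℝ → ℝ} {t : ℕ} {m m' : ℕ → ℕ → ℝ} (h : SuffixMaxFrom n g S t m)
    (ht : t < n) (hm : ∀ i, i ≠ n - 1 - t → m' i = m i)
    (h1 : m (n - 1 - t + 1) 0 ≤ g (S (n - 1 - t)) →
      m' (n - 1 - t) 0 = g (S (n - 1 - t)) ∧ m' (n - 1 - t) 1 = S (n - 1 - t))
    (h2 : g (S (n - 1 - t)) < m (n - 1 - t + 1) 0 →
      m' (n - 1 - t) 0 = m (n - 1 - t + 1) 0 ∧ m' (n - 1 - t) 1 = m (n - 1 - t + 1) 1) :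
    SuffixMaxFrom n g S (t + 1) m' := by
  refine ⟨by rw [hm n (by omega)]; exact h.1, fun i hi hti => ?_⟩
  rw [hm (i + 1) (by omega)]
  by_cases hit : i = n - 1 - t
  · subst hit
    exact ⟨h1, h2⟩
  · rw [hm i hit]
    exact h.2 i hi (by omega)

lemma gainProg_spec (hd7 : d ≠ 7) (he3 : e ≠ 3) (he7 : e ≠ 7) (hde : d ≠ e) (hn : σ.reg 1 = n)
    (hs : ∀ k < n, σ.cell 3 0 k = s k) (hx : ∀ k < n, σ.cell 3 q k = x k)
    (hS : ∀ r < n, σ.cell d r 0 = S r) :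
    Runs ω (gainProg q d e) σ
      (1 + (1 + (n * (1 + (n * (n * (2 + 2) + 2 + 2) + 2) + (1 + 1 + 1) + 2) + 2)))
      (fun τ => IsSuffixMax n (priceGain n s x) S (fun r => τ.cell e r 0)
        (fun r => τ.cell e r 1)) := by
  refine Runs.seq (Q := fun τ => τ.cell e n 0 = 0)
    (Runs.setCell (by simp [RExp.eval, IExp.eval, hn])) fun σ₁ hk₁ h₁ => ?_
  have q1 : σ₁.reg 1 = n := by rw [hk₁.reg 1 (by simp [regs]), hn]
  refine Runs.seq (Q := fun τ => τ.cell e n 0 = 0 ∧ τ.cell e n 1 = -1)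
    (Runs.setCell (by simp [RExp.eval, IExp.eval, q1, h₁])) fun σ₂ hk₂ h₂ => ?_
  have r1 : σ₂.reg 1 = n := by rw [hk₂.reg 1 (by simp [regs]), q1]
  have c3 : σ₂.cell 3 = σ.cell 3 := by
    rw [hk₂.cell 3 (by simp [arrays, he3.symm]), hk₁.cell 3 (by simp [arrays, he3.symm])]
  have cd : σ₂.cell d = σ.cell d := by
    rw [hk₂.cell d (by simp [arrays, hde]), hk₁.cell d (by simp [arrays, hde])]
  refine Runs.mono (Q := fun τ => SuffixMaxFrom n (priceGain n s x) S n (τ.cell e)) ?_ le_rfl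
    fun τ hτ => ⟨hτ.1.1, hτ.1.2, fun i hi => (hτ.2 i hi (by omega)).1,
      fun i hi => (hτ.2 i hi (by omega)).2⟩
  refine Runs.forLoop (fun t m _ => SuffixMaxFrom n (priceGain n s x) S t (m e))
    (by simp [gainRow, gainSum, gainCell, forLoop, regs])
    (by simp [gainRow, gainSum, gainCell, forLoop, regs]) (by norm_num) r1 ?_
    ⟨h₂, fun i hi hi' => by omega⟩
  intro t ht τ hkτ h4 hI
  have t1 : τ.reg 1 = n := by
    rw [hkτ.reg 1 (by simp [gainRow, gainSum, gainCell, forLoop, regs]), r1]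
  have t3 : τ.cell 3 = σ.cell 3 := by
    rw [hkτ.cell 3 (by simp [gainRow, gainSum, gainCell, forLoop, arrays, he3.symm]), c3]
  have td : τ.cell d = σ.cell d := by
    rw [hkτ.cell d (by simp [gainRow, gainSum, gainCell, forLoop, arrays, hd7, hde]), cd]
  refine Runs.seq (gainSum_spec (s := s) (x := x) (S := S) hd7 t1 (by rwa [t3]) (by rwa [t3])
    (by rwa [td]) h4 ht) fun υ hkυ hυ => ?_
  have u1 : υ.reg 1 = n := by rw [hkυ.reg 1 (by simp [gainSum, gainCell, forLoop, regs]), t1]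
  have u4 : υ.reg 4 = t := by rw [hkυ.reg 4 (by simp [gainSum, gainCell, forLoop, regs]), h4]
  have ud : υ.cell d = σ.cell d := by
    rw [hkυ.cell d (by simp [gainSum, gainCell, forLoop, arrays, hd7]), td]
  have ue : υ.cell e = τ.cell e := hkυ.cell e (by simp [gainSum, gainCell, forLoop, arrays, he7])
  rw [← ue] at hI
  have hlt : n - 1 - t < n := by omega
  have eb := backRow_eval u1 u4
  have eb' := backRowSucc_eval u1 u4
  refine Runs.branch (fun hb => ?_) (fun hb => ?_)
  · simp only [BExp.Holds, RExp.eval, eb', IExp.eval, hυ] at hb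
    refine Runs.seq (Q := fun ξ => (∀ i, i ≠ n - 1 - t → ξ.cell e i = υ.cell e i) ∧
      ξ.cell e (n - 1 - t) 0 = priceGain n s x (S (n - 1 - t))) (Runs.setCell ⟨?_, ?_⟩)
      fun ξ hkξ hξ => Runs.setCell ?_
    · intro i hi
      ext j
      simp [eb, hi]
    · simp [eb, RExp.eval, IExp.eval, hυ]
    have x1 : ξ.reg 1 = n := by rw [hkξ.reg 1 (by simp [regs]), u1]
    have x4 : ξ.reg 4 = t := by rw [hkξ.reg 4 (by simp [regs]), u4]
    have xd : ξ.cell d = σ.cell d := by rw [hkξ.cell d (by simp [arrays, hde]), ud]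
    have ex := backRow_eval x1 x4
    refine hI.succ ht (fun i hi => ?_) (fun _ => ⟨?_, ?_⟩) fun h => absurd h hb.not_gt
    · ext j
      simp [ex, hi, hξ.1 i hi]
    · simp [ex, IExp.eval, hξ.2]
    · simp [ex, IExp.eval, RExp.eval, xd, hS _ hlt]
  · simp only [BExp.Holds, RExp.eval, eb', IExp.eval, hυ, not_le] at hb
    refine Runs.seq (Q := fun ξ => (∀ i, i ≠ n - 1 - t → ξ.cell e i = υ.cell e i) ∧
      ξ.cell e (n - 1 - t) 0 = υ.cell e (n - 1 - t + 1) 0) (Runs.setCell ⟨?_, ?_⟩)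
      fun ξ hkξ hξ => Runs.setCell ?_
    · intro i hi
      ext j
      simp [eb, hi]
    · simp [eb, eb', RExp.eval, IExp.eval]
    have x1 : ξ.reg 1 = n := by rw [hkξ.reg 1 (by simp [regs]), u1]
    have x4 : ξ.reg 4 = t := by rw [hkξ.reg 4 (by simp [regs]), u4]
    have ex := backRow_eval x1 x4
    have ex' := backRowSucc_eval x1 x4
    refine hI.succ ht (fun i hi => ?_) (fun h => absurd h hb.not_ge) fun _ => ⟨?_, ?_⟩
    · ext j
      simp [ex, hi, hξ.1 i hi]
    · simp [ex, IExp.eval, hξ.2]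
    · simp [ex, ex', IExp.eval, RExp.eval, hξ.1 (n - 1 - t + 1) (by omega)]

end

end GainsFromTrade

namespace GainsFromTrade

open Program

/-! ### The dynamic program -/

/-- The column treated by a backward loop over `reg 5`. -/
def backCol : IExp := .sub (.sub (.reg 1) (.const 1)) (.reg 5)

/-- The gain of a path from `(i, j)` that passes column `i` at once. -/
def columnExp (i j : IExp) : RExp :=
  .add (.mul (.cell 2 i (.const 2)) (.cell 5 j (.const 0))) (.cell 6 (.add i (.const 1)) j)

/-- The gain of a path from `(i, j)` that passes row `j` at once. -/
def rowExp (i j : IExp) : RExp :=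
  .add (.mul (.cell 1 j (.const 2)) (.cell 4 i (.const 0))) (.cell 6 i (.add j (.const 1)))

/-- One entry of the dynamic program. -/
def pathCell : Program :=
  .branch (.rle (columnExp backRow backCol) (rowExp backRow backCol))
    (.setCell 6 backRow backCol (rowExp backRow backCol))
    (.setCell 6 backRow backCol (columnExp backRow backCol))

/-- The zero entries of the dynamic program. -/
def borderProg : Program :=
  .seq (.setCell 6 (.reg 1) (.reg 1) (.ofInt (.const 0)))
    (forLoop 4 1 (.seq (.setCell 6 (.reg 1) (.reg 4) (.ofInt (.const 0)))
      (.setCell 6 (.reg 4) (.reg 1) (.ofInt (.const 0)))))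

/-- Write the values of the dynamic program into array `6`. -/
def pathProg : Program := .seq borderProg (forLoop 4 1 (forLoop 5 1 pathCell))

section

variable {ω : SampleStream} {σ : State} {n : ℕ} {w₁ w₂ G₁ G₂ : ℕ → ℝ}

lemma borderProg_spec (hn : σ.reg 1 = n) :
    Runs ω borderProg σ (1 + (n * (1 + 1 + 2) + 2))
      (fun τ => ∀ k ≤ n, τ.cell 6 n k = 0 ∧ τ.cell 6 k n = 0) := by
  refine Runs.seq (Q := fun τ => τ.cell 6 n n = 0) (Runs.setCell (by simp [hn, RExp.eval, IExp.eval]))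
    fun σ₁ hk₁ h₁ => ?_
  have r1 : σ₁.reg 1 = n := by rw [hk₁.reg 1 (by simp [regs]), hn]
  refine (Runs.forLoop (fun k m _ => m 6 n n = 0 ∧ ∀ l < k, m 6 n l = 0 ∧ m 6 l n = 0)
    (by simp [regs]) (by simp [regs]) (by norm_num) r1 ?_ (by simpa using h₁)).mono le_rfl ?_
  · intro k hk τ hkτ h4 hI
    have t1 : τ.reg 1 = n := by rw [hkτ.reg 1 (by simp [forLoop, regs]), r1]
    refine Runs.seq (Q := fun υ => (υ.cell 6 n n = 0 ∧ υ.cell 6 n k = 0) ∧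
      ∀ l < k, υ.cell 6 n l = 0 ∧ υ.cell 6 l n = 0) (Runs.setCell ?_)
      fun υ hkυ hυ => Runs.setCell ?_
    · simp only [setCell_cell, IExp.eval, RExp.eval, t1, h4]
      refine ⟨⟨by simp [hI.1], by simp⟩, fun l hl => ⟨?_, ?_⟩⟩
      · simp [(hI.2 l hl).1]
      · simp [(hI.2 l hl).2]
    · have u1 : υ.reg 1 = n := by rw [hkυ.reg 1 (by simp [regs]), t1]
      have u4 : υ.reg 4 = k := by rw [hkυ.reg 4 (by simp [regs]), h4]
      simp only [setCell_cell, IExp.eval, RExp.eval, u1, u4]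
      refine ⟨by simp [hυ.1.1], fun l hl => ?_⟩
      rcases Nat.lt_succ_iff_lt_or_eq.1 hl with h | rfl
      · constructor
        · simp [(hυ.2 l h).1]
        · simp [(hυ.2 l h).2]
      · simp [hυ.1.2]
  · intro τ hτ k hk
    rcases hk.lt_or_eq with h | rfl
    · exact hτ.2 k h
    · exact ⟨hτ.1, hτ.1⟩

lemma columnExp_eval {e f : IExp} {i j : ℕ} (hi : e.eval σ = i) (hj : f.eval σ = j) :
    (columnExp e f).eval σ = σ.cell 2 i 2 * σ.cell 5 j 0 + σ.cell 6 (i + 1) j := by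
  simp [columnExp, RExp.eval, IExp.eval, hi, hj]

lemma rowExp_eval {e f : IExp} {i j : ℕ} (hi : e.eval σ = i) (hj : f.eval σ = j) :
    (rowExp e f).eval σ = σ.cell 1 j 2 * σ.cell 4 i 0 + σ.cell 6 i (j + 1) := by
  simp [rowExp, RExp.eval, IExp.eval, hi, hj]

lemma pathProg_spec (hn : σ.reg 1 = n) (hw₁ : ∀ i < n, σ.cell 2 i 2 = w₁ i)
    (hw₂ : ∀ j < n, σ.cell 1 j 2 = w₂ j) (hG₁ : ∀ i < n, σ.cell 4 i 0 = G₁ i)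
    (hG₂ : ∀ j < n, σ.cell 5 j 0 = G₂ j) :
    Runs ω pathProg σ ((1 + (n * (1 + 1 + 2) + 2)) + (n * ((n * (2 + 2) + 2) + 2) + 2))
      (fun τ => IsPathValue n w₁ w₂ G₁ G₂ (τ.cell 6)) := by
  refine Runs.seq (borderProg_spec hn) fun σ₁ hk₁ h₁ => ?_
  have r1 : σ₁.reg 1 = n := by rw [hk₁.reg 1 (by simp [borderProg, forLoop, regs]), hn]
  have ca : ∀ a, a ≠ 6 → σ₁.cell a = σ.cell a := fun a ha =>
    hk₁.cell a (by simp [borderProg, forLoop, arrays, ha])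
  refine (Runs.forLoop (fun t m _ => (∀ k ≤ n, m 6 n k = 0 ∧ m 6 k n = 0) ∧
    ∀ i < n, ∀ j < n, n - t ≤ i →
      m 6 i j = max (w₁ i * G₂ j + m 6 (i + 1) j) (w₂ j * G₁ i + m 6 i (j + 1)))
    (by simp [forLoop, pathCell, regs]) (by simp [forLoop, pathCell, regs]) (by norm_num) r1 ?_
    ⟨h₁, fun i hi _ _ h => by omega⟩).mono le_rfl fun τ hτ =>
      ⟨fun j hj => (hτ.1 j hj).1, fun i hi => (hτ.1 i hi).2,
        fun i hi j hj => hτ.2 i hi j hj (by omega)⟩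
  intro t ht τ hkτ h4 hI
  have t1 : τ.reg 1 = n := by rw [hkτ.reg 1 (by simp [pathCell, forLoop, regs]), r1]
  have ta : ∀ a, a ≠ 6 → τ.cell a = σ.cell a := fun a ha => by
    rw [hkτ.cell a (by simp [pathCell, forLoop, arrays, ha]), ca a ha]
  -- The inner invariant covers the finished columns and, in the current one, the entries from `n -
  -- u` upward.
  refine (Runs.forLoop (fun u m _ => (∀ k ≤ n, m 6 n k = 0 ∧ m 6 k n = 0) ∧
    ∀ i < n, ∀ j < n, (n - t ≤ i ∨ i = n - 1 - t ∧ n - u ≤ j) →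
      m 6 i j = max (w₁ i * G₂ j + m 6 (i + 1) j) (w₂ j * G₁ i + m 6 i (j + 1)))
    (by simp [pathCell, regs]) (by simp [pathCell, regs]) (by norm_num) t1 ?_
    ⟨hI.1, fun i hi j hj h => hI.2 i hi j hj (by omega)⟩).mono le_rfl fun τ hτ =>
      ⟨hτ.1, fun i hi j hj h => hτ.2 i hi j hj (by omega)⟩
  intro u hu υ hkυ h5 hI
  have u1 : υ.reg 1 = n := by rw [hkυ.reg 1 (by simp [pathCell, forLoop, regs]), t1]
  have u4 : υ.reg 4 = t := by rw [hkυ.reg 4 (by simp [pathCell, forLoop, regs]), h4]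
  have ua : ∀ a, a ≠ 6 → υ.cell a = σ.cell a := fun a ha => by
    rw [hkυ.cell a (by simp [pathCell, forLoop, arrays, ha]), ta a ha]
  have ei : backRow.eval υ = n - 1 - t := backRow_eval u1 u4
  have ej : backCol.eval υ = n - 1 - u := by simp [backCol, IExp.eval, u1, h5]
  obtain ⟨i₀, hi₀⟩ : ∃ i₀, i₀ = n - 1 - t := ⟨_, rfl⟩
  obtain ⟨j₀, hj₀⟩ : ∃ j₀, j₀ = n - 1 - u := ⟨_, rfl⟩
  rw [← hi₀] at ei
  rw [← hj₀] at ej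
  have hi₀n : i₀ < n := by omega
  have hj₀n : j₀ < n := by omega
  have ec := columnExp_eval ei ej
  have er := rowExp_eval ei ej
  rw [ua 2 (by norm_num), ua 5 (by norm_num), hw₁ i₀ hi₀n, hG₂ j₀ hj₀n] at ec
  rw [ua 1 (by norm_num), ua 4 (by norm_num), hw₂ j₀ hj₀n, hG₁ i₀ hi₀n] at er
  -- Both branches write the same maximum. The recurrences for earlier entries survive since they
  -- refer only to larger indices, never to the new cell.
  have key : ∀ m : ℕ → ℕ → ℝ, (∀ i j, m i j = if i = i₀ ∧ j = j₀ then
      max (w₁ i₀ * G₂ j₀ + υ.cell 6 (i₀ + 1) j₀) (w₂ j₀ * G₁ i₀ + υ.cell 6 i₀ (j₀ + 1))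
      else υ.cell 6 i j) → (∀ k ≤ n, m n k = 0 ∧ m k n = 0) ∧
      ∀ i < n, ∀ j < n, (n - t ≤ i ∨ i = n - 1 - t ∧ n - (u + 1) ≤ j) →
      m i j = max (w₁ i * G₂ j + m (i + 1) j) (w₂ j * G₁ i + m i (j + 1)) := by
    intro m hm
    refine ⟨fun k hk => ?_, fun i hi j hj h => ?_⟩
    · rw [hm, hm, if_neg (by omega), if_neg (by omega)]
      exact hI.1 k hk
    · rw [hm (i + 1) j, hm i (j + 1), hm i j, if_neg (c := i + 1 = i₀ ∧ j = j₀) (by omega),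
        if_neg (c := i = i₀ ∧ j + 1 = j₀) (by omega)]
      split_ifs with h1
      · rw [h1.1, h1.2]
      · exact hI.2 i hi j hj (by omega)
  refine Runs.branch (fun hb => Runs.setCell (key _ ?_)) (fun hb => Runs.setCell (key _ ?_))
  · simp only [BExp.Holds, ec, er] at hb
    intro i j
    rw [setCell_cell, ei, ej, er, max_eq_right hb]
    simp
  · simp only [BExp.Holds, ec, er, not_le] at hb
    intro i j
    rw [setCell_cell, ei, ej, ec, max_eq_left hb.le]
    simp

end

/-! ### Tracing an optimal path -/

/-- Fill the column of prices of the two output tables with `-1`. -/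
def fillProg : Program :=
  forLoop 4 1 (.seq (.setCell 1 (.reg 4) (.const 1) (.sub (.ofInt (.const 0)) (.ofInt (.const 1))))
    (.setCell 2 (.reg 4) (.const 1) (.sub (.ofInt (.const 0)) (.ofInt (.const 1)))))

/-- One step along an optimal path. -/
def traceStep : Program :=
  .branch (.rle (rowExp (.reg 7) (.reg 8)) (columnExp (.reg 7) (.reg 8)))
    (.seq (.setCell 2 (.reg 7) (.const 1) (.cell 5 (.reg 8) (.const 1)))
      (.setReg 7 (.add (.reg 7) (.const 1))))
    (.seq (.setCell 1 (.reg 8) (.const 1) (.cell 4 (.reg 7) (.const 1)))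
      (.setReg 8 (.add (.reg 8) (.const 1))))

/-- Write the prices along an optimal path into the output tables. -/
def traceProg : Program :=
  .seq fillProg (.seq (.setReg 7 (.const 0)) (.seq (.setReg 8 (.const 0))
    (.loop (.and (.not (.ile (.reg 1) (.reg 7))) (.not (.ile (.reg 1) (.reg 8)))) traceStep)))

/-- A path that has been traced up to `(i, j)`, with gain at least `v` in the part traced. -/
structure TracedPath (n : ℕ) (w₁ w₂ G₁ G₂ : ℕ → ℝ) (v : ℝ) (i j : ℕ) (x y : ℕ → ℕ) : Prop
    extends IsPath n w₁ w₂ G₁ G₂ v x y where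
  done₁ : ∀ l < j, x l ≤ i
  done₂ : ∀ l < i, y l ≤ j
  open₁ : ∀ l, j ≤ l → x l = n
  open₂ : ∀ l, i ≤ l → y l = n

namespace TracedPath

variable {n : ℕ} {w₁ w₂ G₁ G₂ : ℕ → ℝ} {v : ℝ} {i j : ℕ} {x y : ℕ → ℕ}

/-- Before tracing, every threshold is `n`: nothing is sold, and the gain is `0`. -/
lemma start (h₁ : G₁ n = 0) (h₂ : G₂ n = 0) :
    TracedPath n w₁ w₂ G₁ G₂ 0 0 0 (fun _ => n) (fun _ => n) where
  le₁ _ _ := le_rfl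
  le₂ _ _ := le_rfl
  mono₁ _ _ _ _ := le_rfl
  mono₂ _ _ _ _ := le_rfl
  disj i hi _ _ h := absurd hi h.not_gt
  value := by simp [h₁, h₂]
  done₁ _ h := absurd h (Nat.not_lt_zero _)
  done₂ _ h := absurd h (Nat.not_lt_zero _)
  open₁ _ _ := rfl
  open₂ _ _ := rfl

lemma swap (h : TracedPath n w₁ w₂ G₁ G₂ v i j x y) : TracedPath n w₂ w₁ G₂ G₁ v j i y x where
  le₁ := h.le₂
  le₂ := h.le₁
  mono₁ := h.mono₂
  mono₂ := h.mono₁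
  disj i hi j hj h1 h2 := h.disj j hj i hi h2 h1
  value := h.value.trans_eq (add_comm _ _)
  done₁ := h.done₂
  done₂ := h.done₁
  open₁ := h.open₂
  open₂ := h.open₁

/-- The new height `j` of column `i` creates no overlap, because all rows from `j` on still have the
threshold `n`. The old entry of the column earned `G₂ n = 0`, so exactly `w₁ i * G₂ j` is added. -/
lemma column (h : TracedPath n w₁ w₂ G₁ G₂ v i j x y) (h₂ : G₂ n = 0) (hi : i < n) (hj : j < n) :
    TracedPath n w₁ w₂ G₁ G₂ (v + w₁ i * G₂ j) (i + 1) j x (Function.update y i j) where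
  le₁ := h.le₁
  le₂ l hl := by
    rw [Function.update_apply]
    split_ifs
    · exact hj.le
    · exact h.le₂ l hl
  mono₁ := h.mono₁
  mono₂ l l' hl hl' := by
    rw [Function.update_apply, Function.update_apply]
    split_ifs with h1 h2 h2
    · exact le_rfl
    · rw [h.open₂ l' (by omega)]
      exact hj.le
    · exact h.done₂ l (by omega)
    · exact h.mono₂ l l' hl hl'
  disj l hl l' hl' h1 := by
    rw [Function.update_apply]
    split_ifs with h2
    · intro h3
      rw [h.open₁ l' h3] at h1
      omega
    · exact h.disj l hl l' hl' h1
  value := by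
    have h1 : ∑ l ∈ Finset.range n, w₁ l * G₂ (Function.update y i j l) =
        ∑ l ∈ Finset.range n, (w₁ l * G₂ (y l) + if l = i then w₁ i * G₂ j else 0) := by
      refine Finset.sum_congr rfl fun l _ => ?_
      rw [Function.update_apply]
      split_ifs with h2
      · rw [h2, h.open₂ i le_rfl, h₂, mul_zero, zero_add]
      · rw [add_zero]
    rw [h1, Finset.sum_add_distrib, Finset.sum_ite_eq' (Finset.range n) i,
      if_pos (Finset.mem_range.2 hi), ← add_assoc]
    exact add_le_add_left h.value _
  done₁ l hl := (h.done₁ l hl).trans (Nat.le_succ i)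
  done₂ l hl := by
    rw [Function.update_apply]
    split_ifs with h1
    · exact le_rfl
    · exact h.done₂ l (by omega)
  open₁ := h.open₁
  open₂ l hl := by
    rw [Function.update_apply, if_neg (by omega)]
    exact h.open₂ l (by omega)

lemma row (h : TracedPath n w₁ w₂ G₁ G₂ v i j x y) (h₁ : G₁ n = 0) (hi : i < n) (hj : j < n) :
    TracedPath n w₁ w₂ G₁ G₂ (v + w₂ j * G₁ i) i (j + 1) (Function.update x j i) y :=
  (h.swap.column h₁ hj hi).swap

end TracedPath

section

variable {ω : SampleStream} {σ : State} {n : ℕ} {w₁ w₂ G₁ P₁ G₂ P₂ c₁ c₂ : ℕ → ℝ} {D : ℕ → ℕ → ℝ}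

/-- The output tables belong to the path `x, y`. -/
def PathTables (n : ℕ) (w₁ w₂ P₁ P₂ c₁ c₂ : ℕ → ℝ) (x y : ℕ → ℕ) (m : ℕ → ℕ → ℕ → ℝ) : Prop :=
  ∀ k < n, (m 1 k 0 = c₁ k ∧ m 1 k 1 = P₁ (x k) ∧ m 1 k 2 = w₂ k) ∧
    (m 2 k 0 = c₂ k ∧ m 2 k 1 = P₂ (y k) ∧ m 2 k 2 = w₁ k)

/-- Rows and columns that the trace never reaches must end with the price `∞`; the entry `-1` is
also `P n`, in agreement with the initial thresholds. -/
lemma fillProg_spec (hn : σ.reg 1 = n)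
    (h₁ : ∀ k < n, σ.cell 1 k 0 = c₁ k ∧ σ.cell 1 k 2 = w₂ k)
    (h₂ : ∀ k < n, σ.cell 2 k 0 = c₂ k ∧ σ.cell 2 k 2 = w₁ k) (hP₁ : P₁ n = -1) (hP₂ : P₂ n = -1) :
    Runs ω fillProg σ (n * (1 + 1 + 2) + 2)
      (fun τ => PathTables n w₁ w₂ P₁ P₂ c₁ c₂ (fun _ => n) (fun _ => n) τ.cell) := by
  refine (Runs.forLoop (fun l m _ => ∀ k < n, (m 1 k 0 = c₁ k ∧ (k < l → m 1 k 1 = -1) ∧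
    m 1 k 2 = w₂ k) ∧ (m 2 k 0 = c₂ k ∧ (k < l → m 2 k 1 = -1) ∧ m 2 k 2 = w₁ k))
    (by simp [regs]) (by simp [regs]) (by norm_num) hn ?_ ?_).mono le_rfl ?_
  · intro l hl τ hkτ h4 hI
    refine Runs.seq (Q := fun m => ∀ k < n, (m.cell 1 k 0 = c₁ k ∧
      (k < l + 1 → m.cell 1 k 1 = -1) ∧ m.cell 1 k 2 = w₂ k) ∧
      (m.cell 2 k 0 = c₂ k ∧ (k < l → m.cell 2 k 1 = -1) ∧ m.cell 2 k 2 = w₁ k))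
      (Runs.setCell ?_) fun υ hkυ hυ => Runs.setCell ?_
    · intro k hk
      have := hI k hk
      simp only [setCell_cell, IExp.eval, RExp.eval, h4]
      refine ⟨⟨by simp [this], fun h => ?_, by simp [this]⟩, by simpa using this.2⟩
      rcases Nat.lt_succ_iff_lt_or_eq.1 h with h | rfl
      · simp [this.1.2.1 h]
      · simp
    · intro k hk
      have := hυ k hk
      have u4 : υ.reg 4 = l := by rw [hkυ.reg 4 (by simp [regs]), h4]
      simp only [setCell_cell, IExp.eval, RExp.eval, u4]
      refine ⟨by simpa using this.1, by simp [this], fun h => ?_, by simp [this]⟩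
      rcases Nat.lt_succ_iff_lt_or_eq.1 h with h | rfl
      · simp [this.2.2.1 h]
      · simp
  · exact fun k hk => ⟨⟨(h₁ k hk).1, fun h => absurd h (Nat.not_lt_zero _), (h₁ k hk).2⟩,
      (h₂ k hk).1, fun h => absurd h (Nat.not_lt_zero _), (h₂ k hk).2⟩
  · intro τ hτ k hk
    obtain ⟨⟨h3, h4, h5⟩, h6, h7, h8⟩ := hτ k hk
    exact ⟨⟨h3, hP₁ ▸ h4 hk, h5⟩, h6, hP₂ ▸ h7 hk, h8⟩

/-- No back pointers are stored: each step repeats the comparison of the dynamic program. The gain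
already traced plus the value `D` of the remaining rectangle stays at least `D 0 0`, and every step
advances one of two indices, hence at most `n + n` steps. -/
lemma traceProg_spec (hn : σ.reg 1 = n) (hD : IsPathValue n w₁ w₂ G₁ G₂ D)
    (h₁ : ∀ k < n, σ.cell 1 k 0 = c₁ k ∧ σ.cell 1 k 2 = w₂ k)
    (h₂ : ∀ k < n, σ.cell 2 k 0 = c₂ k ∧ σ.cell 2 k 2 = w₁ k)
    (h₄ : ∀ k < n, σ.cell 4 k 0 = G₁ k ∧ σ.cell 4 k 1 = P₁ k)
    (h₅ : ∀ k < n, σ.cell 5 k 0 = G₂ k ∧ σ.cell 5 k 1 = P₂ k)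
    (h₆ : σ.cell 6 = D)
    (hG₁ : G₁ n = 0) (hG₂ : G₂ n = 0) (hP₁ : P₁ n = -1) (hP₂ : P₂ n = -1) :
    Runs ω traceProg σ (n * (1 + 1 + 2) + 2 + (1 + (1 + ((n + n) * (3 + 1) + 1))))
      (fun τ => ∃ x y, IsPath n w₁ w₂ G₁ G₂ (D 0 0) x y ∧
        PathTables n w₁ w₂ P₁ P₂ c₁ c₂ x y τ.cell) := by
  refine Runs.seq (fillProg_spec hn h₁ h₂ hP₁ hP₂) fun σ₁ hk₁ q₁ => ?_
  refine Runs.seq (Q := fun τ => τ.reg 7 = 0 ∧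
    PathTables n w₁ w₂ P₁ P₂ c₁ c₂ (fun _ => n) (fun _ => n) τ.cell) (Runs.setReg ⟨by simp
      [IExp.eval], q₁⟩) fun σ₂ hk₂ q₂ => ?_
  refine Runs.seq (Q := fun τ => (τ.reg 7 = 0 ∧ τ.reg 8 = 0) ∧
    PathTables n w₁ w₂ P₁ P₂ c₁ c₂ (fun _ => n) (fun _ => n) τ.cell) (Runs.setReg ⟨by simp
      [IExp.eval, q₂.1], q₂.2⟩) fun σ₃ hk₃ q₃ => ?_
  have r1 : σ₃.reg 1 = n := by
    rw [hk₃.reg 1 (by simp [regs]), hk₂.reg 1 (by simp [regs]),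
      hk₁.reg 1 (by simp [fillProg, forLoop, regs]), hn]
  have ca : ∀ a, a ≠ 1 → a ≠ 2 → σ₃.cell a = σ.cell a := fun a ha ha' => by
    rw [hk₃.cell a (by simp [arrays]), hk₂.cell a (by simp [arrays]),
      hk₁.cell a (by simp [fillProg, forLoop, arrays, ha, ha'])]
  have hloop := Runs.loop (ω := ω) (σ := σ₃) (c := traceStep) (T := 3)
    (b := .and (.not (.ile (.reg 1) (.reg 7))) (.not (.ile (.reg 1) (.reg 8))))
    (fun τ => (τ.reg 7 ≤ n ∧ τ.reg 8 ≤ n) ∧ ∃ x y,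
      TracedPath n w₁ w₂ G₁ G₂ (D 0 0 - D (τ.reg 7) (τ.reg 8)) (τ.reg 7) (τ.reg 8) x y ∧
        PathTables n w₁ w₂ P₁ P₂ c₁ c₂ x y τ.cell) (fun τ => (n - τ.reg 7) + (n - τ.reg 8)) ?_ ?_
  · simp only [q₃.1.1, q₃.1.2, Nat.sub_zero] at hloop
    refine hloop.keeps.mono le_rfl ?_
    rintro τ ⟨hk, ⟨⟨h7, h8⟩, x, y, hp, ht⟩, hb⟩
    refine ⟨x, y, ?_, ht⟩
    have t1 : τ.reg 1 = n := by rw [hk.reg 1 (by simp [traceStep, regs]), r1]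
    simp only [BExp.Holds, IExp.eval, t1, not_and_or, not_not] at hb
    -- The loop stops at a border of the square, where nothing remains to be gained.
    have h9 : D (τ.reg 7) (τ.reg 8) = 0 := by
      rcases hb with hb | hb
      · rw [le_antisymm h7 hb]
        exact hD.right _ h8
      · rw [le_antisymm h8 hb]
        exact hD.top _ h7
    rw [h9, sub_zero] at hp
    exact hp.toIsPath
  · intro τ hkτ hI hb
    obtain ⟨⟨h7, h8⟩, x, y, hp, ht⟩ := hI
    have t1 : τ.reg 1 = n := by rw [hkτ.reg 1 (by simp [traceStep, regs]), r1]
    have ta : ∀ a, a ≠ 1 → a ≠ 2 → τ.cell a = σ.cell a := fun a ha ha' => by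
      rw [hkτ.cell a (by simp [traceStep, arrays, ha, ha']), ca a ha ha']
    simp only [BExp.Holds, IExp.eval, t1, not_le] at hb
    obtain ⟨i, hi⟩ : ∃ i, i = τ.reg 7 := ⟨_, rfl⟩
    obtain ⟨j, hj⟩ : ∃ j, j = τ.reg 8 := ⟨_, rfl⟩
    rw [← hi, ← hj] at hb hp
    have ec : (columnExp (.reg 7) (.reg 8)).eval τ = w₁ i * G₂ j + D (i + 1) j := by
      rw [columnExp_eval (e := .reg 7) (f := .reg 8) hi.symm hj.symm, (ht i hb.1).2.2.2, ta 5 (by norm_num) (by norm_num),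
        ta 6 (by norm_num) (by norm_num), h₆, (h₅ j hb.2).1]
    have er : (rowExp (.reg 7) (.reg 8)).eval τ = w₂ j * G₁ i + D i (j + 1) := by
      rw [rowExp_eval (e := .reg 7) (f := .reg 8) hi.symm hj.symm, (ht j hb.2).1.2.2, ta 4 (by norm_num) (by norm_num),
        ta 6 (by norm_num) (by norm_num), h₆, (h₄ i hb.1).1]
    have hDij := hD.step i hb.1 j hb.2
    refine Runs.branch (fun hb' => ?_) (fun hb' => ?_)
    · simp only [BExp.Holds, ec, er] at hb'
      rw [max_eq_left hb'] at hDij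
      refine Runs.seq (T := 1) (U := 1) (Q := fun υ =>
        PathTables n w₁ w₂ P₁ P₂ c₁ c₂ x (Function.update y i j) υ.cell) (Runs.setCell ?_)
        fun υ hkυ hυ => Runs.setReg ?_
      · intro k hk
        have := ht k hk
        simp only [setCell_cell, IExp.eval, RExp.eval, ← hi, ← hj, Function.update_apply]
        refine ⟨by simpa using this.1, by simp [this], ?_, by simp [this]⟩
        split_ifs with h1 h2 h2
        · rw [ta 5 (by norm_num) (by norm_num), (h₅ j hb.2).2]
        · exact absurd h1.2.1 h2
        · exact absurd ⟨trivial, h2, trivial⟩ h1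
        · exact this.2.2.1
      · have u7 : υ.reg 7 = i := by rw [hkυ.reg 7 (by simp [regs]), hi]
        have u8 : υ.reg 8 = j := by rw [hkυ.reg 8 (by simp [regs]), hj]
        simp only [setReg_reg, setReg_cell, IExp.eval, u7, if_true, u8,
          show (8 : ℕ) ≠ 7 by norm_num, if_false, ← hi, ← hj]
        refine ⟨⟨⟨hb.1, hb.2.le⟩, x, Function.update y i j, ?_, hυ⟩, by omega⟩
        convert hp.column hG₂ hb.1 hb.2 using 1
        linarith
    · simp only [BExp.Holds, ec, er, not_le] at hb'
      rw [max_eq_right hb'.le] at hDij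
      refine Runs.seq (T := 1) (U := 1) (Q := fun υ =>
        PathTables n w₁ w₂ P₁ P₂ c₁ c₂ (Function.update x j i) y υ.cell) (Runs.setCell ?_)
        fun υ hkυ hυ => Runs.setReg ?_
      · intro k hk
        have := ht k hk
        simp only [setCell_cell, IExp.eval, RExp.eval, ← hi, ← hj, Function.update_apply]
        refine ⟨⟨by simp [this], ?_, by simp [this]⟩, by simpa using this.2⟩
        split_ifs with h1 h2 h2
        · rw [ta 4 (by norm_num) (by norm_num), (h₄ i hb.1).2]
        · exact absurd h1.2.1 h2
        · exact absurd ⟨trivial, h2, trivial⟩ h1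
        · exact this.1.2.1
      · have u7 : υ.reg 7 = i := by rw [hkυ.reg 7 (by simp [regs]), hi]
        have u8 : υ.reg 8 = j := by rw [hkυ.reg 8 (by simp [regs]), hj]
        simp only [setReg_reg, setReg_cell, IExp.eval, u7, if_true, u8,
          show (7 : ℕ) ≠ 8 by norm_num, if_false, ← hi, ← hj]
        refine ⟨⟨⟨hb.1.le, hb.2⟩, Function.update x j i, y, ?_, hυ⟩, by omega⟩
        convert hp.row hG₁ hb.1 hb.2 using 1
        linarith
  · rw [q₃.1.1, q₃.1.2, sub_self]
    exact ⟨⟨Nat.zero_le _, Nat.zero_le _⟩, _, _, TracedPath.start hG₁ hG₂, q₃.2⟩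

end

end GainsFromTrade

namespace GainsFromTrade

open Program

/-! ### The algorithm -/

/-- Compute optimal tables from the samples in array `3`. -/
def tableProg : Program :=
  .seq (sortProg 1 2) (.seq (sortProg 2 1) (.seq (gainProg 1 2 4) (.seq (gainProg 2 1 5)
    (.seq pathProg traceProg))))

/-- Draw `reg 1` samples from each distribution. -/
def drawProg : Program :=
  forLoop 4 1 (.seq (.draw .s 3 (.const 0) (.reg 4)) (.seq (.draw .b₁ 3 (.const 1) (.reg 4))
    (.draw .b₂ 3 (.const 2) (.reg 4))))

/-- The precision `1 / k` is good enough for the accuracy `ε` and the confidence `δ`. -/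
def Suffices (ε δ : ℝ) (k : ℕ) : Prop := 1 ≤ ε ∨ 1 ≤ δ ∨ 1 ≤ k * ε ∧ 1 ≤ 2 ^ k * ε * δ

/-- The number of samples for the precision `1 / k`. -/
def sampleSize (k : ℕ) : ℕ := max 1 (51200 * k ^ 3)

/-- Compute the number of samples, in the registers `1` and `2`. -/
def sizeProg : Program :=
  .seq (.setCell 0 (.const 1) (.const 0) (.ofInt (.const 1)))
    (.seq
      (.loop (.and (.not (.rle (.ofInt (.const 1)) (.cell 0 (.const 0) (.const 0))))
        (.and (.not (.rle (.ofInt (.const 1)) (.cell 0 (.const 0) (.const 1))))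
          (.not (.and
            (.rle (.ofInt (.const 1)) (.mul (.ofInt (.reg 3)) (.cell 0 (.const 0) (.const 0))))
            (.rle (.ofInt (.const 1)) (.mul (.mul (.cell 0 (.const 1) (.const 0))
              (.cell 0 (.const 0) (.const 0))) (.cell 0 (.const 0) (.const 1))))))))
        (.seq (.setCell 0 (.const 1) (.const 0)
          (.add (.cell 0 (.const 1) (.const 0)) (.cell 0 (.const 1) (.const 0))))
          (.setReg 3 (.add (.reg 3) (.const 1)))))
      (.seq (.setReg 1 (.const 1))
        (.seq (.loop (.not (.rle (.mul (.ofInt (.const 51200))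
            (.mul (.ofInt (.reg 3)) (.mul (.ofInt (.reg 3)) (.ofInt (.reg 3)))))
            (.ofInt (.reg 1)))) (.setReg 1 (.add (.reg 1) (.const 1))))
          (.setReg 2 (.reg 1)))))

/-- The algorithm: sample, and optimize for the empirical distributions. -/
def mainProg : Program := .seq sizeProg (.seq drawProg tableProg)

section

variable {ω : SampleStream} {σ : State} {n : ℕ}

/-- The state holds optimal tables for the samples `s, a, b`. -/
def HoldsTables (n : ℕ) (s a b : ℕ → ℝ≥0) (m : ℕ → ℕ → ℕ → ℝ) : Prop :=
  ∃ G₁ P₁ G₂ P₂ D x y, Tables n s a b G₁ P₁ G₂ P₂ D ∧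
    IsPath n (fun r => weight n a r) (fun r => weight n b r) G₁ G₂ (D 0 0) x y ∧
    PathTables n (fun r => weight n a r) (fun r => weight n b r) P₁ P₂
      (fun r => sorted n b r) (fun r => sorted n a r) x y m

lemma tableProg_spec {s a b : ℕ → ℝ≥0} (hn : σ.reg 1 = n) (hs : ∀ k < n, σ.cell 3 0 k = s k)
    (ha : ∀ k < n, σ.cell 3 1 k = a k) (hb : ∀ k < n, σ.cell 3 2 k = b k) :
    Runs ω tableProg σ (100 * (n + 1) ^ 3) (fun τ => HoldsTables n s a b τ.cell) := by
  refine Runs.mono ((sortProg_spec (by norm_num) (by norm_num) hn ha).seq fun σ₁ k₁ h₁ => ?_)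
    (U := 100 * (n + 1) ^ 3) (T := (n * (6 * n * n + 10 * n + 4 + 2) + 2) +
      ((n * (6 * n * n + 10 * n + 4 + 2) + 2) +
      ((1 + (1 + (n * (1 + (n * (n * (2 + 2) + 2 + 2) + 2) + (1 + 1 + 1) + 2) + 2))) +
      ((1 + (1 + (n * (1 + (n * (n * (2 + 2) + 2 + 2) + 2) + (1 + 1 + 1) + 2) + 2))) +
      (((1 + (n * (1 + 1 + 2) + 2)) + (n * ((n * (2 + 2) + 2) + 2) + 2)) +
      (n * (1 + 1 + 2) + 2 + (1 + (1 + ((n + n) * (3 + 1) + 1)))))))))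
    (by ring_nf; nlinarith) (fun _ h => h)
  have n₁ : σ₁.reg 1 = n := by
    rw [k₁.reg 1 (by simp [sortProg, sortRow, sortBody, countProg, countBody, forLoop, regs]), hn]
  have c₁ : σ₁.cell 3 = σ.cell 3 := k₁.cell 3
    (by simp [sortProg, sortRow, sortBody, countProg, countBody, forLoop, arrays])
  refine (sortProg_spec (by norm_num) (by norm_num) n₁ (by rwa [c₁])).seq fun σ₂ k₂ h₂ => ?_
  have n₂ : σ₂.reg 1 = n := by
    rw [k₂.reg 1 (by simp [sortProg, sortRow, sortBody, countProg, countBody, forLoop, regs]), n₁]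
  have c₂ : σ₂.cell 3 = σ.cell 3 := by
    rw [k₂.cell 3 (by simp [sortProg, sortRow, sortBody, countProg, countBody, forLoop, arrays]),
      c₁]
  have e₂ : σ₂.cell 2 = σ₁.cell 2 := k₂.cell 2
    (by simp [sortProg, sortRow, sortBody, countProg, countBody, forLoop, arrays])
  rw [← e₂] at h₁
  refine (gainProg_spec (s := s) (x := a) (S := fun r => sorted n a r) (by norm_num) (by norm_num)
    (by norm_num) (by norm_num) n₂ (by rwa [c₂]) (by rwa [c₂]) fun r hr => (h₁ r hr).1).seq
    fun σ₃ k₃ h₃ => ?_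
  have n₃ : σ₃.reg 1 = n := by
    rw [k₃.reg 1 (by simp [gainProg, gainRow, gainSum, gainCell, forLoop, regs]), n₂]
  have a₃ : ∀ i, i ≠ 4 → i ≠ 7 → σ₃.cell i = σ₂.cell i := fun i hi hi' => k₃.cell i
    (by simp [gainProg, gainRow, gainSum, gainCell, forLoop, arrays, hi, hi'])
  have c₃ : σ₃.cell 3 = σ.cell 3 := by rw [a₃ 3 (by norm_num) (by norm_num), c₂]
  have h₂' := h₂
  rw [← a₃ 1 (by norm_num) (by norm_num)] at h₂'
  refine (gainProg_spec (s := s) (x := b) (S := fun r => sorted n b r) (by norm_num) (by norm_num)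
    (by norm_num) (by norm_num) n₃ (by rwa [c₃]) (by rwa [c₃]) fun r hr => (h₂' r hr).1).seq
    fun σ₄ k₄ h₄ => ?_
  have n₄ : σ₄.reg 1 = n := by
    rw [k₄.reg 1 (by simp [gainProg, gainRow, gainSum, gainCell, forLoop, regs]), n₃]
  have a₄ : ∀ i, i ≠ 5 → i ≠ 7 → σ₄.cell i = σ₃.cell i := fun i hi hi' => k₄.cell i
    (by simp [gainProg, gainRow, gainSum, gainCell, forLoop, arrays, hi, hi'])
  rw [← a₄ 4 (by norm_num) (by norm_num)] at h₃
  rw [← a₃ 2 (by norm_num) (by norm_num), ← a₄ 2 (by norm_num) (by norm_num)] at h₁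
  rw [← a₄ 1 (by norm_num) (by norm_num)] at h₂'
  refine (pathProg_spec (w₁ := fun r => weight n a r) (w₂ := fun r => weight n b r)
    (G₁ := fun r => σ₄.cell 4 r 0) (G₂ := fun r => σ₄.cell 5 r 0) n₄ (fun r hr => (h₁ r hr).2)
    (fun r hr => (h₂' r hr).2) (fun _ _ => rfl) fun _ _ => rfl).seq fun σ₅ k₅ h₅ => ?_
  have n₅ : σ₅.reg 1 = n := by
    rw [k₅.reg 1 (by simp [pathProg, borderProg, pathCell, forLoop, regs]), n₄]
  have a₅ : ∀ i, i ≠ 6 → σ₅.cell i = σ₄.cell i := fun i hi => k₅.cell i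
    (by simp [pathProg, borderProg, pathCell, forLoop, arrays, hi])
  rw [← a₅ 2 (by norm_num)] at h₁
  rw [← a₅ 1 (by norm_num)] at h₂'
  refine (traceProg_spec (P₁ := fun r => σ₄.cell 4 r 1) (P₂ := fun r => σ₄.cell 5 r 1)
    (c₁ := fun r => sorted n b r) (c₂ := fun r => sorted n a r) n₅ h₅ h₂' h₁
    (fun k _ => by rw [a₅ 4 (by norm_num)]; exact ⟨rfl, rfl⟩)
    (fun k _ => by rw [a₅ 5 (by norm_num)]; exact ⟨rfl, rfl⟩) rfl h₃.last h₄.last h₃.price_last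
    h₄.price_last).mono le_rfl ?_
  rintro τ ⟨x, y, hp, ht⟩
  exact ⟨_, _, _, _, _, x, y, ⟨h₃, h₄, h₅⟩, hp, ht⟩

lemma drawProg_spec (hn : σ.reg 1 = n) (hd : ∀ i, σ.drawn i = 0) :
    Runs ω drawProg σ (n * (1 + (1 + 1) + 2) + 2) (fun τ => (∀ i, τ.drawn i = n) ∧ ∀ k < n,
      τ.cell 3 0 k = ω (.s, k) ∧ τ.cell 3 1 k = ω (.b₁, k) ∧ τ.cell 3 2 k = ω (.b₂, k)) := by
  refine Runs.forLoop (fun k m d => (∀ i, d i = k) ∧ ∀ l < k,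
      m 3 0 l = ω (.s, l) ∧ m 3 1 l = ω (.b₁, l) ∧ m 3 2 l = ω (.b₂, l))
    (by simp [regs]) (by simp [regs]) (by norm_num) hn ?_ (by simpa using hd)
  intro k hk τ hkτ h4 hI
  refine Runs.seq (Q := fun υ => υ = τ.draw ω .s 3 0 k) (Runs.draw (by simp [IExp.eval, h4]))
    fun υ _ hυ => ?_
  refine Runs.seq (Q := fun ξ => ξ = υ.draw ω .b₁ 3 1 k)
    (Runs.draw (by simp [IExp.eval, hυ, h4])) fun ξ _ hξ => Runs.draw ?_
  subst hξ
  subst hυ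
  refine ⟨fun i => ?_, fun l hl => ?_⟩
  · cases i <;> simp [hI.1]
  · rcases Nat.lt_succ_iff_lt_or_eq.1 hl with h | rfl
    · simp [IExp.eval, h4, hI.2 l h, h.ne]
    · simp [IExp.eval, h4, hI.1]

/-- The machine has neither logarithms nor rounding. It searches for the least suitable `k` while
doubling a cell that holds `2 ^ k`, then counts up to the sample size and compares with a real cube.
-/
lemma sizeProg_spec {ε δ : ℝ} {M : ℕ} (hM : IsLeast {k | Suffices ε δ k} M) :
    Runs ω sizeProg (inputState ε δ)
      (1 + ((M * (1 + 1 + 1) + 1) + (1 + ((sampleSize M - 1) * (1 + 1) + 1 + 1))))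
      (fun τ => τ.reg 1 = sampleSize M ∧ τ.reg 2 = sampleSize M) := by
  refine Runs.seq (Q := fun τ => (τ.cell 0 0 0 = ε ∧ τ.cell 0 0 1 = δ) ∧ τ.reg 3 = 0 ∧
    τ.cell 0 1 0 = 1) (Runs.setCell (by simp [inputState, RExp.eval, IExp.eval]))
    fun σ₁ hk₁ h₁ => ?_
  refine Runs.seq (T := M * (1 + 1 + 1) + 1) (Q := fun τ => τ.reg 3 = M) ?_ fun σ₂ hk₂ h₂ => ?_
  · have h3 := h₁.2.1
    have := Runs.loop (ω := ω) (σ := σ₁) (T := 1 + 1)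
      (b := (.and (.not (.rle (.ofInt (.const 1)) (.cell 0 (.const 0) (.const 0))))
        (.and (.not (.rle (.ofInt (.const 1)) (.cell 0 (.const 0) (.const 1))))
          (.not (.and
            (.rle (.ofInt (.const 1)) (.mul (.ofInt (.reg 3)) (.cell 0 (.const 0) (.const 0))))
            (.rle (.ofInt (.const 1)) (.mul (.mul (.cell 0 (.const 1) (.const 0))
              (.cell 0 (.const 0) (.const 0))) (.cell 0 (.const 0) (.const 1)))))))))
      (c := (.seq (.setCell 0 (.const 1) (.const 0)
          (.add (.cell 0 (.const 1) (.const 0)) (.cell 0 (.const 1) (.const 0))))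
          (.setReg 3 (.add (.reg 3) (.const 1)))))
      (fun τ => (τ.cell 0 0 0 = ε ∧ τ.cell 0 0 1 = δ) ∧ τ.reg 3 ≤ M ∧
        τ.cell 0 1 0 = 2 ^ τ.reg 3) (fun τ => M - τ.reg 3) ?_ ?_
    · simp only [h3, Nat.sub_zero] at this
      refine this.mono le_rfl ?_
      rintro τ ⟨⟨⟨hε, hδ⟩, hle, hp⟩, hb⟩
      refine le_antisymm hle (hM.2 ?_)
      simp only [BExp.Holds, RExp.eval, IExp.eval, hε, hδ, hp, Nat.cast_one] at hb
      show Suffices ε δ (τ.reg 3)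
      unfold Suffices
      tauto
    · rintro τ - ⟨⟨hε, hδ⟩, hle, hp⟩ hb
      simp only [BExp.Holds, RExp.eval, IExp.eval, hε, hδ, hp, Nat.cast_one] at hb
      have hlt : τ.reg 3 < M := by
        refine lt_of_le_of_ne hle fun h => ?_
        have := hM.1
        rw [← h] at this
        simp only [mem_ofPred_eq, Suffices] at this
        tauto
      refine Runs.seq (Q := fun υ => (υ.cell 0 0 0 = ε ∧ υ.cell 0 0 1 = δ) ∧
        υ.reg 3 = τ.reg 3 ∧ υ.cell 0 1 0 = 2 ^ (τ.reg 3 + 1)) (Runs.setCell ?_)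
        fun υ _ hυ => Runs.setReg ?_
      · simp [RExp.eval, IExp.eval, hε, hδ, hp, pow_succ, mul_two]
      · simp only [setReg_cell, setReg_reg, if_true, IExp.eval, hυ]
        exact ⟨⟨by simp, hlt, trivial⟩, by omega⟩
    · simp [h₁]
  · refine Runs.seq (Q := fun τ => τ.reg 1 = 1 ∧ τ.reg 3 = M)
      (Runs.setReg (by simp [IExp.eval, h₂])) fun σ₃ hk₃ h₃ => ?_
    refine Runs.seq (T := (sampleSize M - 1) * (1 + 1) + 1) (U := 1)
      (Q := fun τ => τ.reg 1 = sampleSize M) ?_ fun σ₄ hk₄ h₄ =>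
        Runs.setReg (by simp [IExp.eval, h₄])
    have hbM : ∀ τ : State, τ.reg 3 = M →
        ((BExp.not (.rle (.mul (.ofInt (.const 51200))
          (.mul (.ofInt (.reg 3)) (.mul (.ofInt (.reg 3)) (.ofInt (.reg 3)))))
          (.ofInt (.reg 1)))).Holds τ ↔ τ.reg 1 < 51200 * M ^ 3) := by
      intro τ hτ
      simp only [BExp.Holds, RExp.eval, IExp.eval, hτ, not_le]
      rw [← Nat.cast_lt (α := ℝ)]
      push_cast
      rw [show (51200 : ℝ) * (M * (M * M)) = 51200 * (M : ℝ) ^ 3 by ring]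
    have := Runs.loop (ω := ω) (σ := σ₃) (T := 1)
      (b := .not (.rle (.mul (.ofInt (.const 51200))
            (.mul (.ofInt (.reg 3)) (.mul (.ofInt (.reg 3)) (.ofInt (.reg 3)))))
            (.ofInt (.reg 1)))) (c := .setReg 1 (.add (.reg 1) (.const 1)))
      (fun τ => (1 ≤ τ.reg 1 ∧ τ.reg 1 ≤ sampleSize M) ∧ τ.reg 3 = M)
      (fun τ => sampleSize M - τ.reg 1) ?_ ?_
    · rw [h₃.1] at this
      refine this.mono le_rfl ?_
      rintro τ ⟨⟨⟨h5, h6⟩, h7⟩, h8⟩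
      rw [hbM τ h7] at h8
      exact le_antisymm h6 (max_le h5 (not_lt.1 h8))
    · rintro τ - ⟨⟨h5, h6⟩, h7⟩ h8
      rw [hbM τ h7] at h8
      have h9 : τ.reg 1 < sampleSize M := lt_max_of_lt_right h8
      refine Runs.setReg ?_
      simp only [setReg_reg, IExp.eval, if_true, show (3 : ℕ) ≠ 1 by norm_num, if_false]
      exact ⟨⟨⟨by omega, h9⟩, h7⟩, by omega⟩
    · exact ⟨⟨h₃.1.ge, h₃.1.le.trans (le_max_left _ _)⟩, h₃.2⟩

/-- Lets the time of the search for `M` be absorbed into the bound in terms of the sample size. -/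
lemma le_sampleSize (M : ℕ) : M ≤ sampleSize M := by
  refine le_max_of_le_right ?_
  rcases Nat.eq_zero_or_pos M with rfl | h
  · simp
  · calc M ≤ M ^ 3 := Nat.le_self_pow (by norm_num) M
      _ ≤ 51200 * M ^ 3 := Nat.le_mul_of_pos_left _ (by norm_num)

/-- The algorithm halts after polynomially many steps, with optimal tables for the samples. -/
theorem mainProg_spec (ω : SampleStream) {ε δ : ℝ} {M : ℕ}
    (hM : IsLeast {k | Suffices ε δ k} M) :
    Runs ω mainProg (inputState ε δ) (200 * (sampleSize M + 1) ^ 3) (fun τ =>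
      (∀ i, τ.drawn i = sampleSize M) ∧ (τ.reg 1 = sampleSize M ∧ τ.reg 2 = sampleSize M) ∧
        HoldsTables (sampleSize M) (fun k => ω (.s, k)) (fun k => ω (.b₁, k))
          (fun k => ω (.b₂, k)) τ.cell) := by
  have hle := le_sampleSize M
  set n := sampleSize M with hn
  refine Runs.mono (T := (1 + ((M * (1 + 1 + 1) + 1) + (1 + ((n - 1) * (1 + 1) + 1 + 1)))) +
    ((n * (1 + (1 + 1) + 2) + 2) + 100 * (n + 1) ^ 3)) ?_ ?_ (fun _ h => h)
  · refine (sizeProg_spec hM).seq fun σ₁ k₁ h₁ => ?_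
    have d₁ : ∀ i, σ₁.drawn i = 0 := fun i => by
      rw [k₁.drawn (by simp [sizeProg, NoDraw])]
      rfl
    refine (drawProg_spec h₁.1 d₁).seq fun σ₂ k₂ h₂ => ?_
    have r₂ : ∀ x, x ≠ 4 → σ₂.reg x = σ₁.reg x := fun x hx => k₂.reg x
      (by simp [drawProg, forLoop, regs, hx])
    refine (tableProg_spec (s := fun k => ω (.s, k)) (a := fun k => ω (.b₁, k))
      (b := fun k => ω (.b₂, k)) ((r₂ 1 (by norm_num)).trans h₁.1) (fun k hk => (h₂.2 k hk).1)
      (fun k hk => (h₂.2 k hk).2.1) (fun k hk => (h₂.2 k hk).2.2)).keeps.mono le_rfl ?_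
    rintro τ ⟨hk, hτ⟩
    refine ⟨fun i => ?_, ⟨?_, ?_⟩, hτ⟩
    · rw [hk.drawn (by simp [tableProg, traceProg, traceStep, fillProg, pathProg, borderProg,
        pathCell, gainProg, gainRow, gainSum, gainCell, sortProg, sortRow, sortBody, countProg,
        countBody, forLoop, NoDraw]), h₂.1]
    · rw [hk.reg 1 (by simp [tableProg, traceProg, traceStep, fillProg, pathProg, borderProg,
        pathCell, gainProg, gainRow, gainSum, gainCell, sortProg, sortRow, sortBody, countProg,
        countBody, forLoop, regs]), r₂ 1 (by norm_num), h₁.1]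
    · rw [hk.reg 2 (by simp [tableProg, traceProg, traceStep, fillProg, pathProg, borderProg,
        pathCell, gainProg, gainRow, gainSum, gainCell, sortProg, sortRow, sortBody, countProg,
        countBody, forLoop, regs]), r₂ 2 (by norm_num), h₁.2]
  · have h5 : n + 1 ≤ (n + 1) ^ 3 := Nat.le_self_pow (by norm_num) _
    generalize (n + 1) ^ 3 = N at h5
    omega

end

end GainsFromTrade

/-! ### From the final machine state to an optimal good pair -/

namespace GainsFromTrade

lemma stepFunction_congr {s s' p p' : ℕ → ℝ} {n : ℕ} (h : ∀ k < n, s k = s' k ∧ p k = p' k) :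
    stepFunction s p n = stepFunction s' p' n := by
  induction n with
  | zero => rfl
  | succ n ih =>
    funext v
    simp only [stepFunction, (h n n.lt_succ_self).1, (h n n.lt_succ_self).2,
      ih fun k hk => h k (hk.trans n.lt_succ_self)]

/-- The algorithm halts after polynomially many steps; its output is well-behaved, and optimal for
the samples drawn. -/
theorem mainProg_output (ω : SampleStream) {ε δ : ℝ} {m : ℕ}
    (hm : IsLeast {k | Suffices ε δ k} m) :
    ∃ t σ, Exec ω mainProg (inputState ε δ) t σ ∧ t ≤ 200 * (sampleSize m + 1) ^ 3 ∧
      (∀ i, σ.drawn i = sampleSize m) ∧ GoodPair (σ.outputFunction 1) (σ.outputFunction 2) ∧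
      ∀ M : Mechanism, M.IsSimple →
        total (sampleSize m) (fun k => ω (.s, k)) (fun k => ω (.b₁, k)) (fun k => ω (.b₂, k))
          (fun s a b => M.gft (mkProfile s a b)) ≤
        total (sampleSize m) (fun k => ω (.s, k)) (fun k => ω (.b₁, k)) (fun k => ω (.b₂, k))
          (fun s a b => σ.outputMechanism.gft (mkProfile s a b)) := by
  obtain ⟨t, σ, h1, h2, h3, ⟨h4, h5⟩, G₁, P₁, G₂, P₂, D, x, y, h6, h7, h8⟩ :=
    mainProg_spec ω hm
  have e1 : σ.outputFunction 1 = stepFunction (fun r => sorted (sampleSize m)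
      (fun k => ω (.b₂, k)) r) (fun j => P₁ (x j)) (sampleSize m) := by
    unfold State.outputFunction
    rw [h4]
    exact stepFunction_congr fun k hk => ⟨(h8 k hk).1.1, (h8 k hk).1.2.1⟩
  have e2 : σ.outputFunction 2 = stepFunction (fun r => sorted (sampleSize m)
      (fun k => ω (.b₁, k)) r) (fun j => P₂ (y j)) (sampleSize m) := by
    unfold State.outputFunction
    rw [h5]
    exact stepFunction_congr fun k hk => ⟨(h8 k hk).2.1, (h8 k hk).2.2.1⟩
  refine ⟨t, σ, h1, h2, h3, ?_, fun M hM => ?_⟩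
  · rw [e1, e2]
    exact h6.goodPair h7
  · unfold State.outputMechanism
    rw [e1, e2]
    exact h6.optimal h7 hM

end GainsFromTrade

namespace GainsFromTrade

/-! ### Uniform convergence over intervals -/

section Brackets

variable {μ ν : Measure ℝ≥0}

/-- A union of sets of measure at most `c` has measure at most `c`, if each compact subset is
covered by one of the sets. -/
lemma measure_sUnion_le_of_compact [IsFiniteMeasure μ] {S : Set (Set ℝ≥0)} {c : ℝ≥0∞}
    (hS : ∀ U ∈ S, μ U ≤ c) (hm : MeasurableSet (⋃₀ S))
    (hK : ∀ K ⊆ ⋃₀ S, IsCompact K → K.Nonempty → ∃ U ∈ S, K ⊆ U) : μ (⋃₀ S) ≤ c := by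
  rw [hm.measure_eq_iSup_isCompact_of_ne_top (measure_ne_top _ _)]
  refine iSup₂_le fun K hKS => iSup_le fun hKc => ?_
  rcases K.eq_empty_or_nonempty with rfl | hne
  · simp
  · obtain ⟨U, hU, hKU⟩ := hK K hKS hKc hne
    exact (measure_mono hKU).trans (hS U hU)

lemma isUpperSet_measurableSet {U : Set ℝ≥0} (hU : IsUpperSet U) : MeasurableSet U :=
  hU.ordConnected.measurableSet

/-- The union may be uncountable, but a nonempty compact subset has a least point, and a member of
the family that contains this point contains the whole compact set. Inner regularity does the rest.
-/
lemma measure_sUnion_upperSet_le [IsFiniteMeasure μ] {S : Set (Set ℝ≥0)} {c : ℝ≥0∞}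
    (hS : ∀ U ∈ S, IsUpperSet U ∧ μ U ≤ c) : μ (⋃₀ S) ≤ c := by
  refine measure_sUnion_le_of_compact (fun U hU => (hS U hU).2)
    (isUpperSet_measurableSet (isUpperSet_sUnion fun U hU => (hS U hU).1)) fun K hKS hKc hne => ?_
  obtain ⟨x, hx, hmin⟩ := hKc.exists_isLeast hne
  obtain ⟨U, hU, hxU⟩ := hKS hx
  exact ⟨U, hU, fun y hy => (hS U hU).1 (hmin hy) hxU⟩

lemma measure_sUnion_lowerSet_le [IsFiniteMeasure μ] {S : Set (Set ℝ≥0)} {c : ℝ≥0∞}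
    (hS : ∀ U ∈ S, IsLowerSet U ∧ μ U ≤ c) : μ (⋃₀ S) ≤ c := by
  refine measure_sUnion_le_of_compact (fun U hU => (hS U hU).2)
    (isLowerSet_sUnion fun U hU => (hS U hU).1).ordConnected.measurableSet
    fun K hKS hKc hne => ?_
  obtain ⟨x, hx, hmax⟩ := hKc.exists_isGreatest hne
  obtain ⟨U, hU, hxU⟩ := hKS hx
  exact ⟨U, hU, fun y hy => (hS U hU).1 (hmax hy) hxU⟩

/-- The union of the upper sets of measure at most `c`. -/
def outerBracket (μ : Measure ℝ≥0) (c : ℝ) : Set ℝ≥0 := ⋃₀ {U | IsUpperSet U ∧ μ.real U ≤ c}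

/-- The intersection of the upper sets of measure at least `c`. -/
def innerBracket (μ : Measure ℝ≥0) (c : ℝ) : Set ℝ≥0 := ⋂₀ {U | IsUpperSet U ∧ c ≤ μ.real U}

lemma measurableSet_outerBracket (c : ℝ) : MeasurableSet (outerBracket μ c) :=
  isUpperSet_measurableSet (isUpperSet_sUnion fun _ hU => hU.1)

lemma measurableSet_innerBracket (c : ℝ) : MeasurableSet (innerBracket μ c) :=
  isUpperSet_measurableSet (isUpperSet_sInter fun _ hU => hU.1)

lemma measureReal_outerBracket_le [IsFiniteMeasure μ] {c : ℝ} (hc : 0 ≤ c) :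
    μ.real (outerBracket μ c) ≤ c := by
  refine ENNReal.toReal_le_of_le_ofReal hc (measure_sUnion_upperSet_le fun U hU => ⟨hU.1, ?_⟩)
  exact (ENNReal.le_ofReal_iff_toReal_le (measure_ne_top _ _) hc).2 hU.2

/-- Complements turn the intersection of upper sets into a union of lower sets, to which the
compactness argument applies with greatest points. -/
lemma le_measureReal_innerBracket [IsProbabilityMeasure μ] {c : ℝ} (hc : c ≤ 1) :
    c ≤ μ.real (innerBracket μ c) := by
  have h1 : μ.real (innerBracket μ c)ᶜ ≤ 1 - c := by
    refine ENNReal.toReal_le_of_le_ofReal (by linarith) ?_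
    rw [innerBracket, compl_sInter]
    refine measure_sUnion_lowerSet_le ?_
    rintro _ ⟨U, hU, rfl⟩
    refine ⟨hU.1.compl, (ENNReal.le_ofReal_iff_toReal_le (measure_ne_top _ _) (by linarith)).2 ?_⟩
    change μ.real Uᶜ ≤ _
    rw [probReal_compl_eq_one_sub (isUpperSet_measurableSet hU.1)]
    linarith [hU.2]
  rw [probReal_compl_eq_one_sub (measurableSet_innerBracket c)] at h1
  linarith

/-- If the brackets at the multiples of `1 / K` have nearly the same measure, then so do all upper
sets. -/
lemma abs_sub_le_of_upperSet [IsProbabilityMeasure μ] [IsProbabilityMeasure ν] {K : ℕ}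
    (hK : 0 < K) {η : ℝ}
    (hout : ∀ k < K, ν.real (outerBracket μ ((k + 1) / K)) ≤
      μ.real (outerBracket μ ((k + 1) / K)) + η)
    (hin : ∀ k < K, μ.real (innerBracket μ (k / K)) - η ≤ ν.real (innerBracket μ (k / K)))
    {U : Set ℝ≥0} (hU : IsUpperSet U) : |μ.real U - ν.real U| ≤ η + 1 / K := by
  have hK' : (0 : ℝ) < K := Nat.cast_pos.2 hK
  obtain ⟨k, hk, h1, h2⟩ : ∃ k < K, (k : ℝ) / K ≤ μ.real U ∧ μ.real U ≤ (k + 1) / K := by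
    have h0 : 0 ≤ μ.real U * K := by positivity
    rcases (measureReal_le_one (μ := μ) (s := U)).lt_or_eq with h | h
    · refine ⟨⌊μ.real U * K⌋₊, (Nat.floor_lt h0).2 ?_, ?_, ?_⟩
      · exact mul_lt_of_lt_one_left hK' h
      · rw [div_le_iff₀ hK']
        exact Nat.floor_le h0
      · rw [le_div_iff₀ hK']
        exact (Nat.lt_floor_add_one _).le
    -- An upper set of full measure belongs to the last bracket; the floor would give the index `K`,
    -- which is out of range.
    · refine ⟨K - 1, by omega, ?_, ?_⟩ <;> rw [Nat.cast_sub hK, h]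
      · rw [div_le_one hK']
        simp
      · rw [le_div_iff₀ hK']
        simp
  have h3 : innerBracket μ (k / K) ⊆ U := sInter_subset_of_mem ⟨hU, h1⟩
  have h4 : U ⊆ outerBracket μ ((k + 1) / K) := subset_sUnion_of_mem ⟨hU, h2⟩
  have h5 := measureReal_outerBracket_le (μ := μ) (c := (k + 1) / K) (by positivity)
  have h6 := le_measureReal_innerBracket (μ := μ) (c := k / K)
    ((div_le_one hK').2 (Nat.cast_le.2 hk.le))
  have h7 := hout k hk
  have h8 := hin k hk
  have h9 : ν.real U ≤ ν.real (outerBracket μ ((k + 1) / K)) := measureReal_mono h4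
  have h10 : ν.real (innerBracket μ (k / K)) ≤ ν.real U := measureReal_mono h3
  have h11 : ((k : ℝ) + 1) / K = k / K + 1 / K := add_div _ _ _
  rw [abs_le]
  constructor <;> linarith

/-- An order-connected set is the difference of two nested upper sets: its upper closure, and the
part of that closure outside the set. Each contributes one error `η`. -/
lemma abs_sub_le_of_ordConnected [IsProbabilityMeasure μ] [IsProbabilityMeasure ν] {η : ℝ}
    (h : ∀ U : Set ℝ≥0, IsUpperSet U → |μ.real U - ν.real U| ≤ η) {A : Set ℝ≥0}
    (hA : A.OrdConnected) : |μ.real A - ν.real A| ≤ 2 * η := by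
  obtain ⟨U, U', hU, hU', hsub, rfl⟩ : ∃ U U' : Set ℝ≥0, IsUpperSet U ∧ IsUpperSet U' ∧ U' ⊆ U ∧
      A = U \ U' := by
    refine ⟨upperClosure A, upperClosure A \ A, (upperClosure A).upper, ?_, sdiff_subset, ?_⟩
    · rintro x y hxy ⟨⟨a, ha, hax⟩, hx⟩
      exact ⟨⟨a, ha, hax.trans hxy⟩, fun hy => hx (hA.out ha hy ⟨hax, hxy⟩)⟩
    · rw [sdiff_sdiff_right_self]
      exact (inter_eq_right.2 subset_upperClosure).symm
  have h1 := h U hU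
  have h2 := h U' hU'
  rw [measureReal_sdiff hsub (isUpperSet_measurableSet hU'),
    measureReal_sdiff hsub (isUpperSet_measurableSet hU')]
  rw [abs_le] at *
  constructor <;> linarith [h1.1, h1.2, h2.1, h2.2]

/-- Measures that nearly agree on intervals nearly agree on quasiconcave functions. -/
lemma abs_integral_sub_le_of_ordConnected [IsProbabilityMeasure μ] [IsProbabilityMeasure ν] {η : ℝ}
    (h : ∀ A : Set ℝ≥0, A.OrdConnected → |μ.real A - ν.real A| ≤ η) {f : ℝ≥0 → ℝ}
    (hf : Measurable f) (h0 : ∀ x, 0 ≤ f x) (h1 : ∀ x, f x ≤ 1)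
    (hc : ∀ t, {x | t ≤ f x}.OrdConnected) : |∫ x, f x ∂μ - ∫ x, f x ∂ν| ≤ η := by
  have hint : ∀ (κ : Measure ℝ≥0) [IsProbabilityMeasure κ], Integrable f κ := fun κ _ =>
    Integrable.of_mem_Icc 0 1 hf.aemeasurable (ae_of_all _ fun x => ⟨h0 x, h1 x⟩)
  have hanti : ∀ (κ : Measure ℝ≥0) [IsProbabilityMeasure κ],
      IntegrableOn (fun t => κ.real {x | t ≤ f x}) (Ioc (0 : ℝ) 1) := by
    intro κ _
    have hmono : Antitone fun t : ℝ => κ.real {x | t ≤ f x} := fun s t hst =>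
      measureReal_mono fun x hx => le_trans hst hx
    exact Integrable.of_mem_Icc 0 1 hmono.measurable.aemeasurable
      (ae_of_all _ fun t => ⟨measureReal_nonneg, measureReal_le_one⟩)
  -- Layer cake: the superlevel sets are intervals, and the levels run over an interval of length
  -- `1`, so the error on intervals carries over unchanged.
  rw [(hint μ).integral_eq_integral_Ioc_meas_le (ae_of_all _ h0) (ae_of_all _ h1),
    (hint ν).integral_eq_integral_Ioc_meas_le (ae_of_all _ h0) (ae_of_all _ h1),
    ← integral_sub (hanti μ) (hanti ν)]
  have := norm_setIntegral_le_of_norm_le_const (μ := volume) (s := Ioc (0 : ℝ) 1) (C := η)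
    (f := fun t => μ.real {x | t ≤ f x} - ν.real {x | t ≤ f x}) (by simp)
    (fun t _ => h _ (hc t))
  simpa using this

end Brackets

/-! ### Changing the factors of a product measure -/

section Swap

variable {V W : Agent → Measure ℝ≥0} [∀ i, IsProbabilityMeasure (V i)]
  [∀ i, IsProbabilityMeasure (W i)]

/-- Replacing one factor amounts to resampling that coordinate independently, which makes Fubini
applicable in the comparison of the two products. -/
lemma pi_update_eq_map (V : Agent → Measure ℝ≥0) [∀ i, IsProbabilityMeasure (V i)] (i : Agent)
    (ν : Measure ℝ≥0) [IsProbabilityMeasure ν] :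
    Measure.pi (Function.update V i ν) =
      ((Measure.pi V).prod ν).map (fun p => Function.update p.1 i p.2) := by
  have hprob : ∀ j, IsProbabilityMeasure (Function.update V i ν j) := fun j => by
    rw [Function.update_apply]
    split_ifs <;> infer_instance
  have hmeas : Measurable fun p : Profile × ℝ≥0 => Function.update p.1 i p.2 := by
    refine measurable_pi_iff.2 fun j => ?_
    simp only [Function.update_apply]
    split_ifs
    · exact measurable_snd
    · exact (measurable_pi_apply j).comp measurable_fst
  refine Measure.pi_eq fun s hs => ?_
  rw [Measure.map_apply hmeas (MeasurableSet.univ_pi hs)]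
  have : (fun p : Profile × ℝ≥0 => Function.update p.1 i p.2) ⁻¹' (univ.pi s) =
      (univ.pi (Function.update s i univ)) ×ˢ s i := by
    ext p
    simp only [mem_preimage, mem_pi, mem_univ, true_imp_iff, mem_prod]
    constructor
    · refine fun h => ⟨fun j => ?_, by simpa using h i⟩
      by_cases hj : j = i
      · subst hj; simp
      · simpa [hj] using h j
    · rintro ⟨h1, h2⟩ j
      by_cases hj : j = i
      · subst hj; simpa using h2
      · simpa [hj] using h1 j
  rw [this, Measure.prod_prod, Measure.pi_pi, ← Finset.prod_erase_mul _ _ (Finset.mem_univ i),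
    ← Finset.prod_erase_mul (Finset.univ) (fun j => Function.update V i ν j (s j))
      (Finset.mem_univ i)]
  simp only [Function.update_self, measure_univ, mul_one]
  congr 1
  refine Finset.prod_congr rfl fun j hj => ?_
  rw [Function.update_of_ne (Finset.ne_of_mem_erase hj),
    Function.update_of_ne (Finset.ne_of_mem_erase hj)]

/-- A function on profiles that is measurable, has values in `[0, 1]`, and is quasiconcave in each
coordinate. -/
structure CoordQuasiconcave (φ : Profile → ℝ) : Prop where
  meas : Measurable φ
  nonneg : ∀ r, 0 ≤ φ r
  le_one : ∀ r, φ r ≤ 1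
  ordConnected : ∀ i r t, {x | t ≤ φ (Function.update r i x)}.OrdConnected

/-- With the other coordinates fixed, the two inner integrals are those of one quasiconcave function
against `V i` and `ν`. -/
lemma CoordQuasiconcave.abs_integral_update_sub_le {φ : Profile → ℝ} (hφ : CoordQuasiconcave φ)
    (i : Agent) {ν : Measure ℝ≥0} [IsProbabilityMeasure ν] {η : ℝ}
    (h : ∀ A : Set ℝ≥0, A.OrdConnected → |(V i).real A - ν.real A| ≤ η) :
    |∫ r, φ r ∂(Measure.pi V) - ∫ r, φ r ∂(Measure.pi (Function.update V i ν))| ≤ η := by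
  have hmeas : Measurable fun p : Profile × ℝ≥0 => Function.update p.1 i p.2 := by
    refine measurable_pi_iff.2 fun j => ?_
    simp only [Function.update_apply]
    split_ifs
    · exact measurable_snd
    · exact (measurable_pi_apply j).comp measurable_fst
  have key : ∀ (κ : Measure ℝ≥0) [IsProbabilityMeasure κ],
      ∫ r, φ r ∂(Measure.pi (Function.update V i κ)) =
        ∫ r, (∫ x, φ (Function.update r i x) ∂κ) ∂(Measure.pi V) ∧
      Integrable (fun r => ∫ x, φ (Function.update r i x) ∂κ) (Measure.pi V) := by
    intro κ _
    have hint : Integrable (fun p : Profile × ℝ≥0 => φ (Function.update p.1 i p.2))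
        ((Measure.pi V).prod κ) :=
      Integrable.of_mem_Icc 0 1 (hφ.meas.comp hmeas).aemeasurable
        (ae_of_all _ fun p => ⟨hφ.nonneg _, hφ.le_one _⟩)
    refine ⟨?_, hint.integral_prod_left⟩
    rw [pi_update_eq_map, integral_map hmeas.aemeasurable hφ.meas.aestronglyMeasurable,
      integral_prod _ hint]
  obtain ⟨h1, h2⟩ := key (V i)
  obtain ⟨h3, h4⟩ := key ν
  rw [Function.update_eq_self] at h1
  rw [h1, h3, ← integral_sub h2 h4]
  have := norm_integral_le_of_norm_le_const (μ := Measure.pi V) (C := η) (f := fun r =>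
    ∫ x, φ (Function.update r i x) ∂(V i) - ∫ x, φ (Function.update r i x) ∂ν)
    (ae_of_all _ fun r => abs_integral_sub_le_of_ordConnected h
      (hφ.meas.comp (hmeas.comp measurable_prodMk_left)) (fun _ => hφ.nonneg _)
      (fun _ => hφ.le_one _) (hφ.ordConnected i r))
  simpa using this

/-- A hybrid argument: the three factors are replaced one after the other, at a cost of `η` each. -/
lemma CoordQuasiconcave.abs_integral_pi_sub_le {φ : Profile → ℝ} (hφ : CoordQuasiconcave φ)
    {η : ℝ} (h : ∀ i, ∀ A : Set ℝ≥0, A.OrdConnected → |(V i).real A - (W i).real A| ≤ η) :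
    |∫ r, φ r ∂(Measure.pi V) - ∫ r, φ r ∂(Measure.pi W)| ≤ 3 * η := by
  have hprob : ∀ (U : Agent → Measure ℝ≥0) (i : Agent), (∀ j, IsProbabilityMeasure (U j)) →
      ∀ j, IsProbabilityMeasure (Function.update U i (W i) j) := fun U i hU j => by
    rw [Function.update_apply]
    split_ifs <;> infer_instance
  set V₁ := Function.update V .s (W .s) with hV₁
  set V₂ := Function.update V₁ .b₁ (W .b₁) with hV₂
  have hp₁ : ∀ j, IsProbabilityMeasure (V₁ j) := hprob V _ inferInstance
  have hp₂ : ∀ j, IsProbabilityMeasure (V₂ j) := hprob V₁ _ hp₁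
  have hV₃ : Function.update V₂ .b₂ (W .b₂) = W := by
    funext i
    cases i <;> simp [hV₂, hV₁, Function.update]
  have e1 := hφ.abs_integral_update_sub_le (V := V) .s (h .s)
  have e2 := hφ.abs_integral_update_sub_le (V := V₁) .b₁ (ν := W .b₁) (η := η)
    (by simpa [hV₁, Function.update] using h .b₁)
  have e3 := hφ.abs_integral_update_sub_le (V := V₂) .b₂ (ν := W .b₂) (η := η)
    (by simpa [hV₂, hV₁, Function.update] using h .b₂)
  rw [hV₃] at e3
  rw [abs_le] at *
  constructor <;> linarith [e1.1, e1.2, e2.1, e2.2, e3.1, e3.2]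

end Swap

end GainsFromTrade

namespace GainsFromTrade

/-! ### Gains from trade at threshold prices -/

open Classical in
/-- The gain of a buyer of value `v`, with values above `1` treated as `1`, from trade with a seller
of value `s` at the price `p`. -/
noncomputable def clippedGain (p : ℝ≥0∞) (s v : ℝ≥0) : ℝ :=
  if Trades p s v then max (min (v : ℝ) 1 - s) 0 else 0

lemma clippedGain_nonneg (p : ℝ≥0∞) (s v : ℝ≥0) : 0 ≤ clippedGain p s v := by
  unfold clippedGain
  split_ifs
  · exact le_max_right _ _
  · exact le_rfl

lemma clippedGain_le_one (p : ℝ≥0∞) (s v : ℝ≥0) : clippedGain p s v ≤ 1 := by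
  unfold clippedGain
  split_ifs
  · exact max_le (by linarith [min_le_right (v : ℝ) 1, s.coe_nonneg]) zero_le_one
  · exact zero_le_one

open Classical in
lemma clippedGain_eq {p : ℝ≥0∞} {s v : ℝ≥0} (hv : v ≤ 1) :
    clippedGain p s v = if Trades p s v then (v : ℝ) - s else 0 := by
  unfold clippedGain
  split_ifs with h
  · have h1 : s ≤ v := ENNReal.coe_le_coe.1 (h.2.trans h.1)
    rw [min_eq_left (by exact_mod_cast hv), max_eq_left (sub_nonneg.2 (NNReal.coe_le_coe.2 h1))]
  · rfl

lemma measurable_clippedGain {f : ℝ≥0 → ℝ≥0∞} (hf : Measurable f) {α : Type*} [MeasurableSpace α]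
    {s v w : α → ℝ≥0} (hs : Measurable s) (hv : Measurable v) (hw : Measurable w) :
    Measurable fun x => clippedGain (f (w x)) (s x) (v x) := by
  refine Measurable.ite ?_ ?_ measurable_const
  · exact (measurableSet_le (hf.comp hw) hv.coe_nnreal_ennreal).inter
      (measurableSet_le hs.coe_nnreal_ennreal (hf.comp hw))
  · exact ((hv.coe_nnreal_real.min measurable_const).sub hs.coe_nnreal_real).max measurable_const

lemma clippedGain_mono_buyer {p : ℝ≥0∞} {s v v' : ℝ≥0} (h : v ≤ v') :
    clippedGain p s v ≤ clippedGain p s v' := by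
  by_cases h1 : Trades p s v
  · have h2 : Trades p s v' := ⟨h1.1.trans (ENNReal.coe_le_coe.2 h), h1.2⟩
    simp only [clippedGain, h1, h2, if_true]
    gcongr
  · simp only [clippedGain, h1, if_false]
    exact clippedGain_nonneg p s v'

lemma clippedGain_anti_seller {p : ℝ≥0∞} {s s' v : ℝ≥0} (h : s ≤ s') :
    clippedGain p s' v ≤ clippedGain p s v := by
  by_cases h1 : Trades p s' v
  · have h2 : Trades p s v := ⟨h1.1, (ENNReal.coe_le_coe.2 h).trans h1.2⟩
    simp only [clippedGain, h1, h2, if_true]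
    gcongr
  · rw [clippedGain, if_neg h1]
    exact clippedGain_nonneg p s v

/-- The other buyer's value `w` acts only through the price. At a positive level the superlevel set
is empty or `{w | s ≤ f w ≤ v}`, an interval because `f` is monotone where finite and finite on an
interval. -/
lemma ordConnected_clippedGain_other {f : ℝ≥0 → ℝ≥0∞} (hf : IntervalMonotone f) (s v : ℝ≥0)
    (t : ℝ) : {w | t ≤ clippedGain (f w) s v}.OrdConnected := by
  rcases le_or_gt t 0 with ht | ht
  · rw [show {w | t ≤ clippedGain (f w) s v} = univ from
      eq_univ_of_forall fun w => ht.trans (clippedGain_nonneg _ _ _)]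
    exact ordConnected_univ
  · have key : ∀ w, t ≤ clippedGain (f w) s v ↔
        Trades (f w) s v ∧ t ≤ max (min (v : ℝ) 1 - s) 0 := by
      intro w
      unfold clippedGain
      split_ifs with h
      · simp [h]
      · simp [h, ht]
    refine ⟨fun w hw w'' hw'' w' hw' => ?_⟩
    obtain ⟨h1, h2⟩ := (key w).1 hw
    obtain ⟨h3, -⟩ := (key w'').1 hw''
    obtain ⟨h4, h5⟩ := hf w w' w'' hw'.1 hw'.2 (ne_top_of_le_ne_top ENNReal.coe_ne_top h1.1)
      (ne_top_of_le_ne_top ENNReal.coe_ne_top h3.1)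
    exact (key w').2 ⟨⟨h5.trans h3.1, h1.2.trans h4⟩, h2⟩

lemma coordQuasiconcave_clippedGain₁ {f : ℝ≥0 → ℝ≥0∞} (hm : Measurable f)
    (hf : IntervalMonotone f) :
    CoordQuasiconcave fun r => clippedGain (f (r .b₂)) (r .s) (r .b₁) where
  meas := measurable_clippedGain hm (measurable_pi_apply _) (measurable_pi_apply _)
    (measurable_pi_apply _)
  nonneg _ := clippedGain_nonneg _ _ _
  le_one _ := clippedGain_le_one _ _ _
  ordConnected i r t := by
    cases i <;> simp only [Function.update, reduceCtorEq, dite_true, dite_false]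
    · exact IsLowerSet.ordConnected fun x y hxy hx => le_trans hx (clippedGain_anti_seller hxy)
    · exact IsUpperSet.ordConnected fun x y hxy hx => le_trans hx (clippedGain_mono_buyer hxy)
    · exact ordConnected_clippedGain_other hf _ _ t

lemma coordQuasiconcave_clippedGain₂ {f : ℝ≥0 → ℝ≥0∞} (hm : Measurable f)
    (hf : IntervalMonotone f) :
    CoordQuasiconcave fun r => clippedGain (f (r .b₁)) (r .s) (r .b₂) where
  meas := measurable_clippedGain hm (measurable_pi_apply _) (measurable_pi_apply _)
    (measurable_pi_apply _)
  nonneg _ := clippedGain_nonneg _ _ _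
  le_one _ := clippedGain_le_one _ _ _
  ordConnected i r t := by
    cases i <;> simp only [Function.update, reduceCtorEq, dite_true, dite_false]
    · exact IsLowerSet.ordConnected fun x y hxy hx => le_trans hx (clippedGain_anti_seller hxy)
    · exact ordConnected_clippedGain_other hf _ _ t
    · exact IsUpperSet.ordConnected fun x y hxy hx => le_trans hx (clippedGain_mono_buyer hxy)

section

variable {V W : Agent → Measure ℝ≥0} [∀ i, IsProbabilityMeasure (V i)]
  [∀ i, IsProbabilityMeasure (W i)]

lemma ae_pi_le_one (hV : ∀ i, ∀ᵐ x ∂(V i), x ≤ 1) : ∀ᵐ r ∂(Measure.pi V), ∀ i, r i ≤ 1 :=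
  ae_all_iff.2 fun i => (Measure.quasiMeasurePreserving_eval V i).ae (hV i)

variable {f₁ f₂ : ℝ≥0 → ℝ≥0∞}

lemma GoodPair.expectedGFT_eq (h : GoodPair f₁ f₂) (hV : ∀ i, ∀ᵐ x ∂(V i), x ≤ 1) :
    (pairMechanism f₁ f₂).expectedGFT (Measure.pi V) =
      ∫ r, clippedGain (f₁ (r .b₂)) (r .s) (r .b₁) ∂(Measure.pi V) +
        ∫ r, clippedGain (f₂ (r .b₁)) (r .s) (r .b₂) ∂(Measure.pi V) := by
  have h1 := coordQuasiconcave_clippedGain₁ h.meas₁ h.mono₁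
  have h2 := coordQuasiconcave_clippedGain₂ h.meas₂ h.mono₂
  rw [← integral_add
    (Integrable.of_mem_Icc 0 1 h1.meas.aemeasurable (ae_of_all _ fun r => ⟨h1.nonneg r, h1.le_one r⟩))
    (Integrable.of_mem_Icc 0 1 h2.meas.aemeasurable
      (ae_of_all _ fun r => ⟨h2.nonneg r, h2.le_one r⟩))]
  refine integral_congr_ae ?_
  filter_upwards [ae_pi_le_one hV] with r hr
  rw [clippedGain_eq (hr _), clippedGain_eq (hr _)]
  conv_lhs => rw [eq_mkProfile r]
  rw [h.disj.gft_eq]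

/-- The gains from trade of a good pair are continuous in the prior. -/
lemma GoodPair.abs_expectedGFT_sub_le (h : GoodPair f₁ f₂) (hV : ∀ i, ∀ᵐ x ∂(V i), x ≤ 1)
    (hW : ∀ i, ∀ᵐ x ∂(W i), x ≤ 1) {η : ℝ}
    (hη : ∀ i, ∀ A : Set ℝ≥0, A.OrdConnected → |(V i).real A - (W i).real A| ≤ η) :
    |(pairMechanism f₁ f₂).expectedGFT (Measure.pi V) -
      (pairMechanism f₁ f₂).expectedGFT (Measure.pi W)| ≤ 6 * η := by
  have h1 := (coordQuasiconcave_clippedGain₁ h.meas₁ h.mono₁).abs_integral_pi_sub_le hη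
  have h2 := (coordQuasiconcave_clippedGain₂ h.meas₂ h.mono₂).abs_integral_pi_sub_le hη
  rw [h.expectedGFT_eq hV, h.expectedGFT_eq hW]
  rw [abs_le] at *
  constructor <;> linarith [h1.1, h1.2, h2.1, h2.2]

end

/-! ### Empirical distributions -/

section

variable {n : ℕ}

lemma isProbabilityMeasure_empirical (hn : 0 < n) (x : ℕ → ℝ≥0) :
    IsProbabilityMeasure (empirical n x) := by
  refine ⟨?_⟩
  simp only [empirical, Measure.smul_apply, Measure.coe_finsetSum, Finset.sum_apply, measure_univ,
    Finset.sum_const, Finset.card_range, nsmul_eq_mul, mul_one, smul_eq_mul]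
  exact ENNReal.inv_mul_cancel (by simpa using hn.ne') (ENNReal.natCast_ne_top n)

lemma ae_empirical_le_one {x : ℕ → ℝ≥0} (hx : ∀ k < n, x k ≤ 1) :
    ∀ᵐ v ∂(empirical n x), v ≤ 1 := by
  refine Measure.ae_smul_measure ?_ _
  rw [ae_iff, Measure.coe_finsetSum, Finset.sum_apply]
  refine Finset.sum_eq_zero fun k hk => ?_
  have h : MeasurableSet {v : ℝ≥0 | ¬ v ≤ 1} := measurableSet_Iic.compl
  rw [Measure.dirac_apply' _ h]
  simpa using hx k (Finset.mem_range.1 hk)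

lemma measureReal_empirical (x : ℕ → ℝ≥0) {A : Set ℝ≥0} (hA : MeasurableSet A) :
    (empirical n x).real A = (∑ k ∈ Finset.range n, A.indicator 1 (x k)) / n := by
  rw [Measure.real, empirical, Measure.smul_apply, Measure.coe_finsetSum, Finset.sum_apply,
    smul_eq_mul, ENNReal.toReal_mul, ENNReal.toReal_sum fun k _ => measure_ne_top _ _,
    ENNReal.toReal_inv, ENNReal.toReal_natCast, div_eq_inv_mul]
  congr 1
  refine Finset.sum_congr rfl fun k _ => ?_
  rw [Measure.dirac_apply' _ hA]
  by_cases h : x k ∈ A <;> simp [h]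

lemma prod_agent {M : Type*} [CommMonoid M] (f : Agent → M) : ∏ i, f i = f .s * (f .b₂ * f .b₁) := by
  rw [show (Finset.univ : Finset Agent) = {.s, .b₂, .b₁} by ext i; cases i <;> simp]
  simp

lemma pi_empirical (hn : 0 < n) (s a b : ℕ → ℝ≥0) :
    (Measure.pi fun i => empirical n (fun k => mkProfile (s k) (a k) (b k) i)) =
      ((n : ℝ≥0∞)⁻¹ * ((n : ℝ≥0∞)⁻¹ * (n : ℝ≥0∞)⁻¹)) • ∑ k ∈ Finset.range n,
        ∑ j ∈ Finset.range n, ∑ i ∈ Finset.range n, Measure.dirac (mkProfile (s k) (a i) (b j)) := by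
  have : ∀ i, IsProbabilityMeasure (empirical n (fun k => mkProfile (s k) (a k) (b k) i)) :=
    fun i => isProbabilityMeasure_empirical hn _
  refine Measure.pi_eq fun A hA => ?_
  rw [prod_agent]
  simp only [empirical, Measure.smul_apply, Measure.coe_finsetSum, Finset.sum_apply, mkProfile_s,
    mkProfile_b₁, mkProfile_b₂, smul_eq_mul]
  rw [mul_mul_mul_comm ((n : ℝ≥0∞)⁻¹) _ ((n : ℝ≥0∞)⁻¹), mul_mul_mul_comm ((n : ℝ≥0∞)⁻¹) _
    ((n : ℝ≥0∞)⁻¹ * (n : ℝ≥0∞)⁻¹), Finset.sum_mul_sum, Finset.sum_mul]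
  congr 1
  refine Finset.sum_congr rfl fun k _ => ?_
  rw [Finset.mul_sum]
  refine Finset.sum_congr rfl fun j _ => ?_
  rw [Finset.mul_sum]
  refine Finset.sum_congr rfl fun i _ => ?_
  rw [Measure.dirac_apply' _ (MeasurableSet.univ_pi hA), Measure.dirac_apply' _ (hA _),
    Measure.dirac_apply' _ (hA _), Measure.dirac_apply' _ (hA _)]
  by_cases h1 : s k ∈ A .s
  · by_cases h2 : a i ∈ A .b₁
    · by_cases h3 : b j ∈ A .b₂
      · have : mkProfile (s k) (a i) (b j) ∈ univ.pi A := by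
          rintro (_ | _ | _) - <;> simpa
        simp [h1, h2, h3, this]
      · have : mkProfile (s k) (a i) (b j) ∉ univ.pi A := fun h => h3 (h .b₂ trivial)
        simp [h3, this]
    · have : mkProfile (s k) (a i) (b j) ∉ univ.pi A := fun h => h2 (h .b₁ trivial)
      simp [h2, this]
  · have : mkProfile (s k) (a i) (b j) ∉ univ.pi A := fun h => h1 (h .s trivial)
    simp [h1, this]

lemma Mechanism.expectedGFT_empirical (M : Mechanism) (hn : 0 < n) (s a b : ℕ → ℝ≥0) :
    M.expectedGFT (Measure.pi fun i => empirical n (fun k => mkProfile (s k) (a k) (b k) i)) =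
      total n s a b (fun s a b => M.gft (mkProfile s a b)) / n ^ 3 := by
  have hint : ∀ r : Profile, Integrable M.gft (Measure.dirac r) := fun r =>
    integrable_dirac (by simp [enorm_lt_top])
  rw [Mechanism.expectedGFT, pi_empirical hn, integral_smul_measure,
    integral_finsetSum_measure fun k _ => integrable_finsetSum_measure.2 fun j _ =>
      integrable_finsetSum_measure.2 fun i _ => hint _]
  simp only [ENNReal.toReal_mul, ENNReal.toReal_inv, ENNReal.toReal_natCast, smul_eq_mul]
  rw [total, div_eq_inv_mul]
  congr 1
  · rw [pow_three, mul_inv, mul_inv]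
  refine Finset.sum_congr rfl fun k _ => ?_
  rw [integral_finsetSum_measure fun j _ => integrable_finsetSum_measure.2 fun i _ => hint _]
  refine Finset.sum_congr rfl fun j _ => ?_
  rw [integral_finsetSum_measure fun i _ => hint _]
  exact Finset.sum_congr rfl fun i _ => integral_dirac _ _

end

end GainsFromTrade

namespace GainsFromTrade

open ProbabilityTheory

/-! ### Concentration -/

section

variable {V : Agent → Measure ℝ≥0} [∀ i, IsProbabilityMeasure (V i)] {n : ℕ}

instance : IsProbabilityMeasure (streamLaw V) := by
  unfold streamLaw
  infer_instance

/-- Profiles made of disjoint sets of samples are independent. -/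
lemma map_streamLaw (e : Agent → Fin n → ℕ) (he : ∀ i, Function.Injective (e i)) :
    (streamLaw V).map (fun ω (k : Fin n) (i : Agent) => ω (i, e i k)) =
      Measure.infinitePi fun _ : Fin n => Measure.pi V := by
  have hinj : Function.Injective fun p : Fin n × Agent => ((p.2, e p.2 p.1) : Agent × ℕ) := by
    rintro ⟨k, i⟩ ⟨l, j⟩ h
    obtain ⟨h1, h2⟩ := Prod.mk.inj h
    simp only at h1 h2
    subst h1
    rw [he _ h2]
  have h1 := Measure.map_infinitePi_infinitePi_of_inj (P := fun x : Agent × ℕ => V x.1) hinj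
  have h2 := Measure.infinitePi_map_curry (fun (_ : Fin n) (i : Agent) => V i)
  simp only [← Measure.infinitePi_eq_pi (μ := V)]
  rw [← h2, ← h1, streamLaw, Measure.map_map (MeasurableEquiv.measurable _) (by fun_prop)]
  rfl

/-- Hoeffding's inequality for averages over profiles made of disjoint sets of samples. -/
lemma streamLaw_sum_le {φ : Profile → ℝ} (hφ : Measurable φ) (h0 : ∀ r, φ r ∈ Icc (0 : ℝ) 1)
    (e : Agent → Fin n → ℕ) (he : ∀ i, Function.Injective (e i)) {η : ℝ} (hη : 0 ≤ η) :
    streamLaw V {ω | ∑ k, φ (fun i => ω (i, e i k)) ≤ n * (∫ r, φ r ∂(Measure.pi V) - η)} ≤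
      ENNReal.ofReal (Real.exp (-(2 * n * η ^ 2))) := by
  rcases Nat.eq_zero_or_pos n with rfl | hn
  · simp
  set ρ := Measure.infinitePi fun _ : Fin n => Measure.pi V with hρ
  set c := ∫ r, φ r ∂(Measure.pi V) with hc
  have hind : iIndepFun (fun (k : Fin n) (T : Fin n → Profile) => c - φ (T k)) ρ :=
    iIndepFun_infinitePi (X := fun _ r => c - φ r) fun _ => measurable_const.sub hφ
  have hev : ∀ k : Fin n, ∫ T, -φ (T k) ∂ρ = -c := by
    intro k
    have h1 := Measure.infinitePi_map_eval (fun _ : Fin n => Measure.pi V) k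
    rw [integral_neg, hc, ← h1, integral_map (measurable_pi_apply k).aemeasurable
      hφ.aestronglyMeasurable]
  have hsub : ∀ k ∈ (Finset.univ : Finset (Fin n)), HasSubgaussianMGF
      (fun T : Fin n → Profile => c - φ (T k)) ((‖(0 : ℝ) - (-1)‖₊ / 2) ^ 2) ρ := by
    intro k _
    -- The variable `-φ` has range `[-1, 0]` of length `1`, so the variance proxy is `1 / 4`; this
    -- gives the factor `2` in the exponent.
    have := hasSubgaussianMGF_of_mem_Icc (μ := ρ) (a := -1) (b := 0) (X := fun T => -φ (T k))
      (hφ.comp (measurable_pi_apply k)).neg.aemeasurable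
      (ae_of_all _ fun T => ⟨neg_le_neg (h0 _).2, neg_nonpos.2 (h0 _).1⟩)
    rw [hev k] at this
    convert this using 2
    ring
  have key := HasSubgaussianMGF.measure_sum_ge_le_of_iIndepFun hind hsub
    (ε := n * η) (by positivity)
  have hS : MeasurableSet {T : Fin n → Profile | n * η ≤ ∑ k, (c - φ (T k))} :=
    measurableSet_le measurable_const (Finset.measurable_sum _ fun k _ =>
      measurable_const.sub (hφ.comp (measurable_pi_apply k)))
  have hT : Measurable fun (ω : SampleStream) (k : Fin n) (i : Agent) => ω (i, e i k) := by
    fun_prop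
  have h3 : {ω : SampleStream | ∑ k, φ (fun i => ω (i, e i k)) ≤ n * (c - η)} =
      (fun ω (k : Fin n) (i : Agent) => ω (i, e i k)) ⁻¹'
        {T : Fin n → Profile | n * η ≤ ∑ k, (c - φ (T k))} := by
    ext ω
    simp only [mem_ofPred_eq, mem_preimage, Finset.sum_sub_distrib, Finset.sum_const,
      Finset.card_univ, Fintype.card_fin, nsmul_eq_mul]
    constructor <;> intro h <;> linarith
  rw [h3, ← Measure.map_apply hT hS, map_streamLaw e he,
    ENNReal.le_ofReal_iff_toReal_le (measure_ne_top _ _) (Real.exp_nonneg _)]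
  refine key.trans (Real.exp_le_exp.2 (le_of_eq ?_))
  have hn' : (n : ℝ) ≠ 0 := by positivity
  simp only [Finset.sum_const, Finset.card_univ, Fintype.card_fin, nsmul_eq_mul]
  push_cast
  simp only [Real.norm_eq_abs]
  norm_num
  field_simp
  norm_num

/-- The empirical frequency is an average over the main diagonal of a function of one coordinate. -/
lemma streamLaw_empirical_le (hn : 0 < n) (i : Agent) {A : Set ℝ≥0} (hA : MeasurableSet A) {η : ℝ}
    (hη : 0 ≤ η) :
    streamLaw V {ω | (empirical n fun k => ω (i, k)).real A ≤ (V i).real A - η} ≤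
      ENNReal.ofReal (Real.exp (-(2 * n * η ^ 2))) := by
  have hn' : (0 : ℝ) < n := Nat.cast_pos.2 hn
  have h1 : ∫ r : Profile, A.indicator 1 (r i) ∂(Measure.pi V) = (V i).real A := by
    have := (measurePreserving_eval V i).map_eq
    rw [← integral_indicator_one hA, ← this, integral_map (measurable_pi_apply i).aemeasurable
      (measurable_one.indicator hA).aestronglyMeasurable]
  have h2 := streamLaw_sum_le (V := V) (n := n) (φ := fun r => A.indicator 1 (r i))
    ((measurable_one.indicator hA).comp (measurable_pi_apply i))
    (fun r => ⟨indicator_nonneg (fun _ _ => zero_le_one) _,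
      indicator_le_self' (fun _ _ => zero_le_one) _⟩) (fun _ k => k)
    (fun _ => Fin.val_injective) hη
  refine le_trans (measure_mono fun ω hω => ?_) h2
  simp only [mem_ofPred_eq] at hω ⊢
  rw [measureReal_empirical _ hA, div_le_iff₀ hn'] at hω
  rw [h1, Fin.sum_univ_eq_sum_range fun k => A.indicator 1 (ω (i, k)), mul_comm]
  exact hω

end

/-- A sum over a cube as a sum over the diagonals. -/
lemma total_eq_sum_diagonals (n : ℕ) [NeZero n] (s a b : ℕ → ℝ≥0)
    (F : ℝ≥0 → ℝ≥0 → ℝ≥0 → ℝ) :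
    total n s a b F = ∑ c : Fin n, ∑ d : Fin n, ∑ k : Fin n,
      F (s k) (a (k + d : Fin n)) (b (k + c : Fin n)) := by
  rw [total]
  simp only [Finset.sum_range]
  have h : ∀ (k : Fin n) (g : Fin n → ℝ), ∑ c, g (k + c) = ∑ j, g j := fun k g =>
    Equiv.sum_comp (Equiv.addLeft k) g
  calc _ = ∑ k : Fin n, ∑ c : Fin n, ∑ d : Fin n,
        F (s k) (a (k + d : Fin n)) (b (k + c : Fin n)) := by
        refine Finset.sum_congr rfl fun k _ => ?_
        rw [← h k]
        exact Finset.sum_congr rfl fun c _ => (h k fun i => F _ (a i) _).symm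
    _ = ∑ c : Fin n, ∑ k : Fin n, ∑ d : Fin n,
        F (s k) (a (k + d : Fin n)) (b (k + c : Fin n)) := Finset.sum_comm
    _ = _ := Finset.sum_congr rfl fun c _ => Finset.sum_comm

/-! ### Typical samples and the transfer to the prior -/

section

variable {V : Agent → Measure ℝ≥0} [∀ i, IsProbabilityMeasure (V i)] {n : ℕ}

/-- The indices of the samples on the diagonal with offsets `c` and `d`. -/
def diagonal [NeZero n] (c d : Fin n) : Agent → Fin n → ℕ
  | .s, k => k
  | .b₁, k => (k + d : Fin n)
  | .b₂, k => (k + c : Fin n)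

lemma diagonal_injective [NeZero n] (c d : Fin n) (i : Agent) :
    Function.Injective (diagonal c d i) := by
  intro k l h
  cases i
  · exact Fin.val_injective h
  · exact add_right_cancel (Fin.val_injective h)
  · exact add_right_cancel (Fin.val_injective h)

/-- The samples on which empirical estimates are off by at least `η`. -/
def Atypical (V : Agent → Measure ℝ≥0) (n K : ℕ) [NeZero n] (φ : Profile → ℝ) (η : ℝ) :
    Set SampleStream :=
  (⋃ p : Fin n × Fin n, {ω | ∑ k, φ (fun i => ω (i, diagonal p.1 p.2 i k)) ≤
    n * (∫ r, φ r ∂(Measure.pi V) - η)}) ∪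
  ((⋃ p : Agent × Fin K, {ω | (empirical n fun k => ω (p.1, k)).real
      (innerBracket (V p.1) (p.2 / K)) ≤ (V p.1).real (innerBracket (V p.1) (p.2 / K)) - η}) ∪
    -- Hoeffding's inequality is used only as a lower bound for frequencies; the upper bound for an
    -- outer bracket comes from its complement.
    ⋃ p : Agent × Fin K, {ω | (empirical n fun k => ω (p.1, k)).real
      (outerBracket (V p.1) ((p.2 + 1) / K))ᶜ ≤
        (V p.1).real (outerBracket (V p.1) ((p.2 + 1) / K))ᶜ - η})

lemma measure_iUnion_le_card {α ι : Type*} [Fintype ι] [MeasurableSpace α] {μ : Measure α}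
    {s : ι → Set α} {c : ℝ≥0∞} (h : ∀ i, μ (s i) ≤ c) : μ (⋃ i, s i) ≤ Fintype.card ι * c := by
  refine (measure_iUnion_fintype_le μ s).trans ((Finset.sum_le_sum fun i _ => h i).trans ?_)
  simp

/-- A union bound over `n ^ 2` diagonals and, for each of the three agents, `K` inner and `K` outer
brackets. -/
lemma streamLaw_atypical_le [NeZero n] (K : ℕ) {φ : Profile → ℝ} (hφ : Measurable φ)
    (h0 : ∀ r, φ r ∈ Icc (0 : ℝ) 1) {η : ℝ} (hη : 0 ≤ η) :
    streamLaw V (Atypical V n K φ η) ≤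
      ((n ^ 2 + 6 * K : ℕ) : ℝ≥0∞) * ENNReal.ofReal (Real.exp (-(2 * n * η ^ 2))) := by
  have hn : 0 < n := Nat.pos_of_ne_zero (NeZero.ne n)
  have hcard : Fintype.card Agent = 3 := rfl
  set c := ENNReal.ofReal (Real.exp (-(2 * n * η ^ 2))) with hc
  have h1 : streamLaw V (Atypical V n K φ η) ≤ (Fintype.card (Fin n × Fin n) : ℝ≥0∞) * c +
      ((Fintype.card (Agent × Fin K) : ℝ≥0∞) * c + (Fintype.card (Agent × Fin K) : ℝ≥0∞) * c) := by
    unfold Atypical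
    refine (measure_union_le _ _).trans (add_le_add ?_ ((measure_union_le _ _).trans
      (add_le_add ?_ ?_)))
    · exact measure_iUnion_le_card fun p =>
        streamLaw_sum_le hφ h0 (diagonal p.1 p.2) (diagonal_injective p.1 p.2) hη
    · exact measure_iUnion_le_card fun p =>
        streamLaw_empirical_le hn p.1 (measurableSet_innerBracket _) hη
    · exact measure_iUnion_le_card fun p =>
        streamLaw_empirical_le hn p.1 (measurableSet_outerBracket _).compl hη
  refine h1.trans (le_of_eq ?_)
  rw [← add_mul, ← add_mul]
  congr 1
  simp only [Fintype.card_prod, Fintype.card_fin, hcard]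
  norm_cast
  ring

/-- Bounded gains from trade. -/
noncomputable def Mechanism.boundedGFT (M : Mechanism) (r : Profile) : ℝ := min (M.gft r) 1

lemma Mechanism.measurable_gft {M : Mechanism} (hM : Measurable M.alloc) : Measurable M.gft := by
  unfold Mechanism.gft
  have h : ∀ i : Agent, MeasurableSet {r | M.alloc r = i} := fun i => hM (MeasurableSet.of_discrete
    (s := {i}))
  have hm : ∀ i : Agent, Measurable fun r : Profile => (r i : ℝ) := fun i =>
    (measurable_pi_apply i).coe_nnreal_real
  exact (Measurable.ite (h _) ((hm _).sub (hm _)) measurable_const).add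
    (Measurable.ite (h _) ((hm _).sub (hm _)) measurable_const)

/-- For typical samples, a good pair that is at least as good as `M` for the empirical
distributions is nearly as good as `M` for the prior. -/
lemma expectedGFT_sub_le_of_not_atypical [NeZero n] {K : ℕ} (hK : 0 < K)
    (hV : ∀ i, ∀ᵐ x ∂(V i), x ≤ 1) {M : Mechanism} {η : ℝ} {ω : SampleStream}
    (hω : ω ∉ Atypical V n K M.boundedGFT η) (hω1 : ∀ x, ω x ≤ 1)
    {f₁ f₂ : ℝ≥0 → ℝ≥0∞} (hf : GoodPair f₁ f₂)
    (hopt : total n (fun k => ω (.s, k)) (fun k => ω (.b₁, k)) (fun k => ω (.b₂, k))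
        (fun s a b => M.gft (mkProfile s a b)) ≤
      total n (fun k => ω (.s, k)) (fun k => ω (.b₁, k)) (fun k => ω (.b₂, k))
        (fun s a b => (pairMechanism f₁ f₂).gft (mkProfile s a b))) :
    M.expectedGFT (Measure.pi V) - (13 * η + 12 / K) ≤
      (pairMechanism f₁ f₂).expectedGFT (Measure.pi V) := by
  have hn : 0 < n := Nat.pos_of_ne_zero (NeZero.ne n)
  have hn' : (0 : ℝ) < n := Nat.cast_pos.2 hn
  simp only [Atypical, mem_union, mem_iUnion, not_or, not_exists, mem_ofPred_eq, not_le] at hω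
  obtain ⟨h1, h2, h3⟩ := hω
  set E : Agent → Measure ℝ≥0 := fun i => empirical n fun k => ω (i, k) with hE
  have hEp : ∀ i, IsProbabilityMeasure (E i) := fun i => isProbabilityMeasure_empirical hn _
  have hE1 : ∀ i, ∀ᵐ x ∂(E i), x ≤ 1 := fun i => ae_empirical_le_one fun k _ => hω1 _
  have hE2 : E = fun i => empirical n fun k =>
      mkProfile (ω (.s, k)) (ω (.b₁, k)) (ω (.b₂, k)) i := by
    funext i
    cases i <;> rfl
  have hbracket : ∀ i, ∀ A : Set ℝ≥0, A.OrdConnected →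
      |(V i).real A - (E i).real A| ≤ 2 * (η + 1 / K) := by
    intro i A hA
    refine abs_sub_le_of_ordConnected (fun U hU => abs_sub_le_of_upperSet hK ?_ ?_ hU) hA
    · intro k hk
      have := h3 (i, ⟨k, hk⟩)
      rw [probReal_compl_eq_one_sub (measurableSet_outerBracket _),
        probReal_compl_eq_one_sub (measurableSet_outerBracket _)] at this
      simp only at this
      change (E i).real _ ≤ _
      linarith
    · intro k hk
      exact (h2 (i, ⟨k, hk⟩)).le
  -- The error here is `6 * (2 * (η + 1 / K))`; one further `η` comes from the concentration of `M`.
  have hpair := (abs_le.1 (hf.abs_expectedGFT_sub_le hV hE1 hbracket)).1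
  have hb : ∀ r : Profile, (∀ i, r i ≤ 1) → M.boundedGFT r = M.gft r := fun r hr =>
    min_eq_left (M.gft_le_one hr)
  have hMV : M.expectedGFT (Measure.pi V) = ∫ r, M.boundedGFT r ∂(Measure.pi V) := by
    refine integral_congr_ae ?_
    filter_upwards [ae_pi_le_one hV] with r hr using (hb r hr).symm
  -- Adding the `n ^ 2` diagonal estimates bounds the sum over the full cube, although its triples
  -- are not independent.
  have htot : (n : ℝ) ^ 3 * (M.expectedGFT (Measure.pi V) - η) ≤
      total n (fun k => ω (.s, k)) (fun k => ω (.b₁, k)) (fun k => ω (.b₂, k))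
        (fun s a b => M.gft (mkProfile s a b)) := by
    rw [total_eq_sum_diagonals, hMV]
    calc (n : ℝ) ^ 3 * (∫ r, M.boundedGFT r ∂(Measure.pi V) - η)
        = ∑ _c : Fin n, ∑ _d : Fin n, (n : ℝ) * (∫ r, M.boundedGFT r ∂(Measure.pi V) - η) := by
          simp only [Finset.sum_const, Finset.card_univ, Fintype.card_fin, nsmul_eq_mul]
          ring
      _ ≤ _ := by
          refine Finset.sum_le_sum fun c _ => Finset.sum_le_sum fun d _ => (h1 (c, d)).le.trans
            (le_of_eq (Finset.sum_congr rfl fun k _ => ?_))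
          rw [hb _ fun i => hω1 _]
          congr 1
          funext i
          cases i <;> rfl
  have hemp : M.expectedGFT (Measure.pi V) - η ≤ (pairMechanism f₁ f₂).expectedGFT
      (Measure.pi E) := by
    rw [hE2, Mechanism.expectedGFT_empirical _ hn, le_div_iff₀ (by positivity), mul_comm]
    exact htot.trans hopt
  have : (12 : ℝ) / K = 12 * (1 / K) := by ring
  linarith

end

end GainsFromTrade

namespace GainsFromTrade

/-! ### The number of samples -/

/-- The bound `x ^ 2 + 5` stays positive even if `x` is negative, which can happen for large `ε` or
`δ`. In the main case `2 * x + 3` dominates `1 / ε`, and `2 ^ (2 * x + 3)` dominates `1 / (ε * δ)`.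
-/
lemma exists_isLeast_suffices {ε δ : ℝ} (hε : 0 < ε) (hδ : 0 < δ) :
    ∃ m : ℕ, IsLeast {k | Suffices ε δ k} m ∧
      (m : ℝ) ≤ (1 / ε * Real.log (1 / (ε * δ))) ^ 2 + 5 := by
  set x := 1 / ε * Real.log (1 / (ε * δ)) with hx
  obtain ⟨k, hk, hkx⟩ : ∃ k, Suffices ε δ k ∧ (k : ℝ) ≤ x ^ 2 + 5 := by
    by_cases h1 : 1 ≤ ε
    · exact ⟨0, Or.inl h1, by push_cast; positivity⟩
    by_cases h2 : 1 ≤ δ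
    · exact ⟨0, Or.inr (Or.inl h2), by push_cast; positivity⟩
    push Not at h1 h2
    have hεδ : 0 < ε * δ := mul_pos hε hδ
    set L := Real.log (1 / (ε * δ)) with hL
    have hLe : 1 / ε ≤ Real.exp L := by
      rw [hL, Real.exp_log (by positivity)]
      exact one_div_le_one_div_of_le hεδ (by nlinarith)
    have hL0 : 0 < L := Real.log_pos (by rw [lt_div_iff₀ hεδ]; nlinarith)
    have hε1 : 1 ≤ 1 / ε := by rw [le_div_iff₀ hε]; linarith
    have hLx : L ≤ x := le_mul_of_one_le_left hL0.le hε1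
    have hxε : 1 / ε ≤ 2 * x + 3 := by
      -- For `L ≥ 1` one has `1 / ε ≤ x`; for `L < 1` the number `1 / ε` is below `e < 3`.
      rcases le_or_gt 1 L with h | h
      · have : 1 / ε ≤ x := le_mul_of_one_le_right (by positivity) h
        linarith
      · have h3 := Real.exp_le_exp.2 h.le
        have h4 := Real.exp_one_lt_d9
        linarith
    refine ⟨⌈2 * x + 3⌉₊, Or.inr (Or.inr ⟨?_, ?_⟩), ?_⟩
    · have := hxε.trans (Nat.le_ceil _)
      rwa [div_le_iff₀ hε] at this
    · have h3 : L ≤ ⌈2 * x + 3⌉₊ * Real.log 2 := by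
        have h4 := Real.log_two_gt_d9
        have h5 := Nat.le_ceil (2 * x + 3)
        nlinarith
      have h6 : 1 / (ε * δ) ≤ 2 ^ ⌈2 * x + 3⌉₊ := by
        rw [← Real.log_le_log_iff (by positivity) (by positivity), Real.log_pow]
        exact h3
      rw [div_le_iff₀ hεδ] at h6
      linarith
    · have h5 := (Nat.ceil_lt_add_one (show 0 ≤ 2 * x + 3 by linarith)).le
      -- The ceiling is at most `2 * x + 4 ≤ x ^ 2 + 5`.
      nlinarith [sq_nonneg (x - 1)]
  classical
  have hne : ∃ k, Suffices ε δ k := ⟨k, hk⟩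
  refine ⟨Nat.find hne, ⟨Nat.find_spec hne, fun l hl => Nat.find_min' hne hl⟩, ?_⟩
  exact (Nat.cast_le.2 (Nat.find_min' hne hk)).trans hkx

open Polynomial in
/-- A bound for the number of samples. -/
noncomputable def samplePolynomial : ℝ[X] := C 51200 * (X ^ 2 + C 5) ^ 3

open Polynomial in
/-- A bound for the running time. -/
noncomputable def timePolynomial : ℝ[X] := C 200 * (samplePolynomial + C 1) ^ 3

lemma sampleSize_le_eval {m : ℕ} {x : ℝ} (h : (m : ℝ) ≤ x ^ 2 + 5) :
    (sampleSize m : ℝ) ≤ samplePolynomial.eval x := by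
  simp only [sampleSize, samplePolynomial, Polynomial.eval_mul, Polynomial.eval_C,
    Polynomial.eval_pow, Polynomial.eval_add, Polynomial.eval_X, Nat.cast_max]
  push_cast
  refine max_le ?_ (by gcongr)
  have : (1 : ℝ) ≤ (x ^ 2 + 5) ^ 3 := one_le_pow₀ (by nlinarith [sq_nonneg x])
  linarith

lemma time_le_eval {m t : ℕ} {x : ℝ} (h : (m : ℝ) ≤ x ^ 2 + 5)
    (ht : t ≤ 200 * (sampleSize m + 1) ^ 3) : (t : ℝ) ≤ timePolynomial.eval x := by
  have h1 : (t : ℝ) ≤ 200 * ((sampleSize m : ℝ) + 1) ^ 3 := by exact_mod_cast ht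
  refine h1.trans ?_
  simp only [timePolynomial, Polynomial.eval_mul, Polynomial.eval_C, Polynomial.eval_pow,
    Polynomial.eval_add]
  have := sampleSize_le_eval h
  gcongr

/-- The failure probability is small. -/
lemma failure_bound {m : ℕ} (hm : 0 < m) {η : ℝ} (hη : η = 1 / (40 * m : ℕ)) :
    ((sampleSize m ^ 2 + 6 * (40 * m) : ℕ) : ℝ) * Real.exp (-(2 * sampleSize m * η ^ 2)) ≤
      (1 / 2) ^ m := by
  have hsize : sampleSize m = 51200 * m ^ 3 :=
    max_eq_right (Nat.mul_pos (by norm_num) (pow_pos hm 3))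
  have hm' : (m : ℝ) ≠ 0 := by positivity
  have h1 : Real.exp (-(2 * sampleSize m * η ^ 2)) ≤ (1 / 2) ^ (64 * m) := by
    -- The constant `51200` is chosen so that `2 * 51200 * m ^ 3 / (40 * m) ^ 2 = 64 * m`.
    have h2 : -(2 * sampleSize m * η ^ 2) = (64 * m : ℕ) * (-1 : ℝ) := by
      rw [hsize, hη]
      push_cast
      field_simp
      norm_num
    rw [h2, Real.exp_nat_mul]
    refine pow_le_pow_left₀ (Real.exp_nonneg _) ?_ _
    rw [Real.exp_neg, one_div]
    exact inv_anti₀ (by norm_num) (by linarith [Real.add_one_le_exp 1])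
  -- The number of events uses up `63 * m` of the `64 * m` factors `1 / 2`; the remaining `m` are
  -- the bound.
  have h3 : sampleSize m ^ 2 + 6 * (40 * m) ≤ 2 ^ (63 * m) := by
    rw [hsize]
    have h4 : m ≤ 2 ^ m := Nat.lt_two_pow_self.le
    have h5 : 2 ≤ 2 ^ m := Nat.le_self_pow hm.ne' 2
    rw [pow_mul']
    generalize 2 ^ m = u at *
    have h6 : 51200 ≤ u ^ 16 := le_trans (by norm_num) (Nat.pow_le_pow_left h5 16)
    have h7 : 240 ≤ u ^ 8 := le_trans (by norm_num) (Nat.pow_le_pow_left h5 8)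
    calc (51200 * m ^ 3) ^ 2 + 6 * (40 * m) = (51200 * m ^ 3) ^ 2 + 240 * m := by ring
      _ ≤ (u ^ 16 * u ^ 3) ^ 2 + u ^ 8 * u := by gcongr
      _ = u ^ 38 + u ^ 9 := by ring
      _ ≤ u ^ 38 + u ^ 38 := by gcongr <;> omega
      _ = 2 * u ^ 38 := by ring
      _ ≤ u * u ^ 38 := by gcongr
      _ = u ^ 39 := by ring
      _ ≤ u ^ 63 := Nat.pow_le_pow_right (by omega) (by norm_num)
  calc _ ≤ (2 : ℝ) ^ (63 * m) * (1 / 2) ^ (64 * m) :=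
        mul_le_mul (by exact_mod_cast h3) h1 (Real.exp_nonneg _) (by positivity)
    _ = (1 / 2) ^ m := by
        rw [show 64 * m = 63 * m + m by ring, pow_add, ← mul_assoc, ← mul_pow]
        norm_num

/-! ### The output for the prior -/

section

variable {V : Agent → Measure ℝ≥0} [∀ i, IsProbabilityMeasure (V i)]

lemma Mechanism.IsSimple.expectedGFT_nonneg {M : Mechanism} (hM : M.IsSimple)
    (μ : Measure Profile) : 0 ≤ M.expectedGFT μ := integral_nonneg fun r => hM.gft_nonneg r

lemma Mechanism.boundedGFT_mem_Icc {M : Mechanism} (hM : M.IsSimple) (r : Profile) :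
    M.boundedGFT r ∈ Icc (0 : ℝ) 1 := ⟨le_min (hM.gft_nonneg r) zero_le_one, min_le_right _ _⟩

lemma Mechanism.expectedGFT_le_one {M : Mechanism} (hM : M.IsSimple) (ha : Measurable M.alloc)
    (hV : ∀ i, ∀ᵐ x ∂(V i), x ≤ 1) : M.expectedGFT (Measure.pi V) ≤ 1 := by
  have h1 : M.expectedGFT (Measure.pi V) = ∫ r, M.boundedGFT r ∂(Measure.pi V) := by
    refine integral_congr_ae ?_
    filter_upwards [ae_pi_le_one hV] with r hr using (min_eq_left (M.gft_le_one hr)).symm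
  have hm : Measurable M.boundedGFT := (measurable_gft ha).min measurable_const
  rw [h1]
  calc _ ≤ ∫ _r, (1 : ℝ) ∂(Measure.pi V) := integral_mono
        (Integrable.of_mem_Icc 0 1 hm.aemeasurable (ae_of_all _ (boundedGFT_mem_Icc hM)))
        (integrable_const _) fun r => (boundedGFT_mem_Icc hM r).2
    _ = 1 := by simp

lemma ae_streamLaw_le_one (hV : ∀ i, ∀ᵐ x ∂(V i), x ≤ 1) :
    streamLaw V {ω | ¬ ∀ x, ω x ≤ 1} = 0 := by
  refine ae_iff.1 (ae_all_iff.2 fun x => ?_)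
  exact (measurePreserving_eval_infinitePi (fun x : Agent × ℕ => V x.1) x).quasiMeasurePreserving.ae
    (hV x.1)

/-- The benchmark mechanism is chosen from the prior alone, before sampling, so concentration is
needed only for it; the random output is covered by uniform convergence. Large `ε` or `δ` is
trivial, because the optimum lies in `[0, 1]` and probabilities are at most `1`. -/
theorem streamLaw_mainProg_fails_le (hV : ∀ i, ∀ᵐ x ∂(V i), x ≤ 1) {ε δ : ℝ} (hε : 0 < ε)
    (hδ : 0 < δ) :
    streamLaw V {ω | ¬ ∃ (t : ℕ) (σ : State), Exec ω mainProg (inputState ε δ) t σ ∧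
      optSimple (Measure.pi V) - ε ≤ σ.outputMechanism.expectedGFT (Measure.pi V)} ≤
    ENNReal.ofReal δ := by
  obtain ⟨m, hm, -⟩ := exists_isLeast_suffices hε hδ
  set S := {g | ∃ M : Mechanism, M.IsSimple ∧ Measurable M.alloc ∧
    g = M.expectedGFT (Measure.pi V)} with hS
  have hne : S.Nonempty := by
    obtain ⟨t, σ, -, -, -, hg, -⟩ := mainProg_output (fun _ => 0) hm
    exact ⟨_, _, hg.disj.isSimple, hg.disj.measurable_alloc hg.meas₁ hg.meas₂, rfl⟩
  have hle : optSimple (Measure.pi V) ≤ 1 := csSup_le hne (by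
    rintro _ ⟨M, h1, h2, rfl⟩
    exact Mechanism.expectedGFT_le_one h1 h2 hV)
  by_cases hε1 : 1 ≤ ε
  · refine (measure_mono_null (t := ∅) (fun ω hω => (hω ?_).elim) measure_empty).trans_le bot_le
    obtain ⟨t, σ, h3, -, -, hg, -⟩ := mainProg_output ω hm
    refine ⟨t, σ, h3, le_trans ?_ (hg.disj.isSimple.expectedGFT_nonneg _)⟩
    linarith
  rcases hm.1 with h1 | h1 | ⟨h1, h2⟩
  · exact absurd h1 hε1
  · refine prob_le_one.trans ?_
    rwa [ENNReal.one_le_ofReal]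
  · have hm0 : 0 < m := by
      rcases Nat.eq_zero_or_pos m with rfl | h
      · norm_num at h1
      · exact h
    set n := sampleSize m with hn
    have hn0 : NeZero n := ⟨(lt_of_lt_of_le one_pos (le_max_left _ _)).ne'⟩
    -- The supremum need not be attained; a quarter of `ε` pays for a near-maximizer.
    obtain ⟨_, ⟨M, hM, ha, rfl⟩, hMopt⟩ := exists_lt_of_lt_csSup hne
      (show optSimple (Measure.pi V) - ε / 4 < sSup S from sub_lt_self _ (by linarith))
    obtain ⟨η, hη⟩ : ∃ η : ℝ, η = 1 / (40 * m : ℕ) := ⟨_, rfl⟩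
    have hη0 : 0 ≤ η := hη ▸ by positivity
    have hbad := streamLaw_atypical_le (V := V) (n := n) (40 * m)
      ((Mechanism.measurable_gft ha).min measurable_const) (Mechanism.boundedGFT_mem_Icc hM) hη0
    have hδ' : ((n ^ 2 + 6 * (40 * m) : ℕ) : ℝ≥0∞) *
        ENNReal.ofReal (Real.exp (-(2 * n * η ^ 2))) ≤ ENNReal.ofReal δ := by
      rw [← ENNReal.ofReal_natCast, ← ENNReal.ofReal_mul (Nat.cast_nonneg _)]
      refine ENNReal.ofReal_le_ofReal ((failure_bound hm0 hη).trans ?_)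
      rw [one_div, inv_pow, inv_le_iff_one_le_mul₀ (by positivity)]
      refine h2.trans ?_
      -- The failure bound is even at most `ε * δ`, and `ε < 1` is discarded.
      have : (2 : ℝ) ^ m * ε * δ ≤ 2 ^ m * 1 * δ := by
        gcongr
        exact (not_le.1 hε1).le
      linarith
    refine le_trans (measure_mono (t := {ω | ¬ ∀ x, ω x ≤ 1} ∪
      Atypical V n (40 * m) M.boundedGFT η) fun ω hω => ?_) ((measure_union_le _ _).trans
      (by rw [ae_streamLaw_le_one hV, zero_add]; exact hbad.trans hδ'))
    by_contra hω'
    simp only [mem_union, not_or, mem_ofPred_eq, not_not] at hω'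
    refine hω ?_
    obtain ⟨t, σ, h3, -, -, hg, hopt⟩ := mainProg_output ω hm
    refine ⟨t, σ, h3, ?_⟩
    have h4 := expectedGFT_sub_le_of_not_atypical (by omega) hV hω'.2 hω'.1 hg (hopt M hM)
    -- With `η = 1 / K` and `K = 40 * m` the error is `25 / (40 * m) ≤ (5 / 8) * ε`, because `1 ≤ m
    -- * ε`.
    have h5 : (13 * η + 12 / ((40 * m : ℕ) : ℝ)) ≤ 3 / 4 * ε := by
      have hm' : (0 : ℝ) < m := Nat.cast_pos.2 hm0
      rw [hη]
      push_cast
      rw [show 13 * (1 / (40 * (m : ℝ))) + 12 / (40 * m) = (25 / 40) / m by field_simp; norm_num,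
        div_le_iff₀ hm']
      nlinarith
    change optSimple (Measure.pi V) - ε ≤ (pairMechanism (σ.outputFunction 1)
      (σ.outputFunction 2)).expectedGFT (Measure.pi V)
    linarith

end

/-- The output is optimal for the empirical distributions. -/
lemma expectedGFT_le_of_total_le {n : ℕ} (hn : 0 < n) {ω : SampleStream} {d : Agent → ℕ}
    (hd : ∀ i, d i = n) {M M' : Mechanism}
    (h : total n (fun k => ω (.s, k)) (fun k => ω (.b₁, k)) (fun k => ω (.b₂, k))
        (fun s a b => M.gft (mkProfile s a b)) ≤
      total n (fun k => ω (.s, k)) (fun k => ω (.b₁, k)) (fun k => ω (.b₂, k))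
        (fun s a b => M'.gft (mkProfile s a b))) :
    M.expectedGFT (Measure.pi fun i => empirical (d i) fun k => ω (i, k)) ≤
      M'.expectedGFT (Measure.pi fun i => empirical (d i) fun k => ω (i, k)) := by
  have : (fun i => empirical (d i) fun k => ω (i, k)) = fun i => empirical n fun k =>
      mkProfile (ω (.s, k)) (ω (.b₁, k)) (ω (.b₂, k)) i := by
    funext i
    cases i <;> rw [hd] <;> rfl
  rw [this, Mechanism.expectedGFT_empirical _ hn, Mechanism.expectedGFT_empirical _ hn]
  gcongr

end GainsFromTrade

theorem mainTheorem4 :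
    ∃ (prog : Program) (samplePoly timePoly : Polynomial ℝ),
      ∀ (ε δ : ℝ), 0 < ε → 0 < δ →
        -- on all samples with values in `[0, 1]`
        (∀ ω : SampleStream, (∀ x, ω x ≤ 1) →
          ∃ (t : ℕ) (σ : State), Exec ω prog (inputState ε δ) t σ ∧
            -- running time
            (t : ℝ) ≤ timePoly.eval (1 / ε * Real.log (1 / (ε * δ))) ∧
            -- number of samples from each of the three distributions
            (∀ i, 0 < σ.drawn i ∧
              (σ.drawn i : ℝ) ≤ samplePoly.eval (1 / ε * Real.log (1 / (ε * δ)))) ∧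
            -- the output is a simple mechanism given by a compatible pair
            Compatible (σ.outputFunction 1) (σ.outputFunction 2) ∧
            σ.outputMechanism.IsSimple ∧ Measurable σ.outputMechanism.alloc ∧
            -- it is optimal for the empirical product distribution
            (∀ M : Mechanism, M.IsSimple → Measurable M.alloc →
              M.expectedGFT (σ.empiricalProduct ω) ≤
                σ.outputMechanism.expectedGFT (σ.empiricalProduct ω))) ∧
        -- the failure probability is at most `δ`
        (∀ V : Agent → Measure ℝ≥0, (∀ i, IsProbabilityMeasure (V i)) →
          (∀ i, ∀ᵐ x ∂(V i), x ≤ 1) →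
          streamLaw V {ω | ¬ ∃ (t : ℕ) (σ : State), Exec ω prog (inputState ε δ) t σ ∧
              optSimple (Measure.pi V) - ε ≤ σ.outputMechanism.expectedGFT (Measure.pi V)} ≤
            ENNReal.ofReal δ) := by
  refine ⟨mainProg, samplePolynomial, timePolynomial, fun ε δ hε hδ => ⟨fun ω _ => ?_,
    fun V _ hV => streamLaw_mainProg_fails_le hV hε hδ⟩⟩
  obtain ⟨m, hm, hmx⟩ := exists_isLeast_suffices hε hδ
  obtain ⟨t, σ, h1, h2, h3, h4, h5⟩ := mainProg_output ω hm
  have hn : 0 < sampleSize m := lt_of_lt_of_le one_pos (le_max_left _ _)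
  exact ⟨t, σ, h1, time_le_eval hmx h2,
    fun i => ⟨(h3 i).symm ▸ hn, (h3 i).symm ▸ sampleSize_le_eval hmx⟩, h4.disj.compatible,
    h4.disj.isSimple, h4.disj.measurable_alloc h4.meas₁ h4.meas₂,
    fun M hM _ => expectedGFT_le_of_total_le hn h3 (h5 M hM)⟩
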